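/- Let $d\ge 2$, and let $G$ be the semigroup of $d\times d$ real matrices with nonnegative entries having a strictly positive entry in every row and in every column; $G^+\subset G$ is the set of matrices with strictly positive entries. Equip $\mathbb R^d$ with the $\ell^1$ norm, $G$ with the operator norm $\|g\|$, and let $S^+=\{x\in\mathbb R^d:\ \|x\|=1,\ x_i\ge 0\ \forall i\}$ carry the metric $d(x,y)=\varphi(m(x,y)m(y,x))$, where $\varphi(s)=\frac{1-s}{1+s}$ and $m(u,v)=\inf\{u_i/v_i:\ v_i>0\}$; continuity and Borel sets on $S^+$ refer to this metric. For $g\in G$, $x\in S^+$ put $g\cdot x=gx/\|gx\|$, $\sigma(g,x)=\log\|gx\|$, $v(g)=\inf_{x\in S^+}\|gx\|$, $N(g)=\max(\|g\|,1/v(g))$, and let $\kappa(g)$ be the spectral radius of $g$. Let $\mu$ be a Borel probability measure on $G$ that is strictly contracting, i.e. $\mu^{*r}(G^+)>0$ for some integer $r\ge1$, and that has a moment of order $2$, i.e. $\int_G(\log N(g))^2\,d\mu(g)<\infty$. Then there is a unique $\mu$-invariant Borel probability measure $\nu$ on $S^+$ (that is, $\int f(g\cdot x)\,d\mu(g)\,d\nu(x)=\int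 f\,d\nu$ for all Borel $f\ge0$). Let $\lambda_\mu=\lim_n \frac1n\int_G\log\|g\|\,d\mu^{*n}(g)$ be the Lyapunov exponent. There are a number $s^2\ge0$ and a bounded continuous function $\psi:S^+\to\mathbb R$ such that, for every sequence $(Y_n)_{n\ge1}$ of i.i.d. random matrices with law $\mu$ and every random variable $W_0$ with law $\nu$ independent of $(Y_n)_{n\ge1}$, writing $A_n=Y_n\cdots Y_1$: 1. $\log\|A_n\|$ is integrable for every $n$, and $\frac1n\log\|A_n\|\to\lambda_\mu$ in $L^1$; 2. $\sigma(A_n,W_0)\in L^2$ for every $n$, and $\frac1n\mathbb E\big[(\sigma(A_n,W_0)-n\lambda_\mu)^2\big]\to s^2$ as $n\to\infty$; 3. $\frac1{\sqrt n}\big(\sigma(A_n,W_0)-n\lambda_\mu\big)$ converges in law to $\mathcal N(0,s^2)$ (the Dirac mass at $0$ if $s^2=0$); 4. $M_n=\sigma(A_n,W_0)-n\lambda_\mu+\psi(A_n\cdot W_0)-\psi(W_0)$ is a martingale with respect to the filtration $\sigma(W_0,Y_1,\dots,Y_n)$, $n\ge0$. Moreover, if there exist no integer $m\ge1$ and continuous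 $\psi_m:S^+\to\mathbb R$ such that $$\sigma(g,x)-m\lambda_\mu=\psi_m(x)-\psi_m(g\cdot x)\qquad\text{for }\mu^{*m}\otimes\nu\text{-almost every }(g,x)\in G\times S^+,$$ then $s^2>0$. In particular, if $\mu$ is aperiodic, i.e. the additive group generated by $\{\log\kappa(g):\ g\in\Gamma_\mu\}$ is dense in $\mathbb R$, where $\Gamma_\mu$ is the closed subsemigroup of $G$ generated by the support of $\mu$, then $s^2>0$. -/

import Mathlib

open Filter MeasureTheory ProbabilityTheory
open scoped Topology ENNReal NNReal BoundedContinuousFunction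

noncomputable section

namespace PosProd

variable {d : ℕ}

/-- The `ℓ¹` norm on `ℝ^d`. -/
def l1 (x : Fin d → ℝ) : ℝ := ∑ i, |x i|

/-- The semigroup `G` of positive allowable matrices: entries are nonnegative and every row and
every column has a strictly positive entry. -/
def allowable (d : ℕ) : Submonoid (Matrix (Fin d) (Fin d) ℝ) where
  carrier := {g | (∀ i j, 0 ≤ g i j) ∧ (∀ i, ∃ j, 0 < g i j) ∧ (∀ j, ∃ i, 0 < g i j)}
  one_mem' := by
    refine ⟨fun i j => ?_, fun i => ⟨i, by simp⟩, fun i => ⟨i, by simp⟩⟩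
    rw [Matrix.one_apply]; split_ifs <;> norm_num
  mul_mem' := by
    rintro a b ⟨ha, ha', ha''⟩ ⟨hb, hb', hb''⟩
    refine ⟨fun i j => ?_, fun i => ?_, fun j => ?_⟩
    · rw [Matrix.mul_apply]
      exact Finset.sum_nonneg fun k _ => mul_nonneg (ha i k) (hb k j)
    · obtain ⟨k, hk⟩ := ha' i
      obtain ⟨j, hj⟩ := hb' k
      exact ⟨j, Finset.sum_pos' (fun k _ => mul_nonneg (ha i k) (hb k j))
        ⟨k, Finset.mem_univ _, mul_pos hk hj⟩⟩
    · obtain ⟨k, hk⟩ := hb'' j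
      obtain ⟨i, hi⟩ := ha'' k
      exact ⟨i, Finset.sum_pos' (fun k _ => mul_nonneg (ha i k) (hb k j))
        ⟨k, Finset.mem_univ _, mul_pos hi hk⟩⟩

/-- `G`, with the topology inherited from the space of matrices. -/
abbrev G (d : ℕ) : Type := allowable d

instance : MeasurableSpace (G d) := borel (G d)

instance : BorelSpace (G d) := ⟨rfl⟩

/-- The set `G⁺` of matrices with strictly positive entries. -/
def GPos (d : ℕ) : Set (G d) := {g | ∀ i j, 0 < g.1 i j}

/-- `S⁺`: the nonnegative vectors of `ℓ¹` norm one. -/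
@[ext] structure SPlus (d : ℕ) where
  /-- the underlying vector -/
  val : Fin d → ℝ
  nonneg : ∀ i, 0 ≤ val i
  norm_eq : l1 val = 1

/-- The quantity `m(u, v) = inf {u i / v i : v i > 0}`. -/
def mInf (u v : SPlus d) : ℝ := sInf {r | ∃ i, 0 < v.val i ∧ r = u.val i / v.val i}

/-- The function `φ(s) = (1 - s) / (1 + s)`. -/
def phi (s : ℝ) : ℝ := (1 - s) / (1 + s)

theorem SPlus.sum_eq (x : SPlus d) : ∑ i, x.val i = 1 := by
  rw [← x.norm_eq, l1]
  exact Finset.sum_congr rfl fun i _ => (abs_of_nonneg (x.nonneg i)).symm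

theorem SPlus.exists_pos (x : SPlus d) : ∃ i, 0 < x.val i := by
  by_contra! h
  have : ∑ i, x.val i ≤ 0 := Finset.sum_nonpos fun i _ => h i
  rw [x.sum_eq] at this
  linarith

theorem le_mInf {u v : SPlus d} {r : ℝ} (h : ∀ i, r * v.val i ≤ u.val i) : r ≤ mInf u v := by
  obtain ⟨i, hi⟩ := v.exists_pos
  refine le_csInf ⟨_, i, hi, rfl⟩ ?_
  rintro _ ⟨j, hj, rfl⟩
  exact (le_div_iff₀ hj).2 (h j)

theorem mInf_nonneg (u v : SPlus d) : 0 ≤ mInf u v :=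
  le_mInf fun i => by simpa using u.nonneg i

theorem mInf_mul_le (u v : SPlus d) (i : Fin d) : mInf u v * v.val i ≤ u.val i := by
  rcases (v.nonneg i).eq_or_lt with h | h
  · rw [← h, mul_zero]; exact u.nonneg i
  · refine (le_div_iff₀ h).1 (csInf_le ⟨0, ?_⟩ ⟨i, h, rfl⟩)
    rintro _ ⟨j, hj, rfl⟩
    exact div_nonneg (u.nonneg j) hj.le

theorem mInf_le_one (u v : SPlus d) : mInf u v ≤ 1 := by
  have h : ∑ i, mInf u v * v.val i ≤ ∑ i, u.val i :=
    Finset.sum_le_sum fun i _ => mInf_mul_le u v i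
  rwa [← Finset.mul_sum, v.sum_eq, u.sum_eq, mul_one] at h

theorem mInf_self (u : SPlus d) : mInf u u = 1 :=
  le_antisymm (mInf_le_one u u) (le_mInf fun i => by rw [one_mul])

theorem mInf_mul_mInf_le (x y z : SPlus d) : mInf x y * mInf y z ≤ mInf x z :=
  le_mInf fun i => by
    rw [mul_assoc]
    exact (mul_le_mul_of_nonneg_left (mInf_mul_le y z i) (mInf_nonneg x y)).trans
      (mInf_mul_le x y i)

theorem phi_anti {s t : ℝ} (hs : 0 ≤ s) (hst : s ≤ t) : phi t ≤ phi s := by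
  unfold phi
  rw [div_le_div_iff₀ (by linarith) (by linarith)]
  nlinarith

theorem phi_mul_le {s t : ℝ} (hs : 0 ≤ s) (hs' : s ≤ 1) (ht : 0 ≤ t) (ht' : t ≤ 1) :
    phi (s * t) ≤ phi s + phi t := by
  have h0 : 0 ≤ s * t := mul_nonneg hs ht
  have h1 : s * t ≤ 1 := mul_le_one₀ hs' ht ht'
  unfold phi
  rw [div_add_div _ _ (by linarith) (by linarith),
    div_le_div_iff₀ (by linarith) (by nlinarith)]
  nlinarith [mul_nonneg (sub_nonneg.2 h1) (mul_nonneg (sub_nonneg.2 hs') (sub_nonneg.2 ht'))]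

/-- `S⁺` with the distance `d(x, y) = φ(m(x, y) m(y, x))`. -/
instance : MetricSpace (SPlus d) where
  dist x y := phi (mInf x y * mInf y x)
  dist_self x := by simp [mInf_self, phi]
  dist_comm x y := by rw [mul_comm]
  dist_triangle x y z := by
    have key : (mInf x y * mInf y x) * (mInf y z * mInf z y) ≤ mInf x z * mInf z x := by
      calc (mInf x y * mInf y x) * (mInf y z * mInf z y)
          = (mInf x y * mInf y z) * (mInf z y * mInf y x) := by ring
        _ ≤ _ := mul_le_mul (mInf_mul_mInf_le x y z) (mInf_mul_mInf_le z y x)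
          (mul_nonneg (mInf_nonneg _ _) (mInf_nonneg _ _)) (mInf_nonneg _ _)
    have h (u v : SPlus d) : 0 ≤ mInf u v * mInf v u ∧ mInf u v * mInf v u ≤ 1 :=
      ⟨mul_nonneg (mInf_nonneg _ _) (mInf_nonneg _ _),
        mul_le_one₀ (mInf_le_one _ _) (mInf_nonneg _ _) (mInf_le_one _ _)⟩
    exact (phi_anti (mul_nonneg (h x y).1 (h y z).1) key).trans
      (phi_mul_le (h x y).1 (h x y).2 (h y z).1 (h y z).2)
  eq_of_dist_eq_zero := by
    intro x y hxy
    have hxy' : phi (mInf x y * mInf y x) = 0 := hxy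
    have h0 : 0 ≤ mInf x y * mInf y x := mul_nonneg (mInf_nonneg _ _) (mInf_nonneg _ _)
    have h1 : mInf x y * mInf y x = 1 := by
      rw [phi, div_eq_zero_iff] at hxy'
      rcases hxy' with h | h <;> linarith
    have a1 := mInf_le_one x y
    have a2 := mInf_le_one y x
    have a3 := mInf_nonneg x y
    have a4 := mInf_nonneg y x
    have e1 : mInf x y = 1 := by nlinarith
    have e2 : mInf y x = 1 := by nlinarith
    ext i
    have b1 := mInf_mul_le x y i
    have b2 := mInf_mul_le y x i
    rw [e1, one_mul] at b1
    rw [e2, one_mul] at b2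
    exact le_antisymm b2 b1

instance : MeasurableSpace (SPlus d) := borel (SPlus d)

instance : BorelSpace (SPlus d) := ⟨rfl⟩

/-- The vector `g x`. -/
def mulVec (g : G d) (x : SPlus d) : Fin d → ℝ := Matrix.mulVec g.1 x.val

theorem mulVec_nonneg (g : G d) (x : SPlus d) (i : Fin d) : 0 ≤ mulVec g x i := by
  unfold mulVec Matrix.mulVec dotProduct
  exact Finset.sum_nonneg fun j _ => mul_nonneg (g.2.1 i j) (x.nonneg j)

theorem l1_mulVec_pos (g : G d) (x : SPlus d) : 0 < l1 (mulVec g x) := by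
  obtain ⟨j, hj⟩ := x.exists_pos
  obtain ⟨i, hi⟩ := g.2.2.2 j
  refine Finset.sum_pos' (fun k _ => abs_nonneg _) ⟨i, Finset.mem_univ _, ?_⟩
  rw [abs_of_nonneg (mulVec_nonneg g x i)]
  exact Finset.sum_pos' (fun j _ => mul_nonneg (g.2.1 i j) (x.nonneg j))
    ⟨j, Finset.mem_univ _, mul_pos hi hj⟩

/-- The action `g · x = g x / ‖g x‖` of `G` on `S⁺`. -/
def act (g : G d) (x : SPlus d) : SPlus d where
  val i := mulVec g x i / l1 (mulVec g x)
  nonneg i := div_nonneg (mulVec_nonneg g x i) (l1_mulVec_pos g x).le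
  norm_eq := by
    have h := l1_mulVec_pos g x
    simp only [l1] at h ⊢
    simp only [abs_div, abs_of_pos h]
    rw [← Finset.sum_div, div_self h.ne']

/-- The norm cocycle `σ(g, x) = log ‖g x‖`. -/
def sigma (g : G d) (x : SPlus d) : ℝ := Real.log (l1 (mulVec g x))

/-- The operator norm of `g` associated with the `ℓ¹` norm. -/
def opNorm (g : G d) : ℝ := ⨆ x : {x : Fin d → ℝ // l1 x = 1}, l1 (Matrix.mulVec g.1 x.1)

/-- `v(g) = inf {‖g x‖ : x ∈ S⁺}`. -/
def vInf (g : G d) : ℝ := ⨅ x : SPlus d, l1 (mulVec g x)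

/-- `N(g) = max (‖g‖, 1 / v(g))`. -/
def bigN (g : G d) : ℝ := max (opNorm g) (1 / vInf g)

/-- The spectral radius `κ(g)`. -/
def kappa (g : G d) : ℝ := (spectralRadius ℂ (g.1.map (fun t : ℝ => (t : ℂ)))).toReal

/-- The convolution power `μ^{*n}`. -/
def convPow (μ : Measure (G d)) : ℕ → Measure (G d)
  | 0 => Measure.dirac 1
  | n + 1 => μ.mconv (convPow μ n)

/-- `μ` admits a moment of order `p`. -/
def HasMoment (μ : Measure (G d)) (p : ℝ) : Prop :=
  ∫⁻ g, ENNReal.ofReal (Real.log (bigN g) ^ p) ∂μ < ∞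

/-- `μ` is strictly contracting. -/
def StrictlyContracting (μ : Measure (G d)) : Prop :=
  ∃ r : ℕ, 1 ≤ r ∧ 0 < convPow μ r (GPos d)

/-- `ν` is `μ`-invariant. -/
def IsInvariant (μ : Measure (G d)) (ν : Measure (SPlus d)) : Prop :=
  ∀ f : SPlus d → ℝ≥0∞, Measurable f → ∫⁻ q, f (act q.1 q.2) ∂(μ.prod ν) = ∫⁻ x, f x ∂ν

/-- The closed subsemigroup `Γ_μ` of `G` generated by the support of `μ`. -/
def Gam (μ : Measure (G d)) : Set (G d) :=
  closure (Subsemigroup.closure μ.support : Set (G d))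

/-- `μ` is aperiodic: the group generated by `{log κ(g) : g ∈ Γ_μ}` is dense in `ℝ`. -/
def Aperiodic (μ : Measure (G d)) : Prop :=
  Dense (AddSubgroup.closure ((fun g => Real.log (kappa g)) '' Gam μ) : Set ℝ)

/-- The Lyapunov exponent `λ_μ = lim (1/n) 𝔼 log ‖A_n‖`, where `A_n` has law `μ^{*n}`. -/
def lyapunov (μ : Measure (G d)) : ℝ :=
  limUnder atTop fun n : ℕ => (∫ g, Real.log (opNorm g) ∂(convPow μ n)) / n

/-- `σ(g, x) - m λ_μ = ψ(x) - ψ(g · x)` for `μ^{*m} ⊗ ν`-almost every `(g, x)`. -/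
def CoboundaryRelation (μ : Measure (G d)) (ν : Measure (SPlus d)) (m : ℕ)
    (ψ : SPlus d → ℝ) : Prop :=
  ∀ᵐ q ∂((convPow μ m).prod ν), sigma q.1 q.2 - m * lyapunov μ = ψ q.2 - ψ (act q.1 q.2)

/-- The left products `A_n = Y_n ⋯ Y_1`. The sequence is indexed from zero: the matrix `Y k`
is the `(k+1)`-st one. -/
def leftProd {Ω : Type*} (Y : ℕ → Ω → G d) : ℕ → Ω → G d
  | 0, _ => 1
  | n + 1, ω => Y n ω * leftProd Y n ω

/-- The `σ`-algebras generated by the starting point `W` and the first `n` matrices. -/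
def pastFiltration {Ω : Type*} [mΩ : MeasurableSpace Ω] (Y : ℕ → Ω → G d) (W : Ω → SPlus d)
    (hY : ∀ n, Measurable (Y n)) (hW : Measurable W) : Filtration ℕ mΩ where
  seq n := MeasurableSpace.comap W inferInstance ⊔
    ⨆ k < n, MeasurableSpace.comap (Y k) inferInstance
  mono' _ _ h := sup_le_sup le_rfl (biSup_mono fun _ hk => lt_of_lt_of_le hk h)
  le' _ := sup_le hW.comap_le (iSup₂_le fun k _ => (hY k).comap_le)

end PosProd

end

noncomputable section

namespace PosProd

section

variable {d : ℕ}

/-! ### The metric on `S⁺` -/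

/-! The proof rests on contraction. `S⁺` is a complete separable metric space of diameter at most
one on which `G` acts without increasing distances, and a matrix whose entries have all cross-ratios
at least `θ > 0` contracts by the factor `φ(θ) < 1` (`dist_act_le_of_mem_crossSet`). Strict
contraction gives such matrices positive mass under some `μ^{*r}`, so `μ^{*n}` contracts distances
on average by a summable sequence `κ_n` (`exists_summable_contractsBy`). Write `Pf(x) = ∫ f(g · x)
dμ(g)`. Summability yields uniqueness of `ν`, existence of `ν` as the law of the almost sure limit
of `Y_1 ⋯ Y_n · x`, and, for Lipschitz `f`, a bounded Lipschitz solution `u` of the Poisson equation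
`u - Pu = f - ∫ f dν` (`exists_poisson`).

The Poisson equation is solved twice. For `f(x) = ∫ σ(g, x) dμ(g)` its solution `ψ` makes `σ(g, x) -
λ + ψ(g · x) - ψ(x)` centered for every `x`. Its sums along the walk form a martingale at bounded
distance from `σ(A_n, x) - nλ`. Orthogonality of the increments makes the second moment exactly `n
s²` under `ν`, where `s²` is the `ν`-mean of the conditional variance `V`. The operator norm is
attained at a vertex of the simplex, so the growth of `‖A_n‖` follows from starting the walk at the
vertices, and `λ = λ_μ`. For `f = V` the solution `u` makes `1 - θ²u/2` an eigenfunction of the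
perturbed transfer operator with eigenvalue `1 - θ²s²/2`, up to `o(θ²)`
(`IsCorrector.norm_transfer_sub_le`). Iterating `n` times at `θ = t/√n` gives the Gaussian
characteristic function.

If `s² = 0`, the corrected cocycle vanishes almost surely, so `σ - mλ` is a coboundary of `ψ` and is
bounded uniformly in `m`. Since `ν` charges only the interior of the simplex, Gelfand's formula then
forces `log κ(g) ∈ λℤ` for every `g ∈ Γ_μ`, which excludes aperiodicity. -/

theorem SPlus.dist_eq (x y : SPlus d) : dist x y = phi (mInf x y * mInf y x) := rfl

theorem mInf_mul_nonneg (x y : SPlus d) : 0 ≤ mInf x y * mInf y x :=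
  mul_nonneg (mInf_nonneg _ _) (mInf_nonneg _ _)

theorem mInf_mul_le_one (x y : SPlus d) : mInf x y * mInf y x ≤ 1 :=
  mul_le_one₀ (mInf_le_one _ _) (mInf_nonneg _ _) (mInf_le_one _ _)

/-- As `φ` is an involution, a bound `D` on a distance amounts to the cross-ratio bound with
constant `φ(D)`. -/
theorem phi_phi {s : ℝ} (hs : 0 ≤ s) : phi (phi s) = s := by
  have : 1 + s ≠ 0 := by linarith
  unfold phi
  field_simp
  ring

theorem phi_nonneg {s : ℝ} (hs : 0 ≤ s) (hs' : s ≤ 1) : 0 ≤ phi s :=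
  div_nonneg (by linarith) (by linarith)

theorem phi_le_one {s : ℝ} (hs : 0 ≤ s) : phi s ≤ 1 := by
  unfold phi
  rw [div_le_one (by linarith)]
  linarith

theorem SPlus.dist_le_one (x y : SPlus d) : dist x y ≤ 1 := phi_le_one (mInf_mul_nonneg x y)

theorem le_mInf_iff {x y : SPlus d} {r : ℝ} :
    r ≤ mInf x y ↔ ∀ i, r * y.val i ≤ x.val i :=
  ⟨fun h i => (mul_le_mul_of_nonneg_right h (y.nonneg i)).trans (mInf_mul_le x y i), le_mInf⟩

/-- The product `m(x, y) m(y, x)` is governed by the cross-ratios `x_i y_j / (x_j y_i)`. The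
hypothesis is cleared of denominators so that vanishing coordinates are allowed. -/
theorem le_mInf_mul_mInf {x y : SPlus d} {K : ℝ}
    (h : ∀ i j, K * (x.val j * y.val i) ≤ x.val i * y.val j) : K ≤ mInf x y * mInf y x := by
  rcases le_or_gt K 0 with hK | hK
  · exact hK.trans (mInf_mul_nonneg x y)
  have h1 (j : Fin d) : K * x.val j ≤ mInf x y * y.val j := by
    rcases (y.nonneg j).eq_or_lt with hj | hj
    -- If `y_j = 0`, the hypothesis at an index `i` with `y_i > 0` forces `x_j = 0`.
    · obtain ⟨i, hi⟩ := y.exists_pos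
      have := h i j
      rw [← hj, mul_zero] at this ⊢
      nlinarith [x.nonneg j, mul_pos hK hi]
    · rw [← div_le_iff₀ hj]
      refine le_mInf fun i => ?_
      rw [div_mul_eq_mul_div, div_le_iff₀ hj, mul_assoc]
      exact h i j
  have h2 : 0 < mInf x y := by
    obtain ⟨j, hj⟩ := x.exists_pos
    exact pos_of_mul_pos_left ((mul_pos hK hj).trans_le (h1 j)) (y.nonneg j)
  have h3 : K / mInf x y ≤ mInf y x := le_mInf fun j => by
    rw [div_mul_eq_mul_div, div_le_iff₀ h2, mul_comm (y.val j)]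
    exact h1 j
  rwa [div_le_iff₀' h2] at h3

theorem SPlus.dist_le_phi {x y : SPlus d} {K : ℝ} (hK : 0 ≤ K)
    (h : ∀ i j, K * (x.val j * y.val i) ≤ x.val i * y.val j) : dist x y ≤ phi K :=
  phi_anti hK (le_mInf_mul_mInf h)

theorem one_sub_mInf_le (x y : SPlus d) : 1 - mInf x y ≤ 2 * dist x y := by
  have h1 : mInf x y * mInf y x ≤ mInf x y :=
    mul_le_of_le_one_right (mInf_nonneg _ _) (mInf_le_one _ _)
  have h2 : 1 - mInf x y * mInf y x ≤ 2 * dist x y := by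
    have h0 := mInf_mul_nonneg x y
    rw [SPlus.dist_eq, phi, ← mul_div_assoc, le_div_iff₀ (by linarith)]
    nlinarith [mInf_mul_le_one x y]
  linarith

/-- The metric dominates the coordinates: its topology is finer than the Euclidean one. -/
theorem SPlus.abs_sub_le (x y : SPlus d) (i : Fin d) : |x.val i - y.val i| ≤ 2 * dist x y := by
  have key (x y : SPlus d) : y.val i - x.val i ≤ 2 * dist x y := by
    have h1 := mInf_mul_le x y i
    have h2 := one_sub_mInf_le x y
    have h3 : y.val i ≤ 1 := by
      rw [← y.sum_eq]
      exact Finset.single_le_sum (fun j _ => y.nonneg j) (Finset.mem_univ i)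
    nlinarith [y.nonneg i, mInf_le_one x y]
  rw [abs_le]
  have h1 := key x y
  have h2 := key y x
  rw [dist_comm] at h2
  constructor <;> linarith

/-- This is `φ(t) ≤ 1 - t` at `t = r²`. It serves to prove convergence in the metric from
coordinatewise inequalities. -/
theorem SPlus.dist_le_of_le_mInf {x y : SPlus d} {r : ℝ} (hr : 0 ≤ r) (h1 : r ≤ mInf x y)
    (h2 : r ≤ mInf y x) : dist x y ≤ 1 - r ^ 2 := by
  have h3 : r * r ≤ mInf x y * mInf y x := mul_le_mul h1 h2 hr (mInf_nonneg _ _)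
  refine (phi_anti (mul_nonneg hr hr) h3).trans ?_
  have : r ≤ 1 := h1.trans (mInf_le_one _ _)
  unfold phi
  rw [div_le_iff₀ (by positivity)]
  have h4 : r ^ 2 ≤ 1 := pow_le_one₀ hr this
  nlinarith [mul_nonneg (sq_nonneg r) (sub_nonneg.2 h4)]

/-! ### The action and the cocycle -/

/-- The sum of the `j`-th column of `g`. -/
def colSum (g : G d) (j : Fin d) : ℝ := ∑ i, g.1 i j

theorem colSum_pos (g : G d) (j : Fin d) : 0 < colSum g j := by
  obtain ⟨i, hi⟩ := g.2.2.2 j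
  exact Finset.sum_pos' (fun i _ => g.2.1 i j) ⟨i, Finset.mem_univ _, hi⟩

/-- The `ℓ¹` norm is linear on nonnegative vectors, so `‖g x‖` is a convex combination of the column
sums. All bounds on `σ` come from this. -/
theorem l1_mulVec (g : G d) (x : SPlus d) : l1 (mulVec g x) = ∑ j, colSum g j * x.val j := by
  simp only [l1, abs_of_nonneg (mulVec_nonneg g x _)]
  simp only [mulVec, Matrix.mulVec, dotProduct, colSum, Finset.sum_mul]
  exact Finset.sum_comm

theorem mulVec_le_mulVec {x y : SPlus d} (g : G d) {r : ℝ} (h : ∀ i, r * y.val i ≤ x.val i)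
    (i : Fin d) : r * mulVec g y i ≤ mulVec g x i := by
  simp only [mulVec, Matrix.mulVec, dotProduct, Finset.mul_sum]
  refine Finset.sum_le_sum fun j _ => ?_
  rw [mul_left_comm]
  exact mul_le_mul_of_nonneg_left (h j) (g.2.1 i j)

theorem act_val (g : G d) (x : SPlus d) (i : Fin d) :
    (act g x).val i = mulVec g x i / l1 (mulVec g x) := rfl

theorem mulVec_mul (g h : G d) (x : SPlus d) (i : Fin d) :
    mulVec (g * h) x i = l1 (mulVec h x) * mulVec g (act h x) i := by
  have h0 := (l1_mulVec_pos h x).ne'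
  have h1 : mulVec (g * h) x = Matrix.mulVec g.1 (mulVec h x) := by
    simp [mulVec, Matrix.mulVec_mulVec]
  rw [h1]
  change ∑ j, g.1 i j * mulVec h x j = l1 (mulVec h x) * ∑ j, g.1 i j * (act h x).val j
  rw [Finset.mul_sum]
  refine Finset.sum_congr rfl fun j _ => ?_
  rw [act_val]
  field_simp

theorem l1_mulVec_mul (g h : G d) (x : SPlus d) :
    l1 (mulVec (g * h) x) = l1 (mulVec h x) * l1 (mulVec g (act h x)) := by
  simp only [l1, mulVec_mul, abs_mul, ← Finset.mul_sum]
  rw [← l1, abs_of_pos (l1_mulVec_pos h x)]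

theorem act_mul (g h : G d) (x : SPlus d) : act (g * h) x = act g (act h x) := by
  ext i
  rw [act_val, act_val, mulVec_mul, l1_mulVec_mul, mul_div_mul_left _ _ (l1_mulVec_pos h x).ne']

theorem mulVec_one (x : SPlus d) : mulVec 1 x = x.val := by simp [mulVec]

theorem act_one (x : SPlus d) : act 1 x = x := by
  ext i
  rw [act_val, mulVec_one, x.norm_eq, div_one]

theorem sigma_mul (g h : G d) (x : SPlus d) :
    sigma (g * h) x = sigma g (act h x) + sigma h x := by
  rw [sigma, l1_mulVec_mul, Real.log_mul (l1_mulVec_pos h x).ne' (l1_mulVec_pos g _).ne', add_comm]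
  rfl

theorem sigma_one (x : SPlus d) : sigma 1 x = 0 := by
  rw [sigma, mulVec_one, x.norm_eq, Real.log_one]

/-- The normalizing factor is inverted when `x` and `y` are exchanged, so it cancels in `m(x, y)
m(y, x)`. -/
theorem mInf_act (g : G d) (x y : SPlus d) :
    mInf x y * (l1 (mulVec g y) / l1 (mulVec g x)) ≤ mInf (act g x) (act g y) := by
  have hx := l1_mulVec_pos g x
  have hy := l1_mulVec_pos g y
  refine le_mInf fun i => ?_
  have := mulVec_le_mulVec g (mInf_mul_le x y) i
  rw [act_val, act_val]
  field_simp
  exact this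

theorem dist_act_le (g : G d) (x y : SPlus d) : dist (act g x) (act g y) ≤ dist x y := by
  have hx := l1_mulVec_pos g x
  have hy := l1_mulVec_pos g y
  refine phi_anti (mInf_mul_nonneg x y) ?_
  calc mInf x y * mInf y x
      = (mInf x y * (l1 (mulVec g y) / l1 (mulVec g x))) *
        (mInf y x * (l1 (mulVec g x) / l1 (mulVec g y))) := by field_simp
    _ ≤ _ := mul_le_mul (mInf_act g x y) (mInf_act g y x)
      (mul_nonneg (mInf_nonneg _ _) (by positivity)) (mInf_nonneg _ _)

theorem continuous_act (g : G d) : Continuous (act g) :=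
  (LipschitzWith.of_dist_le_mul (K := 1) fun x y => by
    simpa using dist_act_le g x y).continuous

/-! ### Strict contraction by matrices with bounded cross-ratios -/

/-- The matrices all of whose `2 × 2` cross-ratios are at least `θ`. -/
def crossSet (d : ℕ) (θ : ℝ) : Set (G d) :=
  {g | ∀ i j k l, θ * (g.1 j k * g.1 i l) ≤ g.1 i k * g.1 j l}

/-- Both sides are bilinear in `(u, w)`; expanded over pairs `(k, l)`, the inequality holds term by
term. -/
theorem cross_le {g : G d} {θ : ℝ} (hg : g ∈ crossSet d θ) {u w : Fin d → ℝ}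
    (hu : ∀ i, 0 ≤ u i) (hw : ∀ i, 0 ≤ w i) (i j : Fin d) :
    θ * (Matrix.mulVec g.1 u j * Matrix.mulVec g.1 w i) ≤
      Matrix.mulVec g.1 u i * Matrix.mulVec g.1 w j := by
  simp only [Matrix.mulVec, dotProduct, Finset.sum_mul_sum]
  simp only [Finset.mul_sum]
  refine Finset.sum_le_sum fun k _ => Finset.sum_le_sum fun l _ => ?_
  have := mul_le_mul_of_nonneg_right (hg i j k l) (mul_nonneg (hu k) (hw l))
  linarith

/-- Put `u = x - a y`, `w = y - b x` with `a = m(x, y)`, `b = m(y, x)`, and `U = g u`, `W = g w`.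
The letters stand for `A = U_i W_j`, `B = U_j W_i`, `E = U_i U_j`, `F = W_i W_j`. The two long sums
are then `(1 - ab)²` times `(gx)_j (gy)_i` and `(gx)_i (gy)_j`. The hypothesis `θB ≤ A` is
equivalent to `B - A ≤ φ(θ)(A + B)`, and `1 - ab = φ(ab)(1 + ab)`; the terms in `E` and `F` only
help. -/
theorem cross_contraction {A B E F a b θ : ℝ} (hE : 0 ≤ E) (hF : 0 ≤ F)
    (ha : 0 ≤ a) (hb : 0 ≤ b) (hab : a * b ≤ 1) (hθ : 0 ≤ θ) (hθ1 : θ ≤ 1)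
    (h : θ * B ≤ A) :
    phi (phi θ * phi (a * b)) * (B + b * E + a * F + a * b * A) ≤
      A + b * E + a * F + a * b * B := by
  have hab0 : 0 ≤ a * b := mul_nonneg ha hb
  set c := phi θ with hc
  have hc0 : 0 ≤ c := phi_nonneg hθ hθ1
  have hc1 : c * (1 + θ) = 1 - θ := by
    rw [hc, phi, div_mul_cancel₀]; linarith
  set δ := phi (a * b) with hδ
  have hd0 : 0 ≤ δ := phi_nonneg hab0 hab
  have hd1 : δ * (1 + a * b) = 1 - a * b := by
    rw [hδ, phi, div_mul_cancel₀]; linarith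
  have h1 : B - A ≤ c * (A + B) := by
    have hc2 : c ≤ 1 := phi_le_one hθ
    have h3 : (1 + θ) * (B - A) ≤ (1 + θ) * (c * (A + B)) := by
      rw [show (1 + θ) * (c * (A + B)) = (1 - θ) * (A + B) by rw [← hc1]; ring]
      nlinarith
    exact le_of_mul_le_mul_left h3 (by linarith)
  have h2 : (1 - a * b) * (B - A) ≤
      c * δ * ((1 + a * b) * (A + B) + 2 * b * E + 2 * a * F) := by
    have h4 : (1 - a * b) * (B - A) ≤ (1 - a * b) * (c * (A + B)) :=
      mul_le_mul_of_nonneg_left h1 (by linarith)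
    have h5 : 0 ≤ c * δ * (2 * b * E + 2 * a * F) := by positivity
    have h6 : (1 - a * b) * (c * (A + B)) = c * δ * ((1 + a * b) * (A + B)) := by
      rw [← hd1]; ring
    linarith
  have hcd : 0 ≤ c * δ := mul_nonneg hc0 hd0
  rw [phi, div_mul_eq_mul_div, div_le_iff₀ (by linarith)]
  linarith

theorem dist_act_le_of_mem_crossSet {g : G d} {θ : ℝ} (hθ : 0 ≤ θ) (hθ1 : θ ≤ 1)
    (hg : g ∈ crossSet d θ) (x y : SPlus d) :
    dist (act g x) (act g y) ≤ phi θ * dist x y := by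
  set a := mInf x y with ha
  set b := mInf y x with hb
  have ha0 : 0 ≤ a := mInf_nonneg x y
  have hb0 : 0 ≤ b := mInf_nonneg y x
  have hab1 : a * b ≤ 1 := mInf_mul_le_one x y
  -- When `ab = 1` the points coincide; this case is set apart because the factor `(1 - ab)²` is
  -- cancelled below.
  rcases hab1.eq_or_lt with hab | hab
  · have : dist x y = 0 := by simp [SPlus.dist_eq, ← ha, ← hb, hab, phi]
    rw [eq_of_dist_eq_zero this, dist_self, dist_self, mul_zero]
  have hd1 : phi θ * dist x y ≤ 1 :=
    mul_le_one₀ (phi_le_one hθ) dist_nonneg (SPlus.dist_le_one _ _)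
  have hd0 : 0 ≤ phi θ * dist x y := mul_nonneg (phi_nonneg hθ hθ1) dist_nonneg
  rw [← phi_phi hd0]
  refine SPlus.dist_le_phi (phi_nonneg hd0 hd1) fun i j => ?_
  have hx := l1_mulVec_pos g x
  have hy := l1_mulVec_pos g y
  set u : Fin d → ℝ := fun i => x.val i - a * y.val i with hu
  set w : Fin d → ℝ := fun i => y.val i - b * x.val i with hw
  have hu0 (i) : 0 ≤ u i := sub_nonneg.2 (mInf_mul_le x y i)
  have hw0 (i) : 0 ≤ w i := sub_nonneg.2 (mInf_mul_le y x i)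
  have pos {v : Fin d → ℝ} (hv : ∀ i, 0 ≤ v i) (i : Fin d) : 0 ≤ Matrix.mulVec g.1 v i :=
    (Finset.sum_nonneg fun j _ => mul_nonneg (g.2.1 i j) (hv j) : 0 ≤ ∑ j, g.1 i j * v j)
  have eu (i) : Matrix.mulVec g.1 u i = mulVec g x i - a * mulVec g y i := by
    simp only [hu, mulVec, Matrix.mulVec, dotProduct, Finset.mul_sum, ← Finset.sum_sub_distrib]
    exact Finset.sum_congr rfl fun _ _ => by ring
  have ew (i) : Matrix.mulVec g.1 w i = mulVec g y i - b * mulVec g x i := by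
    simp only [hw, mulVec, Matrix.mulVec, dotProduct, Finset.mul_sum, ← Finset.sum_sub_distrib]
    exact Finset.sum_congr rfl fun _ _ => by ring
  have key := cross_contraction (mul_nonneg (pos hu0 i) (pos hu0 j))
    (mul_nonneg (pos hw0 i) (pos hw0 j)) ha0 hb0 hab1 hθ hθ1 (cross_le hg hu0 hw0 i j)
  simp only [eu, ew] at key
  have key2 : phi (phi θ * dist x y) * (mulVec g x j * mulVec g y i) ≤
      mulVec g x i * mulVec g y j := by
    have h3 : 0 < (1 - a * b) ^ 2 := by have : 0 < 1 - a * b := by linarith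
                                        positivity
    refine le_of_mul_le_mul_left ?_ h3
    rw [SPlus.dist_eq, ← ha, ← hb]
    linarith
  simp only [act_val]
  rw [div_mul_div_comm, div_mul_div_comm, ← mul_div_assoc]
  gcongr

/-- There are finitely many cross-ratios, all positive. The thresholds `1/(n+1)` exhaust `G⁺` by
countably many sets. -/
theorem exists_mem_crossSet {g : G d} (hg : g ∈ GPos d) :
    ∃ n : ℕ, g ∈ crossSet d (1 / ((n : ℝ) + 1)) := by
  have : ∀ᶠ n : ℕ in atTop, g ∈ crossSet d (1 / ((n : ℝ) + 1)) := by
    simp only [crossSet, Set.mem_ofPred_eq, eventually_all]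
    intro i j k l
    have h0 : Tendsto (fun n : ℕ => 1 / ((n : ℝ) + 1) * (g.1 j k * g.1 i l)) atTop (𝓝 0) := by
      simpa using tendsto_one_div_add_atTop_nhds_zero_nat.mul_const (g.1 j k * g.1 i l)
    exact (h0.eventually (gt_mem_nhds (mul_pos (hg i k) (hg j l)))).mono fun n hn => hn.le
  exact this.exists

end

section

variable {d : ℕ}

/-! ### Topology and measurability of `S⁺` -/

/-- The support and the coordinates of a point of `S⁺`. -/
def SPlus.code (x : SPlus d) : (Fin d → Bool) × (Fin d → ℝ) := (fun i => decide (0 < x.val i), x.val)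

/-- At distance less than one both `m(x, y)` and `m(y, x)` are positive, so the open faces of the
simplex are open subsets of `S⁺`. -/
theorem SPlus.val_pos_iff {x y : SPlus d} (h : dist x y < 1) (i : Fin d) :
    0 < x.val i ↔ 0 < y.val i := by
  have h0 : mInf x y * mInf y x ≠ 0 := fun h0 => by
    rw [SPlus.dist_eq, h0] at h
    simp [phi] at h
  have h1 : 0 < mInf x y := (mInf_nonneg x y).lt_of_ne' (left_ne_zero_of_mul h0)
  have h2 : 0 < mInf y x := (mInf_nonneg y x).lt_of_ne' (right_ne_zero_of_mul h0)
  exact ⟨fun hi => (mul_pos h2 hi).trans_le (mInf_mul_le y x i),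
    fun hi => (mul_pos h1 hi).trans_le (mInf_mul_le x y i)⟩

theorem SPlus.continuous_val (i : Fin d) : Continuous fun x : SPlus d => x.val i :=
  (LipschitzWith.of_dist_le_mul (K := 2) fun x y => by
    simpa [Real.dist_eq] using SPlus.abs_sub_le x y i).continuous

/-- The topology of `S⁺` is the Euclidean one on each open face, with distinct faces separated.
Recording the support in a discrete factor captures this, and gives second countability and a
description of the Borel sets. -/
theorem SPlus.isInducing_code : Topology.IsInducing (SPlus.code (d := d)) := by
  refine Topology.isInducing_iff_nhds.2 fun x => le_antisymm (tendsto_iff_comap.1 ?_) ?_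
  · refine Tendsto.prodMk_nhds (tendsto_pi_nhds.2 fun i => ?_) (tendsto_pi_nhds.2 fun i => ?_)
    · refine tendsto_const_nhds.congr' ?_
      filter_upwards [Metric.ball_mem_nhds x one_pos] with y hy
      simp only [SPlus.val_pos_iff (Metric.mem_ball.1 hy) i]
    · exact (SPlus.continuous_val i).tendsto x
  · refine tendsto_id'.1 ?_
    rw [Metric.tendsto_nhds]
    intro ε hε
    obtain ⟨r, hr0, hr1, hr⟩ : ∃ r : ℝ, 0 < r ∧ r < 1 ∧ 1 - r ^ 2 < ε := by
      -- With `r ≥ 1 - ε/4` one has `1 - r² ≤ 2(1 - r) ≤ ε/2`.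
      refine ⟨max (1 / 2) (1 - ε / 4), by simp, by simp [hε]; norm_num, ?_⟩
      have h1 := le_max_left (1 / 2 : ℝ) (1 - ε / 4)
      have h2 := le_max_right (1 / 2 : ℝ) (1 - ε / 4)
      nlinarith
    have hc : Tendsto SPlus.code (comap SPlus.code (𝓝 (SPlus.code x))) (𝓝 (SPlus.code x)) :=
      tendsto_comap
    have h1 (i : Fin d) : ∀ᶠ y in comap SPlus.code (𝓝 (SPlus.code x)),
        (0 < y.val i ↔ 0 < x.val i) := by
      have : Tendsto (fun y : SPlus d => y.code.1 i) (comap SPlus.code (𝓝 (SPlus.code x)))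
          (𝓝 (x.code.1 i)) :=
        (((continuous_apply i).comp continuous_fst).tendsto (SPlus.code x)).comp hc
      rw [nhds_discrete Bool, tendsto_pure] at this
      filter_upwards [this] with y hy
      simpa [SPlus.code] using hy
    have h2 (i : Fin d) : Tendsto (fun y : SPlus d => y.val i)
        (comap SPlus.code (𝓝 (SPlus.code x))) (𝓝 (x.val i)) :=
      (((continuous_apply i).comp continuous_snd).tendsto (SPlus.code x)).comp hc
    have h3 (i : Fin d) : ∀ᶠ y : SPlus d in comap SPlus.code (𝓝 (SPlus.code x)),
        r * x.val i ≤ y.val i ∧ r * y.val i ≤ x.val i := by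
      rcases (x.nonneg i).eq_or_lt with hi | hi
      -- Euclidean closeness says nothing useful when `x_i = 0`; here the equality of supports is
      -- what gives `y_i = 0`.
      · filter_upwards [h1 i] with y hy
        rw [← hi] at hy ⊢
        have : y.val i = 0 := le_antisymm (not_lt.1 fun h => lt_irrefl _ (hy.1 h)) (y.nonneg i)
        simp [this]
      · have a1 : r * x.val i < x.val i := by nlinarith
        filter_upwards [(h2 i).eventually (lt_mem_nhds a1),
          ((h2 i).const_mul r).eventually (gt_mem_nhds a1)] with y h4 h5
        exact ⟨h4.le, h5.le⟩
    filter_upwards [eventually_all.2 h3] with y hy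
    exact (SPlus.dist_le_of_le_mInf hr0.le (le_mInf fun i => (hy i).1)
      (le_mInf fun i => (hy i).2)).trans_lt hr

instance : SecondCountableTopology (SPlus d) :=
  SPlus.isInducing_code.secondCountableTopology

theorem SPlus.measurable_val (i : Fin d) : Measurable fun x : SPlus d => x.val i :=
  (SPlus.continuous_val i).measurable

/-- The topology is finer than the Euclidean one, but the support is a Borel function of the
coordinates, so the Borel sets are the same. -/
theorem SPlus.measurable_of_val {α : Type*} [MeasurableSpace α] {f : α → SPlus d}
    (hf : ∀ i, Measurable fun a => (f a).val i) : Measurable f := by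
  have h : borel (SPlus d) =
      MeasurableSpace.comap SPlus.code inferInstance := by
    rw [SPlus.isInducing_code.eq_induced, borel_comap]
    congr 1
    exact (BorelSpace.measurable_eq).symm
  change @Measurable _ _ _ (borel (SPlus d)) f
  rw [h, measurable_comap_iff]
  refine (measurable_pi_lambda _ fun i => ?_).prodMk (measurable_pi_lambda _ hf)
  refine measurable_to_bool ?_
  convert! measurableSet_lt (measurable_const (a := (0 : ℝ))) (hf i) using 1
  ext a
  simp

/-- Coordinates converge, and the inequalities `(1 - 2δ) v ≤ w` between terms of the sequence are
closed, so they pass to the limit and give convergence in the finer metric. -/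
instance : CompleteSpace (SPlus d) := by
  refine Metric.complete_of_cauchySeq_tendsto fun u hu => ?_
  have hc (i : Fin d) : ∃ t, Tendsto (fun n => (u n).val i) atTop (𝓝 t) := by
    refine cauchySeq_tendsto_of_complete (Metric.cauchySeq_iff'.2 fun ε hε => ?_)
    obtain ⟨N, hN⟩ := Metric.cauchySeq_iff'.1 hu (ε / 2) (by positivity)
    refine ⟨N, fun n hn => ?_⟩
    have := SPlus.abs_sub_le (u n) (u N) i
    rw [Real.dist_eq]
    linarith [hN n hn]
  choose t ht using hc
  have ht0 (i) : 0 ≤ t i := ge_of_tendsto' (ht i) fun n => (u n).nonneg i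
  have ht1 : ∑ i, t i = 1 := by
    have := tendsto_finsetSum Finset.univ fun i _ => ht i
    simp only [SPlus.sum_eq] at this
    exact tendsto_nhds_unique this tendsto_const_nhds
  let x : SPlus d := ⟨t, ht0, by simpa [l1, abs_of_nonneg (ht0 _)] using ht1⟩
  refine ⟨x, Metric.tendsto_atTop.2 fun ε hε => ?_⟩
  obtain ⟨δ, hδ0, hδ1, hδ⟩ : ∃ δ : ℝ, 0 < δ ∧ δ < 1 / 2 ∧ 4 * δ < ε := by
    refine ⟨min (1 / 4) (ε / 8), by positivity, ?_, ?_⟩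
    · linarith [min_le_left (1 / 4 : ℝ) (ε / 8)]
    · linarith [min_le_right (1 / 4 : ℝ) (ε / 8)]
  obtain ⟨N, hN⟩ := Metric.cauchySeq_iff.1 hu δ hδ0
  refine ⟨N, fun k hk => ?_⟩
  have h1 : ∀ n ≥ N, 1 - 2 * δ ≤ mInf (u n) (u k) ∧ 1 - 2 * δ ≤ mInf (u k) (u n) := by
    intro n hn
    have a1 := one_sub_mInf_le (u n) (u k)
    have a2 := one_sub_mInf_le (u k) (u n)
    have a3 := hN n hn k hk
    rw [dist_comm] at a2
    constructor <;> linarith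
  have h2 : 1 - 2 * δ ≤ mInf x (u k) := le_mInf fun i => by
    refine ge_of_tendsto (ht i) ?_
    filter_upwards [eventually_ge_atTop N] with n hn
    exact le_mInf_iff.1 (h1 n hn).1 i
  have h3 : 1 - 2 * δ ≤ mInf (u k) x := le_mInf fun i => by
    refine le_of_tendsto ((ht i).const_mul _) ?_
    filter_upwards [eventually_ge_atTop N] with n hn
    exact le_mInf_iff.1 (h1 n hn).2 i
  refine (SPlus.dist_le_of_le_mInf (by linarith) h3 h2).trans_lt ?_
  nlinarith

instance : SecondCountableTopology (Matrix (Fin d) (Fin d) ℝ) :=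
  inferInstanceAs (SecondCountableTopology (Fin d → Fin d → ℝ))

instance : SecondCountableTopology (G d) :=
  TopologicalSpace.Subtype.secondCountableTopology _

theorem continuous_entry (i j : Fin d) : Continuous fun g : G d => g.1 i j :=
  (continuous_subtype_val.matrix_elem i j)

theorem measurable_entry (i j : Fin d) : Measurable fun g : G d => g.1 i j :=
  (continuous_entry i j).measurable

theorem continuous_l1_mulVec (x : SPlus d) : Continuous fun g : G d => l1 (mulVec g x) := by
  simp only [l1_mulVec, colSum]
  exact continuous_finsetSum _ fun j _ =>
    (continuous_finsetSum _ fun i _ => continuous_entry i j).mul continuous_const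

theorem continuous_sigma (x : SPlus d) : Continuous fun g : G d => sigma g x :=
  (continuous_l1_mulVec x).log fun g => (l1_mulVec_pos g x).ne'

theorem measurable_colSum (j : Fin d) : Measurable fun g : G d => colSum g j :=
  Finset.measurable_sum _ fun i _ => measurable_entry i j

theorem measurable_l1_mulVec : Measurable fun q : G d × SPlus d => l1 (mulVec q.1 q.2) := by
  simp only [l1_mulVec]
  exact Finset.measurable_sum _ fun i _ => ((measurable_colSum i).comp measurable_fst).mul
    ((SPlus.measurable_val i).comp measurable_snd)

theorem measurable_act : Measurable fun q : G d × SPlus d => act q.1 q.2 := by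
  refine SPlus.measurable_of_val fun i => ?_
  simp only [act_val]
  refine Measurable.div ?_ measurable_l1_mulVec
  simp only [mulVec, Matrix.mulVec, dotProduct]
  exact Finset.measurable_sum _ fun j _ => ((measurable_entry i j).comp measurable_fst).mul
    ((SPlus.measurable_val j).comp measurable_snd)

@[fun_prop]
theorem measurable_act_comp {α : Type*} [MeasurableSpace α] {f : α → G d} {g : α → SPlus d}
    (hf : Measurable f) (hg : Measurable g) : Measurable fun a => PosProd.act (f a) (g a) :=
  measurable_act.comp (hf.prodMk hg)

@[fun_prop]
theorem measurable_sigma_comp {α : Type*} [MeasurableSpace α] {f : α → G d} {g : α → SPlus d}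
    (hf : Measurable f) (hg : Measurable g) : Measurable fun a => PosProd.sigma (f a) (g a) :=
  (measurable_l1_mulVec.comp (hf.prodMk hg)).log

theorem measurableSet_crossSet (θ : ℝ) : MeasurableSet (crossSet d θ) := by
  have h := measurable_entry (d := d)
  have : crossSet d θ = ⋂ i, ⋂ j, ⋂ k, ⋂ l,
      {g : G d | θ * (g.1 j k * g.1 i l) ≤ g.1 i k * g.1 j l} := by
    ext g; simp [crossSet]
  rw [this]
  refine .iInter fun i => .iInter fun j => .iInter fun k => .iInter fun l => ?_
  exact measurableSet_le ((h j k).mul (h i l) |>.const_mul θ) ((h i k).mul (h j l))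

/-! ### Bounds on the cocycle -/

/-- A bound for `|σ(g, x)|` uniform in `x`. -/
def logCol (g : G d) : ℝ := ∑ j, |Real.log (colSum g j)|

theorem logCol_nonneg (g : G d) : 0 ≤ logCol g := Finset.sum_nonneg fun _ _ => abs_nonneg _

@[fun_prop]
theorem measurable_logCol : Measurable (logCol (d := d)) :=
  Finset.measurable_sum _ fun j _ => (measurable_colSum j).log.abs

theorem exists_colSum_le (g : G d) (x : SPlus d) : ∃ j, colSum g j ≤ l1 (mulVec g x) := by
  by_contra! h
  obtain ⟨k, hk⟩ := x.exists_pos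
  have : ∑ j, l1 (mulVec g x) * x.val j < ∑ j, colSum g j * x.val j :=
    Finset.sum_lt_sum (fun j _ => mul_le_mul_of_nonneg_right (h j).le (x.nonneg j))
      ⟨k, Finset.mem_univ _, mul_lt_mul_of_pos_right (h k) hk⟩
  rw [← Finset.mul_sum, x.sum_eq, mul_one, ← l1_mulVec] at this
  exact lt_irrefl _ this

theorem exists_le_colSum (g : G d) (x : SPlus d) : ∃ j, l1 (mulVec g x) ≤ colSum g j := by
  by_contra! h
  obtain ⟨k, hk⟩ := x.exists_pos
  have : ∑ j, colSum g j * x.val j < ∑ j, l1 (mulVec g x) * x.val j :=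
    Finset.sum_lt_sum (fun j _ => mul_le_mul_of_nonneg_right (h j).le (x.nonneg j))
      ⟨k, Finset.mem_univ _, mul_lt_mul_of_pos_right (h k) hk⟩
  rw [← Finset.mul_sum, x.sum_eq, mul_one, ← l1_mulVec] at this
  exact lt_irrefl _ this

theorem abs_sigma_le (g : G d) (x : SPlus d) : |sigma g x| ≤ logCol g := by
  have h (j) : |Real.log (colSum g j)| ≤ logCol g :=
    Finset.single_le_sum (f := fun j => |Real.log (colSum g j)|) (fun _ _ => abs_nonneg _)
      (Finset.mem_univ j)
  obtain ⟨i, hi⟩ := exists_colSum_le g x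
  obtain ⟨j, hj⟩ := exists_le_colSum g x
  rw [abs_le]
  constructor
  · exact (neg_le.1 (((neg_le_abs _).trans (h i)))).trans (Real.log_le_log (colSum_pos g i) hi)
  · exact (Real.log_le_log (l1_mulVec_pos g x) hj).trans ((le_abs_self _).trans (h j))

/-- At distance at most `1/4`, `m(x, y) ≥ 1/2` and `log(1/m) ≤ 1/m - 1 ≤ 4 d(x, y)`. Farther apart,
the trivial bound `2 logCol g` is at most `8 logCol g · d(x, y)`. -/
theorem abs_sigma_sub_le (g : G d) (x y : SPlus d) :
    |sigma g x - sigma g y| ≤ (4 + 8 * logCol g) * dist x y := by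
  have hL := logCol_nonneg g
  rcases le_or_gt (dist x y) (1 / 4) with hd | hd
  · have key (x y : SPlus d) (hd : dist x y ≤ 1 / 4) :
        sigma g y - sigma g x ≤ 4 * dist x y := by
      have h1 := one_sub_mInf_le x y
      have h2 : 0 < mInf x y := by linarith
      have h3 : mInf x y * l1 (mulVec g y) ≤ l1 (mulVec g x) := by
        simp only [l1_mulVec, Finset.mul_sum]
        refine Finset.sum_le_sum fun j _ => ?_
        rw [mul_left_comm]
        exact mul_le_mul_of_nonneg_left (mInf_mul_le x y j) (colSum_pos g j).le
      have h4 := Real.log_le_log (mul_pos h2 (l1_mulVec_pos g y)) h3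
      rw [Real.log_mul h2.ne' (l1_mulVec_pos g y).ne'] at h4
      have h5 := Real.one_sub_inv_le_log_of_pos h2
      have h6 : (mInf x y)⁻¹ ≤ 1 + 4 * dist x y := by
        rw [inv_le_iff_one_le_mul₀ h2]
        nlinarith [dist_nonneg (x := x) (y := y)]
      unfold sigma
      linarith
    have h1 := key x y hd
    have h2 := key y x (by rwa [dist_comm])
    rw [dist_comm y x] at h2
    have h3 : 0 ≤ logCol g * dist x y := mul_nonneg hL dist_nonneg
    rw [abs_le]
    constructor <;> linarith
  · have h1 := abs_sigma_le g x
    have h2 := abs_sigma_le g y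
    have h3 := abs_sub (sigma g x) (sigma g y)
    nlinarith

/-! ### The operator norm and the moment condition -/

/-- The vertices of the simplex. -/
def vertex (j : Fin d) : SPlus d where
  val := Pi.single j 1
  nonneg i := by
    by_cases h : i = j
    · subst h; simp
    · simp [h]
  norm_eq := by
    rw [l1, Finset.sum_eq_single j] <;> simp +contextual

theorem l1_mulVec_vertex (g : G d) (j : Fin d) : l1 (mulVec g (vertex j)) = colSum g j := by
  rw [l1_mulVec, Finset.sum_eq_single j] <;> simp +contextual [vertex]

theorem sigma_vertex (g : G d) (j : Fin d) : sigma g (vertex j) = Real.log (colSum g j) := by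
  rw [sigma, l1_mulVec_vertex]

/-- By convexity the supremum over the `ℓ¹` sphere is attained at a vertex of the simplex. -/
theorem opNorm_eq [NeZero d] (g : G d) : opNorm g = ⨆ j, colSum g j := by
  have hne : Nonempty {x : Fin d → ℝ // l1 x = 1} := ⟨⟨(vertex 0).val, (vertex 0).norm_eq⟩⟩
  have hb : BddAbove (Set.range (colSum g)) := (Set.finite_range _).bddAbove
  have key (x : {x : Fin d → ℝ // l1 x = 1}) :
      l1 (Matrix.mulVec g.1 x.1) ≤ ⨆ j, colSum g j := by
    calc l1 (Matrix.mulVec g.1 x.1) ≤ ∑ i, ∑ j, g.1 i j * |x.1 j| := by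
          refine Finset.sum_le_sum fun i _ => ?_
          change |∑ j, g.1 i j * x.1 j| ≤ _
          refine (Finset.abs_sum_le_sum_abs (fun j => g.1 i j * x.1 j) _).trans_eq ?_
          exact Finset.sum_congr rfl fun j _ => by rw [abs_mul, abs_of_nonneg (g.2.1 i j)]
      _ = ∑ j, colSum g j * |x.1 j| := by
          rw [Finset.sum_comm]; simp only [colSum, Finset.sum_mul]
      _ ≤ ∑ j, (⨆ j, colSum g j) * |x.1 j| := Finset.sum_le_sum fun j _ =>
          mul_le_mul_of_nonneg_right (le_ciSup hb j) (abs_nonneg _)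
      _ = ⨆ j, colSum g j := by rw [← Finset.mul_sum, ← l1, x.2, mul_one]
  refine le_antisymm (ciSup_le key) (ciSup_le fun j => ?_)
  rw [← l1_mulVec_vertex]
  exact le_ciSup (f := fun x : {x : Fin d → ℝ // l1 x = 1} => l1 (Matrix.mulVec g.1 x.1))
    ⟨_, Set.forall_mem_range.2 key⟩ ⟨(vertex j).val, (vertex j).norm_eq⟩

theorem exists_opNorm_eq [NeZero d] (g : G d) : ∃ j, opNorm g = colSum g j := by
  rw [opNorm_eq]
  obtain ⟨j, hj⟩ := exists_eq_ciSup_of_finite (f := colSum g)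
  exact ⟨j, hj.symm⟩

theorem colSum_le_opNorm [NeZero d] (g : G d) (j : Fin d) : colSum g j ≤ opNorm g := by
  rw [opNorm_eq]
  exact le_ciSup (Set.finite_range _).bddAbove j

@[fun_prop]
theorem measurable_opNorm [NeZero d] : Measurable (opNorm (d := d)) := by
  rw [show opNorm (d := d) = fun g => ⨆ j, colSum g j from funext opNorm_eq]
  exact Measurable.iSup measurable_colSum

/-- Control of `σ` at the `d` vertices yields control of the norm. -/
theorem abs_log_opNorm_sub_le [NeZero d] (g : G d) (c : ℝ) :
    |Real.log (opNorm g) - c| ≤ ∑ j, |sigma g (vertex j) - c| := by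
  obtain ⟨j, hj⟩ := exists_opNorm_eq g
  rw [hj, ← sigma_vertex]
  exact Finset.single_le_sum (f := fun j => |sigma g (vertex j) - c|) (fun _ _ => abs_nonneg _)
    (Finset.mem_univ j)

/-- Every column sum lies between `v(g)` and `‖g‖`, being the value of `‖g x‖` at a vertex. -/
theorem logCol_le [NeZero d] (g : G d) : logCol g ≤ d * Real.log (bigN g) := by
  have hv : 0 < vInf g := by
    obtain ⟨j, hj⟩ := exists_eq_ciInf_of_finite (f := colSum g)
    have hne : Nonempty (SPlus d) := ⟨vertex 0⟩
    refine (colSum_pos g j).trans_le (le_ciInf fun x => ?_)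
    obtain ⟨k, hk⟩ := exists_colSum_le g x
    exact (hj.le.trans (ciInf_le (Set.finite_range _).bddBelow k)).trans hk
  have key (j : Fin d) : |Real.log (colSum g j)| ≤ Real.log (bigN g) := by
    have h0 := colSum_pos g j
    have h1 : colSum g j ≤ bigN g := (colSum_le_opNorm g j).trans (le_max_left _ _)
    have h2 : vInf g ≤ colSum g j := by
      rw [← l1_mulVec_vertex]
      exact ciInf_le ⟨0, Set.forall_mem_range.2 fun x => (l1_mulVec_pos g x).le⟩ (vertex j)
    have h3 : (colSum g j)⁻¹ ≤ bigN g := by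
      refine le_trans ?_ (le_max_right _ _)
      rw [one_div]
      exact inv_anti₀ hv h2
    rw [abs_le']
    refine ⟨Real.log_le_log h0 h1, ?_⟩
    rw [← Real.log_inv]
    exact Real.log_le_log (inv_pos.2 h0) h3
  calc logCol g ≤ ∑ _j : Fin d, Real.log (bigN g) := Finset.sum_le_sum fun j _ => key j
    _ = _ := by simp

theorem memLp_logCol [NeZero d] {μ : Measure (G d)} (h : HasMoment μ 2) :
    MemLp logCol 2 μ := by
  refine (memLp_two_iff_integrable_sq measurable_logCol.aestronglyMeasurable).2
    ⟨by fun_prop, ?_⟩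
  rw [hasFiniteIntegral_iff_ofReal (ae_of_all _ fun g => sq_nonneg _)]
  calc ∫⁻ g, ENNReal.ofReal (logCol g ^ 2) ∂μ
      ≤ ∫⁻ g, ENNReal.ofReal ((d : ℝ) ^ 2) * ENNReal.ofReal (Real.log (bigN g) ^ (2 : ℝ)) ∂μ := by
        refine lintegral_mono fun g => ?_
        rw [← ENNReal.ofReal_mul (by positivity), Real.rpow_two, ← mul_pow]
        exact ENNReal.ofReal_le_ofReal (pow_le_pow_left₀ (logCol_nonneg g) (logCol_le g) 2)
    _ = ENNReal.ofReal ((d : ℝ) ^ 2) * ∫⁻ g, ENNReal.ofReal (Real.log (bigN g) ^ (2 : ℝ)) ∂μ :=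
        lintegral_const_mul' _ _ ENNReal.ofReal_ne_top
    _ < ∞ := ENNReal.mul_lt_top ENNReal.ofReal_lt_top h

end

section

variable {d : ℕ}

/-! ### Convolution powers and averages -/

instance isProbabilityMeasure_convPow (μ : Measure (G d)) [IsProbabilityMeasure μ] (n : ℕ) :
    IsProbabilityMeasure (convPow μ n) := by
  induction n with
  | zero => exact Measure.dirac.isProbabilityMeasure
  | succ n ih => exact Measure.probabilitymeasure_of_probabilitymeasures_mconv μ _

theorem convPow_one (μ : Measure (G d)) [IsProbabilityMeasure μ] : convPow μ 1 = μ :=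
  Measure.mconv_dirac_one μ

theorem convPow_add (μ : Measure (G d)) [IsProbabilityMeasure μ] (m n : ℕ) :
    convPow μ (m + n) = (convPow μ m).mconv (convPow μ n) := by
  induction m with
  | zero => rw [zero_add, convPow, Measure.dirac_one_mconv]
  | succ m ih => rw [Nat.succ_add, convPow, ih, convPow, Measure.mconv_assoc]

theorem convPow_add_prod (μ : Measure (G d)) [IsProbabilityMeasure μ] (η : Measure (SPlus d))
    [IsProbabilityMeasure η] (m n : ℕ) :
    (convPow μ (m + n)).prod η =
      ((convPow μ m).prod ((convPow μ n).prod η)).map fun q => (q.1 * q.2.1, q.2.2) := by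
  rw [convPow_add, Measure.mconv, ← Measure.prodAssoc_prod, Measure.map_map (by fun_prop)
    (by fun_prop)]
  conv_lhs => rw [← Measure.map_id (μ := η)]
  rw [Measure.map_prod_map _ _ (by fun_prop) (by fun_prop)]
  rfl

variable {E : Type*} [NormedAddCommGroup E] [NormedSpace ℝ E]

/-- The average of `f (g · x)` when `g` has law `μ^{*n}`. -/
def avg (μ : Measure (G d)) (n : ℕ) (f : SPlus d → E) (x : SPlus d) : E :=
  ∫ g, f (act g x) ∂(convPow μ n)

theorem integrable_of_bounded {α : Type*} [MeasurableSpace α] {P : Measure α} [IsFiniteMeasure P]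
    {f : α → ℝ} {C : ℝ} (hf : Measurable f) (hC : ∀ a, |f a| ≤ C) : Integrable f P :=
  Integrable.of_bound hf.aestronglyMeasurable C (ae_of_all _ hC)

theorem abs_integral_le {α : Type*} [MeasurableSpace α] (P : Measure α) [IsProbabilityMeasure P]
    {f : α → ℝ} {C : ℝ} (hC : ∀ a, |f a| ≤ C) : |∫ a, f a ∂P| ≤ C := by
  have := norm_integral_le_of_norm_le_const (μ := P) (f := f) (ae_of_all _ hC)
  simpa using this

theorem integral_mconv {μ ν : Measure (G d)} [IsProbabilityMeasure μ] [IsProbabilityMeasure ν]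
    {f : G d → ℝ} (hf : Measurable f) (hi : Integrable f (μ.mconv ν)) :
    ∫ g, f g ∂(μ.mconv ν) = ∫ h, ∫ g, f (g * h) ∂μ ∂ν := by
  have hm : Measurable fun q : G d × G d => q.1 * q.2 := by fun_prop
  rw [Measure.mconv, integral_map hm.aemeasurable hf.aestronglyMeasurable]
  rw [Measure.mconv, integrable_map_measure hf.aestronglyMeasurable hm.aemeasurable] at hi
  exact integral_prod_symm _ hi

variable {μ : Measure (G d)} [IsProbabilityMeasure μ]

/-- In `g h · x` the right factor `h`, of law `μ^{*n}`, acts first; hence the outer average is the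
`n`-th one. -/
theorem avg_add {f : SPlus d → ℝ} {C : ℝ} (hf : Measurable f) (hC : ∀ x, |f x| ≤ C)
    (m n : ℕ) (x : SPlus d) : avg μ (m + n) f x = avg μ n (avg μ m f) x := by
  rw [avg, convPow_add, integral_mconv (f := fun g => f (act g x)) (by fun_prop)
    (integrable_of_bounded (by fun_prop) fun _ => hC _)]
  simp only [act_mul]
  rfl

omit [IsProbabilityMeasure μ] in
theorem avg_zero {f : SPlus d → ℝ} (hf : Measurable f) (x : SPlus d) : avg μ 0 f x = f x := by
  rw [avg, convPow, integral_dirac' _ _ (Measurable.stronglyMeasurable (by fun_prop)), act_one]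

theorem avg_one (f : SPlus d → E) (x : SPlus d) : avg μ 1 f x = ∫ g, f (act g x) ∂μ := by
  rw [avg, convPow_one]

theorem abs_avg_le {f : SPlus d → ℝ} {C : ℝ} (hC : ∀ x, |f x| ≤ C) (n : ℕ) (x : SPlus d) :
    |avg μ n f x| ≤ C :=
  abs_integral_le _ fun _ => hC _

theorem measurable_avg {f : SPlus d → ℝ} (hf : Measurable f) (n : ℕ) :
    Measurable (avg μ n f) := by
  have : Measurable fun q : SPlus d × G d => f (act q.2 q.1) := by fun_prop
  exact (this.stronglyMeasurable.integral_prod_right (ν := convPow μ n)).measurable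

/-! ### Contraction on average -/

/-- `μ^{*n}` contracts the distance by `κ` on average. -/
def ContractsBy (μ : Measure (G d)) (n : ℕ) (κ : ℝ) : Prop :=
  ∀ x y, ∫ g, dist (act g x) (act g y) ∂(convPow μ n) ≤ κ * dist x y

theorem integrable_dist_act (P : Measure (G d)) [IsFiniteMeasure P] (x y : SPlus d) :
    Integrable (fun g => dist (act g x) (act g y)) P :=
  integrable_of_bounded (by fun_prop) fun g => by
    rw [abs_of_nonneg dist_nonneg]; exact SPlus.dist_le_one _ _

theorem contractsBy_one (n : ℕ) : ContractsBy μ n 1 := fun x y => by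
  refine (integral_mono (integrable_dist_act _ x y) (integrable_const (dist x y))
    fun g => dist_act_le g x y).trans ?_
  simp

theorem ContractsBy.add {m n : ℕ} {a b : ℝ} (ha : 0 ≤ a) (hm : ContractsBy μ m a)
    (hn : ContractsBy μ n b) : ContractsBy μ (m + n) (a * b) := fun x y => by
  rw [convPow_add, integral_mconv (f := fun g => dist (act g x) (act g y)) (by fun_prop)
    (integrable_dist_act _ x y)]
  simp only [act_mul]
  calc ∫ h, ∫ g, dist (act g (act h x)) (act g (act h y)) ∂(convPow μ m) ∂(convPow μ n)
      ≤ ∫ h, a * dist (act h x) (act h y) ∂(convPow μ n) := by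
        refine integral_mono_of_nonneg (ae_of_all _ fun h => integral_nonneg fun g => dist_nonneg)
          ((integrable_dist_act _ x y).const_mul a) (ae_of_all _ fun h => hm _ _)
    _ ≤ a * (b * dist x y) := by
        rw [integral_const_mul]
        exact mul_le_mul_of_nonneg_left (hn x y) ha
    _ = a * b * dist x y := by ring

theorem ContractsBy.mul {r : ℕ} {ρ : ℝ} (hρ : 0 ≤ ρ) (h : ContractsBy μ r ρ) (q : ℕ) :
    ContractsBy μ (r * q) (ρ ^ q) := by
  induction q with
  | zero => simpa using contractsBy_one 0
  | succ q ih => rw [Nat.mul_succ, pow_succ]; exact ih.add (pow_nonneg hρ q) h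

/-- Some cross-ratio set has mass `p > 0` under `μ^{*r}`. On it distances shrink by `φ(θ)` and
elsewhere they do not grow, so the mean factor is at most `1 - p(1 - φ(θ))`. -/
theorem exists_contractsBy (hc : StrictlyContracting μ) :
    ∃ r : ℕ, 1 ≤ r ∧ ∃ ρ : ℝ, 0 < ρ ∧ ρ < 1 ∧ ContractsBy μ r ρ := by
  obtain ⟨r, hr, hpos⟩ := hc
  obtain ⟨n, hn⟩ : ∃ n : ℕ, convPow μ r (crossSet d (1 / ((n : ℝ) + 1))) ≠ 0 := by
    by_contra! h
    refine hpos.ne' (measure_mono_null (fun g hg => ?_) (measure_iUnion_null h))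
    exact Set.mem_iUnion.2 (exists_mem_crossSet hg)
  set θ : ℝ := 1 / ((n : ℝ) + 1) with hθ
  have hθ0 : 0 < θ := by positivity
  have hθ1 : θ ≤ 1 := by
    rw [hθ, div_le_one (by positivity)]
    linarith [Nat.cast_nonneg (α := ℝ) n]
  have hc0 : 0 ≤ phi θ := phi_nonneg hθ0.le hθ1
  have hc1 : phi θ < 1 := by
    rw [phi, div_lt_one (by linarith)]; linarith
  set B := crossSet d θ with hB
  have hBm : MeasurableSet B := measurableSet_crossSet θ
  set p := (convPow μ r).real B with hp
  have hp0 : 0 < p := ENNReal.toReal_pos hn (measure_ne_top _ _)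
  -- The maximum with `1/2` only keeps the factor positive, so that it can be inverted later.
  refine ⟨r, hr, max (1 / 2) (1 - p * (1 - phi θ)), by simp, ?_, fun x y => ?_⟩
  · rw [max_lt_iff]
    constructor
    · norm_num
    · nlinarith
  calc ∫ g, dist (act g x) (act g y) ∂(convPow μ r)
      ≤ ∫ g, (dist x y - B.indicator (fun _ => (1 - phi θ) * dist x y) g) ∂(convPow μ r) := by
        refine integral_mono (integrable_dist_act _ x y)
          ((integrable_const _).sub ((integrable_const _).indicator hBm)) fun g => ?_
        by_cases hg : g ∈ B
        · simp only [Set.indicator_of_mem hg]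
          linarith [dist_act_le_of_mem_crossSet hθ0.le hθ1 hg x y]
        · simp only [Set.indicator_of_notMem hg, sub_zero]
          exact dist_act_le g x y
    _ = (1 - p * (1 - phi θ)) * dist x y := by
        rw [integral_sub (integrable_const _) ((integrable_const _).indicator hBm),
          integral_indicator_const _ hBm]
        simp only [integral_const, probReal_univ, smul_eq_mul, one_mul, ← hp]
        ring
    _ ≤ _ := mul_le_mul_of_nonneg_right (le_max_right _ _) dist_nonneg

theorem exists_summable_contractsBy (hc : StrictlyContracting μ) :
    ∃ κ : ℕ → ℝ, (∀ n, 0 ≤ κ n) ∧ Summable κ ∧ ∀ n, ContractsBy μ n (κ n) := by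
  obtain ⟨r, hr, ρ, hρ0, hρ1, h⟩ := exists_contractsBy hc
  refine ⟨fun n => ρ ^ (n / r), fun n => by positivity, ?_, fun n => ?_⟩
  -- With `δ` the `r`-th root of `ρ`, the bound `ρ · ρ^⌊n/r⌋ = δ^(r(⌊n/r⌋+1)) ≤ δ^n` compares the
  -- sequence with a geometric one.
  · set δ : ℝ := ρ ^ ((r : ℝ)⁻¹) with hδ
    have hδr : δ ^ r = ρ := Real.rpow_inv_natCast_pow hρ0.le (by omega)
    have hδ0 : 0 ≤ δ := Real.rpow_nonneg hρ0.le _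
    have hδ1 : δ < 1 := by
      by_contra! h
      exact (hδr ▸ hρ1).not_ge (one_le_pow₀ h)
    refine Summable.of_nonneg_of_le (fun n => by positivity) (fun n => ?_)
      ((summable_geometric_of_lt_one hδ0 hδ1).mul_left ρ⁻¹)
    rw [le_inv_mul_iff₀ hρ0]
    calc ρ * ρ ^ (n / r) = δ ^ (r * (n / r + 1)) := by rw [pow_mul, hδr, pow_succ']
      _ ≤ δ ^ n := pow_le_pow_of_le_one hδ0 hδ1.le (Nat.lt_mul_div_succ n (by omega)).le
  · have := (h.mul hρ0.le (n / r)).add (pow_nonneg hρ0.le _) (contractsBy_one (n % r))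
    rwa [Nat.div_add_mod, mul_one] at this

theorem LipschitzWith.abs_sub_le {f : SPlus d → ℝ} {K : ℝ≥0} (hf : LipschitzWith K f)
    (x y : SPlus d) : |f x - f y| ≤ K * dist x y := by
  rw [← Real.dist_eq]
  exact hf.dist_le_mul x y

theorem LipschitzWith.exists_bound [NeZero d] {f : SPlus d → ℝ} {K : ℝ≥0}
    (hf : LipschitzWith K f) : ∃ C, ∀ x, |f x| ≤ C := by
  refine ⟨|f (vertex 0)| + K, fun x => ?_⟩
  have h1 := LipschitzWith.abs_sub_le hf x (vertex 0)
  have h2 : (K : ℝ) * dist x (vertex 0) ≤ K :=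
    mul_le_of_le_one_right K.2 (SPlus.dist_le_one _ _)
  have h3 := abs_sub_abs_le_abs_sub (f x) (f (vertex 0))
  linarith

theorem abs_avg_sub_le [NeZero d] {f : SPlus d → ℝ} {K : ℝ≥0} (hf : LipschitzWith K f) {n : ℕ}
    {κ : ℝ} (h : ContractsBy μ n κ) (x y : SPlus d) :
    |avg μ n f x - avg μ n f y| ≤ K * κ * dist x y := by
  obtain ⟨C, hC⟩ := LipschitzWith.exists_bound hf
  have hfm := hf.continuous.measurable
  have hi (x : SPlus d) : Integrable (fun g => f (act g x)) (convPow μ n) :=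
    integrable_of_bounded (by fun_prop) fun g => hC _
  rw [avg, avg, ← integral_sub (hi x) (hi y)]
  calc |∫ g, (f (act g x) - f (act g y)) ∂(convPow μ n)|
      ≤ ∫ g, K * dist (act g x) (act g y) ∂(convPow μ n) :=
        norm_integral_le_of_norm_le (f := fun g => f (act g x) - f (act g y))
          ((integrable_dist_act _ x y).const_mul _)
          (ae_of_all _ fun g => LipschitzWith.abs_sub_le hf _ _)
    _ ≤ K * (κ * dist x y) := by
        rw [integral_const_mul]
        exact mul_le_mul_of_nonneg_left (h x y) K.2
    _ = _ := by ring

/-! ### The invariant measure -/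

omit [IsProbabilityMeasure μ] in
theorem isInvariant_iff {ν : Measure (SPlus d)} :
    IsInvariant μ ν ↔ (μ.prod ν).map (fun q => act q.1 q.2) = ν := by
  have hm : Measurable fun q : G d × SPlus d => act q.1 q.2 := measurable_act
  constructor
  · intro h
    refine Measure.ext_of_lintegral _ fun f hf => ?_
    rw [lintegral_map hf hm, h f hf]
  · intro h f hf
    rw [← lintegral_map hf hm, h]

theorem integral_avg_eq {ν : Measure (SPlus d)} [IsProbabilityMeasure ν] (hν : IsInvariant μ ν)
    {f : SPlus d → ℝ} {C : ℝ} (hf : Measurable f) (hC : ∀ x, |f x| ≤ C) (n : ℕ) :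
    ∫ x, avg μ n f x ∂ν = ∫ x, f x ∂ν := by
  have hm : Measurable fun q : G d × SPlus d => act q.1 q.2 := measurable_act
  induction n with
  | zero => simp only [avg_zero hf]
  | succ n ih =>
    rw [← ih, ← (isInvariant_iff.1 hν), integral_map hm.aemeasurable
      (measurable_avg hf n).aestronglyMeasurable, isInvariant_iff.1 hν,
      integral_prod_symm _ (integrable_of_bounded
        (f := fun q : G d × SPlus d => avg μ n f (act q.1 q.2))
        ((measurable_avg hf n).comp hm) fun _ => abs_avg_le hC n _)]
    refine integral_congr_ae (ae_of_all _ fun x => ?_)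
    simp only [avg_add hf hC n 1]
    rw [avg_one]

/-- For Lipschitz `f`, the `n`-th average of `f` oscillates by at most `K κ_n`, while its integral
against either invariant measure is that of `f`. Letting `n → ∞`, the two measures agree on
Lipschitz functions. -/
theorem IsInvariant.unique [NeZero d] (hc : StrictlyContracting μ) {ν ν' : Measure (SPlus d)}
    [IsProbabilityMeasure ν] [IsProbabilityMeasure ν'] (hν : IsInvariant μ ν)
    (hν' : IsInvariant μ ν') : ν' = ν := by
  obtain ⟨κ, hκ0, hκ, hcon⟩ := exists_summable_contractsBy hc
  have key : ∀ f : SPlus d → ℝ, (∃ L, LipschitzWith L f) → ∫ x, f x ∂ν' = ∫ x, f x ∂ν := by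
    rintro f ⟨K, hK⟩
    obtain ⟨C, hC⟩ := LipschitzWith.exists_bound hK
    have hfm := hK.continuous.measurable
    have hb (n : ℕ) : |∫ x, f x ∂ν' - ∫ x, f x ∂ν| ≤ K * κ n := by
      rw [← integral_avg_eq hν hfm hC n, ← integral_avg_eq hν' hfm hC n]
      set t := avg μ n f with ht
      have htm : Measurable t := measurable_avg hfm n
      have hti (η : Measure (SPlus d)) [IsProbabilityMeasure η] : Integrable t η :=
        integrable_of_bounded htm fun x => abs_avg_le hC n x
      have h1 (x y : SPlus d) : |t x - t y| ≤ K * κ n :=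
        (abs_avg_sub_le hK (hcon n) x y).trans (mul_le_of_le_one_right
          (mul_nonneg K.2 (hκ0 n)) (SPlus.dist_le_one x y))
      have h2 (x : SPlus d) : |t x - ∫ y, t y ∂ν| ≤ K * κ n := by
        have h3 : t x - ∫ y, t y ∂ν = ∫ y, (t x - t y) ∂ν := by
          rw [integral_sub (integrable_const _) (hti ν)]; simp
        rw [h3]
        exact abs_integral_le ν (h1 x)
      have h4 : ∫ x, t x ∂ν' - ∫ y, t y ∂ν = ∫ x, (t x - ∫ y, t y ∂ν) ∂ν' := by
        rw [integral_sub (hti ν') (integrable_const _)]; simp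
      rw [h4]
      exact abs_integral_le ν' h2
    have h0 : Tendsto (fun n => K * κ n) atTop (𝓝 0) := by
      simpa using hκ.tendsto_atTop_zero.const_mul (K : ℝ)
    have := ge_of_tendsto' h0 hb
    exact sub_eq_zero.1 (abs_nonpos_iff.1 this)
  let p : ProbabilityMeasure (SPlus d) := ⟨ν, inferInstance⟩
  let p' : ProbabilityMeasure (SPlus d) := ⟨ν', inferInstance⟩
  -- The constant sequence `p'` converges weakly to `p`, as tested on bounded Lipschitz functions;
  -- uniqueness of limits gives equality.
  have h1 : Tendsto (fun _ : ℕ => p') atTop (𝓝 p) :=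
    tendsto_iff_forall_lipschitz_integral_tendsto.2 fun f _ hf =>
      tendsto_const_nhds.congr fun _ => (key f hf).symm
  exact congrArg (fun q : ProbabilityMeasure (SPlus d) => (q : Measure (SPlus d)))
    (tendsto_nhds_unique (tendsto_const_nhds (x := p') (f := (atTop : Filter ℕ))) h1)

end

section

variable {d : ℕ}

/-! ### Independence of the past -/

/-- The right products `Y_1 ⋯ Y_n`. -/
def rightProd {Ω : Type*} (Y : ℕ → Ω → G d) : ℕ → Ω → G d
  | 0, _ => 1
  | n + 1, ω => rightProd Y n ω * Y n ω

/-- The `σ`-algebra generated by the first `n` matrices. -/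
abbrev pastSigma {Ω : Type*} (Y : ℕ → Ω → G d) (n : ℕ) : MeasurableSpace Ω :=
  ⨆ k < n, MeasurableSpace.comap (Y k) inferInstance

section Past

variable {Ω : Type*} {Y : ℕ → Ω → G d}

theorem pastSigma_le [mΩ : MeasurableSpace Ω] (hY : ∀ n, Measurable (Y n)) (n : ℕ) :
    pastSigma Y n ≤ mΩ :=
  iSup₂_le fun k _ => (hY k).comap_le

theorem pastSigma_mono {m n : ℕ} (h : m ≤ n) : pastSigma Y m ≤ pastSigma Y n :=
  biSup_mono fun _ hk => lt_of_lt_of_le hk h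

theorem measurable_pastSigma {m n : ℕ} (h : m < n) : Measurable[pastSigma Y n] (Y m) :=
  measurable_iff_comap_le.2 (le_iSup₂_of_le m h le_rfl)

theorem measurable_pastSigma_rightProd (n : ℕ) : Measurable[pastSigma Y n] (rightProd Y n) := by
  induction n with
  | zero => exact measurable_const
  | succ n ih =>
    exact Measurable.mul (ih.mono (pastSigma_mono n.le_succ) le_rfl)
      (measurable_pastSigma n.lt_succ_self)

theorem measurable_pastSigma_leftProd (n : ℕ) : Measurable[pastSigma Y n] (leftProd Y n) := by
  induction n with
  | zero => exact measurable_const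
  | succ n ih =>
    exact Measurable.mul (measurable_pastSigma n.lt_succ_self)
      (ih.mono (pastSigma_mono n.le_succ) le_rfl)

theorem indep_pastSigma [MeasurableSpace Ω] {P : Measure Ω} (hY : ∀ n, Measurable (Y n))
    (h : iIndepFun Y P) (n : ℕ) :
    Indep (pastSigma Y n) (MeasurableSpace.comap (Y n) inferInstance) P := by
  have := indep_iSup_of_disjoint (fun k => (hY k).comap_le) h
    (S := {k | k < n}) (T := {n}) (by simp)
  simpa [pastSigma] using this

theorem map_rightProd [MeasurableSpace Ω] {P : Measure Ω} [IsProbabilityMeasure P]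
    {μ : Measure (G d)} [IsProbabilityMeasure μ] (hY : ∀ n, Measurable (Y n))
    (hlaw : ∀ n, P.map (Y n) = μ) (h : iIndepFun Y P) (n : ℕ) :
    P.map (rightProd Y n) = convPow μ n ∧
      P.map (fun ω => (rightProd Y n ω, Y n ω)) = (convPow μ n).prod μ := by
  have hm (n : ℕ) : Measurable (rightProd Y n) :=
    (measurable_pastSigma_rightProd n).mono (pastSigma_le hY n) le_rfl
  have hi (n : ℕ) : IndepFun (rightProd Y n) (Y n) P :=
    indep_of_indep_of_le_left (indep_pastSigma hY h n) (measurable_pastSigma_rightProd n).comap_le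
  have key : P.map (rightProd Y n) = convPow μ n := by
    induction n with
    | zero =>
      change P.map (fun _ => 1) = Measure.dirac 1
      rw [Measure.map_const, measure_univ, one_smul]
    | succ n ih =>
      have h1 := (indepFun_iff_map_prod_eq_prod_map_map (hm n).aemeasurable
        (hY n).aemeasurable).1 (hi n)
      rw [convPow_add, convPow_one, Measure.mconv, ← ih, ← hlaw n, ← h1,
        Measure.map_map (by fun_prop) ((hm n).prodMk (hY n))]
      rfl
  refine ⟨key, ?_⟩
  rw [(indepFun_iff_map_prod_eq_prod_map_map (hm n).aemeasurable
        (hY n).aemeasurable).1 (hi n), key, hlaw]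

end Past

/-! ### Existence of the invariant measure -/

variable {μ : Measure (G d)} [IsProbabilityMeasure μ]

/-- Right products are used because they converge pointwise: `Y_1 ⋯ Y_n · x` and `Y_1 ⋯ Y_n ·
(Y_{n+1} · x)` are at mean distance at most `κ_n`. These distances are almost surely summable, so
the sequence converges by completeness, and `ν` is the law of its limit. -/
theorem exists_tendsto_avg [NeZero d] (hc : StrictlyContracting μ) :
    ∃ ν : Measure (SPlus d), IsProbabilityMeasure ν ∧ ∃ x : SPlus d, ∀ f : SPlus d →ᵇ ℝ,
      Tendsto (fun n => avg μ n f x) atTop (𝓝 (∫ y, f y ∂ν)) := by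
  obtain ⟨κ, hκ0, hκ, hcon⟩ := exists_summable_contractsBy hc
  let P : Measure (ℕ → G d) := Measure.infinitePi fun _ => μ
  let Y : ℕ → (ℕ → G d) → G d := fun n ω => ω n
  have hY (n : ℕ) : Measurable (Y n) := measurable_pi_apply n
  have hlaw (n : ℕ) : P.map (Y n) = μ := Measure.infinitePi_map_eval _ n
  have hind : iIndepFun Y P := iIndepFun_infinitePi (X := fun _ => id) fun _ => measurable_id
  have hm (n : ℕ) : Measurable (rightProd Y n) :=
    (measurable_pastSigma_rightProd n).mono (pastSigma_le hY n) le_rfl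
  let x : SPlus d := vertex 0
  have hmx (n : ℕ) : Measurable fun ω => act (rightProd Y n ω) x :=
    measurable_act_comp (hm n) measurable_const
  have hstep (n : ℕ) : ∫⁻ ω, edist (act (rightProd Y n ω) x) (act (rightProd Y (n + 1) ω) x) ∂P ≤
      ENNReal.ofReal (κ n) := by
    have hmd : Measurable fun q : G d × G d => dist (act q.1 x) (act q.1 (act q.2 x)) := by
      fun_prop
    have h1 : ∫ q, dist (act q.1 x) (act q.1 (act q.2 x)) ∂((convPow μ n).prod μ) ≤ κ n := by
      rw [integral_prod_symm _ (integrable_of_bounded hmd fun q => by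
        rw [abs_of_nonneg dist_nonneg]; exact SPlus.dist_le_one _ _)]
      refine (integral_mono_of_nonneg (ae_of_all _ fun y => integral_nonneg fun g => dist_nonneg)
        (integrable_const (κ n)) (ae_of_all _ fun y => (hcon n x (act y x)).trans
          (mul_le_of_le_one_right (hκ0 n) (SPlus.dist_le_one _ _)))).trans ?_
      simp
    calc ∫⁻ ω, edist (act (rightProd Y n ω) x) (act (rightProd Y (n + 1) ω) x) ∂P
        = ∫⁻ q, ENNReal.ofReal (dist (act q.1 x) (act q.1 (act q.2 x)))
            ∂(P.map fun ω => (rightProd Y n ω, Y n ω)) := by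
          rw [lintegral_map (by fun_prop) ((hm n).prodMk (hY n))]
          simp only [rightProd, act_mul, edist_dist]
      _ = ENNReal.ofReal (∫ q, dist (act q.1 x) (act q.1 (act q.2 x)) ∂((convPow μ n).prod μ)) := by
          rw [(map_rightProd hY hlaw hind n).2, ofReal_integral_eq_lintegral_ofReal
            (integrable_of_bounded hmd fun q => by
              rw [abs_of_nonneg dist_nonneg]; exact SPlus.dist_le_one _ _)
            (ae_of_all _ fun q => dist_nonneg)]
      _ ≤ _ := ENNReal.ofReal_le_ofReal h1
  have hsum : ∫⁻ ω, ∑' n, edist (act (rightProd Y n ω) x) (act (rightProd Y (n + 1) ω) x) ∂P ≠ ∞ := by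
    rw [lintegral_tsum fun n => ((hmx n).edist (hmx (n + 1))).aemeasurable]
    exact ne_top_of_le_ne_top (hκ.tsum_ofReal_ne_top) (ENNReal.tsum_le_tsum hstep)
  have hae : ∀ᵐ ω ∂P, ∃ l, Tendsto (fun n => act (rightProd Y n ω) x) atTop (𝓝 l) := by
    filter_upwards [ae_lt_top' (AEMeasurable.tsum fun n =>
      ((hmx n).edist (hmx (n + 1))).aemeasurable) hsum] with ω hω
    exact cauchySeq_tendsto_of_complete
      (cauchySeq_of_edist_le_of_tsum_ne_top _ (fun n => le_rfl) hω.ne)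
  obtain ⟨Z, hZm, hZ⟩ := measurable_limit_of_tendsto_metrizable_ae
    (fun n => (hmx n).aemeasurable) hae
  refine ⟨P.map Z, Measure.isProbabilityMeasure_map hZm.aemeasurable, x, fun f => ?_⟩
  rw [integral_map hZm.aemeasurable f.continuous.measurable.aestronglyMeasurable]
  have h2 (n : ℕ) : avg μ n f x = ∫ ω, f (act (rightProd Y n ω) x) ∂P := by
    rw [avg, ← (map_rightProd hY hlaw hind n).1, integral_map (hm n).aemeasurable]
    exact (f.continuous.measurable.comp (by fun_prop)).aestronglyMeasurable
  simp only [h2]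
  refine tendsto_integral_of_dominated_convergence (fun _ => ‖f‖)
    (fun n => (f.continuous.measurable.comp (hmx n)).aestronglyMeasurable) (integrable_const _)
    (fun n => ae_of_all _ fun ω => f.norm_coe_le_norm _) ?_
  filter_upwards [hZ] with ω hω
  exact (f.continuous.tendsto _).comp hω

/-- The limit of the `n`-th averages is unchanged by the shift `n ↦ n + 1`. Applying it to `Pf`,
which is continuous because the action does not expand, gives `∫ Pf dν = ∫ f dν`. -/
theorem exists_isInvariant [NeZero d] (hc : StrictlyContracting μ) :
    ∃ ν : Measure (SPlus d), IsProbabilityMeasure ν ∧ IsInvariant μ ν := by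
  obtain ⟨ν, hν, x, h⟩ := exists_tendsto_avg hc
  refine ⟨ν, hν, isInvariant_iff.2 ?_⟩
  have hm : Measurable fun q : G d × SPlus d => act q.1 q.2 := measurable_act
  have : IsProbabilityMeasure ((μ.prod ν).map fun q => act q.1 q.2) :=
    Measure.isProbabilityMeasure_map hm.aemeasurable
  refine ext_of_forall_integral_eq_of_IsFiniteMeasure fun f => ?_
  have hf : Measurable f := f.continuous.measurable
  have hC : ∀ x, |f x| ≤ ‖f‖ := f.norm_coe_le_norm
  have hcont : Continuous (avg μ 1 f) := by
    refine continuous_of_dominated (bound := fun _ => ‖f‖)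
      (fun y => (hf.comp (by fun_prop)).aestronglyMeasurable)
      (fun y => ae_of_all _ fun g => hC _) (integrable_const _)
      (ae_of_all _ fun g => f.continuous.comp (continuous_act g))
  let f' : SPlus d →ᵇ ℝ := BoundedContinuousFunction.ofNormedAddCommGroup (avg μ 1 f) hcont ‖f‖
    fun y => abs_avg_le hC 1 y
  rw [integral_map hm.aemeasurable hf.aestronglyMeasurable, integral_prod_symm _
    (integrable_of_bounded (f := fun q : G d × SPlus d => f (act q.1 q.2)) (hf.comp hm)
      fun _ => hC _)]
  have h1 := h f'
  have h2 : Tendsto (fun n => avg μ n f' x) atTop (𝓝 (∫ y, f y ∂ν)) := by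
    refine ((tendsto_add_atTop_iff_nat 1).2 (h f)).congr fun n => ?_
    rw [add_comm, avg_add hf hC]
    rfl
  have h3 := tendsto_nhds_unique h1 h2
  rw [← h3]
  exact integral_congr_ae (ae_of_all _ fun y => (avg_one f y).symm)

/-! ### The Poisson equation -/

/-- The solution is the Neumann series `∑ P^n (f - ∫ f dν)`, dominated by `∑ K κ_n` both in sup norm
and in Lipschitz constant. -/
theorem exists_poisson [NeZero d] (hc : StrictlyContracting μ) {ν : Measure (SPlus d)}
    [IsProbabilityMeasure ν] (hν : IsInvariant μ ν) {f : SPlus d → ℝ} {K : ℝ≥0}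
    (hf : LipschitzWith K f) :
    ∃ u : SPlus d →ᵇ ℝ, (∃ K' : ℝ≥0, LipschitzWith K' u) ∧
      ∀ x, u x - ∫ g, u (act g x) ∂μ = f x - ∫ y, f y ∂ν := by
  obtain ⟨κ, hκ0, hκ, hcon⟩ := exists_summable_contractsBy hc
  set c := ∫ y, f y ∂ν with hcdef
  let f0 : SPlus d → ℝ := fun x => f x - c
  have hf0 : LipschitzWith K f0 := LipschitzWith.of_dist_le_mul fun x y => by
    simpa [f0] using hf.dist_le_mul x y
  obtain ⟨C, hC⟩ := LipschitzWith.exists_bound hf0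
  have hm0 : Measurable f0 := hf0.continuous.measurable
  have hmean : ∫ y, f0 y ∂ν = 0 := by
    obtain ⟨C', hC'⟩ := LipschitzWith.exists_bound hf
    rw [integral_sub (integrable_of_bounded hf.continuous.measurable hC') (integrable_const _)]
    simp [hcdef]
  set t : ℕ → SPlus d → ℝ := fun n => avg μ n f0 with ht
  have htm (n : ℕ) : Measurable (t n) := measurable_avg hm0 n
  have hlip (n : ℕ) (x y : SPlus d) : |t n x - t n y| ≤ K * κ n * dist x y :=
    abs_avg_sub_le hf0 (hcon n) x y
  have hbd (n : ℕ) (x : SPlus d) : |t n x| ≤ K * κ n := by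
    -- Each term has `ν`-mean zero, so its size is bounded by its oscillation.
    have h1 : t n x = ∫ y, (t n x - t n y) ∂ν := by
      rw [integral_sub (integrable_const _) (integrable_of_bounded (htm n) (abs_avg_le hC n)),
        ht, integral_avg_eq hν hm0 hC n, hmean]
      simp
    rw [h1]
    exact abs_integral_le ν fun y => (hlip n x y).trans (mul_le_of_le_one_right
          (mul_nonneg K.2 (hκ0 n)) (SPlus.dist_le_one x y))
  have hK : Summable fun n => (K : ℝ) * κ n := hκ.mul_left _
  have hs (x : SPlus d) : Summable fun n => t n x := hK.of_norm_bounded fun n => hbd n x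
  set u : SPlus d → ℝ := fun x => ∑' n, t n x with hu
  have hu1 (x : SPlus d) : |u x| ≤ ∑' n, K * κ n :=
    tsum_of_norm_bounded (f := fun n => t n x) hK.hasSum fun n => hbd n x
  have hu2 (x y : SPlus d) : |u x - u y| ≤ (∑' n, K * κ n) * dist x y := by
    rw [hu, ← (hs x).tsum_sub (hs y), ← tsum_mul_right]
    exact tsum_of_norm_bounded (f := fun n => t n x - t n y) (hK.mul_right _).hasSum fun n => hlip n x y
  have hK0 : 0 ≤ ∑' n, K * κ n := tsum_nonneg fun n => mul_nonneg K.2 (hκ0 n)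
  have hul : LipschitzWith ⟨∑' n, K * κ n, hK0⟩ u := LipschitzWith.of_dist_le_mul fun x y => by
    rw [Real.dist_eq]; exact hu2 x y
  refine ⟨BoundedContinuousFunction.ofNormedAddCommGroup u hul.continuous _ hu1, ⟨_, hul⟩,
    fun x => ?_⟩
  change u x - ∫ g, u (act g x) ∂μ = f0 x
  have h1 : ∫ g, u (act g x) ∂μ = ∑' n, t (n + 1) x := by
    have hi (n : ℕ) : Integrable (fun g => t n (act g x)) μ :=
      integrable_of_bounded ((htm n).comp (by fun_prop)) fun g => hbd n _
    rw [← integral_tsum_of_summable_integral_norm hi]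
    · refine tsum_congr fun n => ?_
      rw [ht]
      simp only [avg_add hm0 hC n 1]
      rw [avg_one]
    · refine Summable.of_nonneg_of_le (fun n => integral_nonneg fun g => norm_nonneg _)
        (fun n => ?_) hK
      exact (le_abs_self _).trans (abs_integral_le μ fun g => by
        rw [abs_of_nonneg (norm_nonneg _)]; exact hbd n _)
  rw [h1, hu]
  simp only
  rw [(hs x).tsum_eq_zero_add, ht]
  simp only [avg_zero hm0]
  ring

end

section

variable {d : ℕ}

/-! ### The corrected cocycle -/

/-- The cocycle corrected by a coboundary, `σ(g, x) - c + ψ(g · x) - ψ(x)`. -/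
def walk (c : ℝ) (ψ : SPlus d →ᵇ ℝ) (g : G d) (x : SPlus d) : ℝ :=
  sigma g x - c + ψ (act g x) - ψ x

theorem walk_mul (c c' : ℝ) (ψ : SPlus d →ᵇ ℝ) (g h : G d) (x : SPlus d) :
    walk (c + c') ψ (g * h) x = walk c ψ g (act h x) + walk c' ψ h x := by
  simp only [walk, sigma_mul, act_mul]
  ring

theorem walk_one (ψ : SPlus d →ᵇ ℝ) (x : SPlus d) : walk 0 ψ 1 x = 0 := by
  simp [walk, sigma_one, act_one]

@[fun_prop]
theorem measurable_walk_comp {α : Type*} [MeasurableSpace α] {c : ℝ} {ψ : SPlus d →ᵇ ℝ}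
    {f : α → G d} {g : α → SPlus d} (hf : Measurable f) (hg : Measurable g) :
    Measurable fun a => walk c ψ (f a) (g a) := by
  have hψ : Measurable ψ := ψ.continuous.measurable
  exact (((measurable_sigma_comp hf hg).sub_const c).add
    (hψ.comp (measurable_act_comp hf hg))).sub (hψ.comp hg)

theorem abs_walk_sub_le (c : ℝ) (ψ : SPlus d →ᵇ ℝ) (g : G d) (x : SPlus d) :
    |walk c ψ g x - (sigma g x - c)| ≤ 2 * ‖ψ‖ := by
  have h1 := ψ.norm_coe_le_norm (act g x)
  have h2 := ψ.norm_coe_le_norm x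
  rw [Real.norm_eq_abs, abs_le] at h1 h2
  rw [walk, abs_le]
  constructor <;> linarith

/-- A bound for the corrected cocycle that is uniform in `x`. -/
def walkBound (c : ℝ) (ψ : SPlus d →ᵇ ℝ) (g : G d) : ℝ := logCol g + |c| + 2 * ‖ψ‖ + 1

/-- The summand `1` in `walkBound` is there for this: constants can be absorbed into `walkBound`. -/
theorem one_le_walkBound (c : ℝ) (ψ : SPlus d →ᵇ ℝ) (g : G d) : 1 ≤ walkBound c ψ g := by
  have := logCol_nonneg g
  have := abs_nonneg c
  have := norm_nonneg ψ
  rw [walkBound]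
  linarith

theorem abs_walk_le (c : ℝ) (ψ : SPlus d →ᵇ ℝ) (g : G d) (x : SPlus d) :
    |walk c ψ g x| ≤ walkBound c ψ g := by
  have h1 := abs_le.1 (abs_walk_sub_le c ψ g x)
  have h2 := abs_le.1 (abs_sigma_le g x)
  have h3 := abs_le.1 (le_refl |c|)
  rw [walkBound, abs_le]
  constructor <;> linarith

@[fun_prop]
theorem measurable_walkBound (c : ℝ) (ψ : SPlus d →ᵇ ℝ) : Measurable (walkBound c ψ) := by
  unfold walkBound; fun_prop

variable {μ : Measure (G d)} [IsProbabilityMeasure μ]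

theorem memLp_walkBound (hL : MemLp logCol 2 μ) (c : ℝ) (ψ : SPlus d →ᵇ ℝ) :
    MemLp (walkBound c ψ) 2 μ :=
  ((hL.add (memLp_const |c|)).add (memLp_const (2 * ‖ψ‖))).add (memLp_const 1)

theorem memLp_walk (hL : MemLp logCol 2 μ) (c : ℝ) (ψ : SPlus d →ᵇ ℝ) (x : SPlus d) :
    MemLp (fun g => walk c ψ g x) 2 μ :=
  (memLp_walkBound hL c ψ).mono' (Measurable.aestronglyMeasurable (by fun_prop))
    (ae_of_all _ fun g => abs_walk_le c ψ g x)

theorem abs_walk_sub_walk_le {c : ℝ} {ψ : SPlus d →ᵇ ℝ} {K : ℝ≥0} (hψ : LipschitzWith K ψ)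
    (g : G d) (x y : SPlus d) :
    |walk c ψ g x - walk c ψ g y| ≤ (8 + 2 * K) * walkBound c ψ g * dist x y := by
  have h0 := dist_nonneg (x := x) (y := y)
  have h1 := abs_le.1 (abs_sigma_sub_le g x y)
  have h2 := abs_le.1 (LipschitzWith.abs_sub_le hψ x y)
  have h3 := abs_le.1 (LipschitzWith.abs_sub_le hψ (act g x) (act g y))
  have h4 : (K : ℝ) * dist (act g x) (act g y) ≤ K * dist x y :=
    mul_le_mul_of_nonneg_left (dist_act_le g x y) K.2
  have h5 : (4 + 8 * logCol g + 2 * K) * dist x y ≤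
      (8 + 2 * K) * walkBound c ψ g * dist x y := by
    refine mul_le_mul_of_nonneg_right ?_ h0
    have h6 : logCol g + 1 ≤ walkBound c ψ g := by
      have := abs_nonneg c
      have := norm_nonneg ψ
      rw [walkBound]
      linarith
    have h7 : (K : ℝ) * 1 ≤ K * walkBound c ψ g :=
      mul_le_mul_of_nonneg_left (one_le_walkBound c ψ g) K.2
    linarith
  refine le_trans ?_ h5
  rw [abs_le, walk, walk]
  constructor <;> linarith

/-- `ψ` is Lipschitz and makes the corrected cocycle centered. -/
structure IsCorrector (μ : Measure (G d)) (lam : ℝ) (ψ : SPlus d →ᵇ ℝ) : Prop where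
  lipschitz : ∃ K : ℝ≥0, LipschitzWith K ψ
  mean_zero : ∀ x, ∫ g, walk lam ψ g x ∂μ = 0

theorem integrable_sigma (hL : MemLp logCol 2 μ) (x : SPlus d) :
    Integrable (fun g => sigma g x) μ :=
  (hL.integrable one_le_two).mono' (Measurable.aestronglyMeasurable (by fun_prop))
    (ae_of_all _ fun g => abs_sigma_le g x)

theorem integrable_comp_act (ψ : SPlus d →ᵇ ℝ) (P : Measure (G d)) [IsFiniteMeasure P]
    (x : SPlus d) : Integrable (fun g => ψ (act g x)) P :=
  integrable_of_bounded (ψ.continuous.measurable.comp (by fun_prop))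
    fun g => ψ.norm_coe_le_norm _

/-- The mean drift `x ↦ ∫ σ(g, x) dμ(g)` is Lipschitz, and `ψ` solves the Poisson equation for it.
Here `lam` is the `ν`-mean of the drift; it is identified with `λ_μ` in `IsCorrector.lyapunov_eq`.
-/
theorem exists_isCorrector [NeZero d] (hc : StrictlyContracting μ) (hL : MemLp logCol 2 μ)
    {ν : Measure (SPlus d)} [IsProbabilityMeasure ν] (hν : IsInvariant μ ν) :
    ∃ lam ψ, IsCorrector μ lam ψ := by
  have hL1 := hL.integrable one_le_two
  have hI : Integrable (fun g => 4 + 8 * logCol g) μ := (integrable_const _).add (hL1.const_mul 8)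
  have hF : LipschitzWith (Real.toNNReal (∫ g, (4 + 8 * logCol g) ∂μ))
      fun x => ∫ g, sigma g x ∂μ := by
    refine LipschitzWith.of_dist_le_mul fun x y => ?_
    rw [Real.coe_toNNReal _ (integral_nonneg fun g => by
      change (0 : ℝ) ≤ 4 + 8 * logCol g
      linarith [logCol_nonneg g]), Real.dist_eq, ← integral_sub (integrable_sigma hL x)
      (integrable_sigma hL y), ← integral_mul_const]
    exact norm_integral_le_of_norm_le (f := fun g => sigma g x - sigma g y) (hI.mul_const _)
      (ae_of_all _ fun g => abs_sigma_sub_le g x y)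
  obtain ⟨u, hu, h⟩ := exists_poisson hc hν hF
  refine ⟨∫ y, ∫ g, sigma g y ∂μ ∂ν, u, hu, fun x => ?_⟩
  have h1 := h x
  have hi := integrable_sigma hL x
  have hi2 := integrable_comp_act u μ x
  set lam := ∫ y, ∫ g, sigma g y ∂μ ∂ν
  have hi3 : Integrable (fun g => sigma g x - lam) μ := hi.sub (integrable_const _)
  have hi4 : Integrable (fun g => sigma g x - lam + u (act g x)) μ := hi3.add hi2
  simp only [walk]
  rw [integral_sub hi4 (integrable_const _), integral_add hi3 hi2, integral_sub hi (integrable_const _)]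
  simp only [integral_const, probReal_univ, one_smul]
  linarith

/-- The conditional variance of the corrected cocycle. -/
def condVariance (μ : Measure (G d)) (lam : ℝ) (ψ : SPlus d →ᵇ ℝ) (x : SPlus d) : ℝ :=
  ∫ g, walk lam ψ g x ^ 2 ∂μ

theorem condVariance_nonneg (μ : Measure (G d)) (lam : ℝ) (ψ : SPlus d →ᵇ ℝ) (x : SPlus d) :
    0 ≤ condVariance μ lam ψ x := integral_nonneg fun _ => sq_nonneg _

/-- In `a² - b² = (a + b)(a - b)` each factor costs one `walkBound`, whose square is integrable.
This allows a second Poisson equation, for the variance. -/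
theorem IsCorrector.lipschitz_condVariance (hL : MemLp logCol 2 μ) {lam : ℝ} {ψ : SPlus d →ᵇ ℝ}
    (h : IsCorrector μ lam ψ) : ∃ K : ℝ≥0, LipschitzWith K (condVariance μ lam ψ) := by
  obtain ⟨K, hK⟩ := h.lipschitz
  have hB := (memLp_walkBound hL lam ψ).integrable_sq
  refine ⟨Real.toNNReal (∫ g, 2 * (8 + 2 * K) * walkBound lam ψ g ^ 2 ∂μ),
    LipschitzWith.of_dist_le_mul fun x y => ?_⟩
  rw [Real.coe_toNNReal _ (integral_nonneg fun g => by positivity), Real.dist_eq, condVariance,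
    condVariance, ← integral_sub (memLp_walk hL lam ψ x).integrable_sq
      (memLp_walk hL lam ψ y).integrable_sq, ← integral_mul_const]
  refine norm_integral_le_of_norm_le (f := fun g => walk lam ψ g x ^ 2 - walk lam ψ g y ^ 2)
    ((hB.const_mul _).mul_const _) (ae_of_all _ fun g => ?_)
  have h1 := abs_walk_sub_walk_le hK g x y (c := lam)
  have h2 := abs_walk_le lam ψ g x
  have h3 := abs_walk_le lam ψ g y
  have h4 : |walk lam ψ g x + walk lam ψ g y| ≤ 2 * walkBound lam ψ g :=
    (abs_add_le _ _).trans (by linarith)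
  calc ‖walk lam ψ g x ^ 2 - walk lam ψ g y ^ 2‖
      = |walk lam ψ g x + walk lam ψ g y| * |walk lam ψ g x - walk lam ψ g y| := by
        rw [Real.norm_eq_abs, ← abs_mul]; congr 1; ring
    _ ≤ (2 * walkBound lam ψ g) * ((8 + 2 * K) * walkBound lam ψ g * dist x y) :=
        mul_le_mul h4 h1 (abs_nonneg _) ((abs_nonneg _).trans h4)
    _ = _ := by ring

/-! ### Second moments -/

theorem convPow_succ_prod (μ : Measure (G d)) [IsProbabilityMeasure μ] (η : Measure (SPlus d))
    [IsProbabilityMeasure η] (n : ℕ) :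
    (convPow μ (n + 1)).prod η =
      (μ.prod ((convPow μ n).prod η)).map fun q => (q.1 * q.2.1, q.2.2) := by
  rw [add_comm, convPow_add_prod, convPow_one]

section Moments

variable {η : Measure (SPlus d)} [IsProbabilityMeasure η] {E : Type*} [NormedAddCommGroup E]

theorem integral_convPow_succ_prod [NormedSpace ℝ E] {n : ℕ} {F : G d × SPlus d → E}
    (hF : StronglyMeasurable F) (hi : Integrable F ((convPow μ (n + 1)).prod η)) :
    ∫ q, F q ∂((convPow μ (n + 1)).prod η) =
      ∫ q, ∫ g, F (g * q.1, q.2) ∂μ ∂((convPow μ n).prod η) := by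
  have hm : Measurable fun q : G d × (G d × SPlus d) => (q.1 * q.2.1, q.2.2) := by fun_prop
  rw [convPow_succ_prod] at hi ⊢
  rw [integral_map hm.aemeasurable hF.aestronglyMeasurable]
  rw [integrable_map_measure hF.aestronglyMeasurable hm.aemeasurable] at hi
  exact integral_prod_symm _ hi

theorem memLp_walk_convPow (hL : MemLp logCol 2 μ) (lam : ℝ) (ψ : SPlus d →ᵇ ℝ) (n : ℕ) :
    MemLp (fun q : G d × SPlus d => walk (n * lam) ψ q.1 q.2) 2 ((convPow μ n).prod η) := by
  induction n with
  | zero =>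
    rw [convPow, Measure.dirac_prod, memLp_map_measure_iff
      (Measurable.aestronglyMeasurable (by fun_prop)) (by fun_prop)]
    refine (memLp_const (0 : ℝ)).congr_norm (Measurable.aestronglyMeasurable (by fun_prop))
      (ae_of_all _ fun x => ?_)
    simp [walk_one]
  | succ n ih =>
    rw [convPow_succ_prod, memLp_map_measure_iff
      (Measurable.aestronglyMeasurable (by fun_prop)) (by fun_prop)]
    have h1 : MemLp (fun q : G d × (G d × SPlus d) => walk lam ψ q.1 (act q.2.1 q.2.2)) 2
        (μ.prod ((convPow μ n).prod η)) :=
      ((memLp_walkBound hL lam ψ).comp_measurePreserving measurePreserving_fst).mono'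
        (Measurable.aestronglyMeasurable (by fun_prop))
        (ae_of_all _ fun q => abs_walk_le lam ψ q.1 _)
    have h2 := h1.add (ih.comp_measurePreserving (measurePreserving_snd (μ := μ)))
    refine h2.congr_norm (Measurable.aestronglyMeasurable (by fun_prop)) (ae_of_all _ fun q => ?_)
    simp only [Function.comp, Pi.add_apply]
    rw [← walk_mul, Nat.cast_succ, add_mul, one_mul, add_comm lam]

/-- Orthogonality of martingale increments: integrating over the last matrix first, the cross term
vanishes by `mean_zero`. -/
theorem IsCorrector.integral_sq_succ (hL : MemLp logCol 2 μ) {lam : ℝ} {ψ : SPlus d →ᵇ ℝ}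
    (h : IsCorrector μ lam ψ) (n : ℕ) :
    ∫ q, walk ((n + 1 : ℕ) * lam) ψ q.1 q.2 ^ 2 ∂((convPow μ (n + 1)).prod η) =
      ∫ q, condVariance μ lam ψ (act q.1 q.2) ∂((convPow μ n).prod η) +
      ∫ q, walk (n * lam) ψ q.1 q.2 ^ 2 ∂((convPow μ n).prod η) := by
  have hw := memLp_walk_convPow (η := η) hL lam ψ
  rw [integral_convPow_succ_prod (Measurable.stronglyMeasurable (by fun_prop)) (hw _).integrable_sq]
  have hin (q : G d × SPlus d) :
      ∫ g, walk ((n + 1 : ℕ) * lam) ψ (g * q.1) q.2 ^ 2 ∂μ =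
        condVariance μ lam ψ (act q.1 q.2) + walk (n * lam) ψ q.1 q.2 ^ 2 := by
    have hx := memLp_walk hL lam ψ (act q.1 q.2)
    set w := walk (n * lam) ψ q.1 q.2 with hwd
    have h1 (g : G d) : walk ((n + 1 : ℕ) * lam) ψ (g * q.1) q.2 ^ 2 =
        walk lam ψ g (act q.1 q.2) ^ 2 + 2 * w * walk lam ψ g (act q.1 q.2) + w ^ 2 := by
      rw [Nat.cast_succ, add_mul, one_mul, add_comm _ lam, walk_mul, ← hwd]
      ring
    simp only [h1]
    have h2 : Integrable (fun g => walk lam ψ g (act q.1 q.2) ^ 2 +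
        2 * w * walk lam ψ g (act q.1 q.2)) μ :=
      hx.integrable_sq.add ((hx.integrable one_le_two).const_mul _)
    rw [integral_add h2 (integrable_const _), integral_add hx.integrable_sq
      ((hx.integrable one_le_two).const_mul _), integral_const_mul, h.mean_zero]
    simp [condVariance]
  simp only [hin]
  obtain ⟨K, hK⟩ := h.lipschitz_condVariance hL
  refine integral_add ?_ (hw n).integrable_sq
  obtain ⟨C, hC⟩ : ∃ C, ∀ x, |condVariance μ lam ψ x| ≤ C := by
    refine ⟨∫ g, walkBound lam ψ g ^ 2 ∂μ, fun x => ?_⟩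
    rw [abs_of_nonneg (condVariance_nonneg _ _ _ _)]
    refine integral_mono (memLp_walk hL lam ψ x).integrable_sq
      (memLp_walkBound hL lam ψ).integrable_sq fun g => ?_
    exact sq_le_sq.2 ((abs_walk_le lam ψ g x).trans (le_abs_self _))
  exact integrable_of_bounded (hK.continuous.measurable.comp (by fun_prop)) fun q => hC _

end Moments

end

section

variable {d : ℕ} {μ : Measure (G d)} [IsProbabilityMeasure μ]

/-! ### Growth of the moments along the walk -/

theorem condVariance_le (hL : MemLp logCol 2 μ) (lam : ℝ) (ψ : SPlus d →ᵇ ℝ) (x : SPlus d) :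
    condVariance μ lam ψ x ≤ ∫ g, walkBound lam ψ g ^ 2 ∂μ :=
  integral_mono (memLp_walk hL lam ψ x).integrable_sq (memLp_walkBound hL lam ψ).integrable_sq
    fun g => sq_le_sq.2 ((abs_walk_le lam ψ g x).trans (le_abs_self _))

theorem abs_condVariance_le (hL : MemLp logCol 2 μ) (lam : ℝ) (ψ : SPlus d →ᵇ ℝ) (x : SPlus d) :
    |condVariance μ lam ψ x| ≤ ∫ g, walkBound lam ψ g ^ 2 ∂μ := by
  rw [abs_of_nonneg (condVariance_nonneg _ _ _ _)]
  exact condVariance_le hL lam ψ x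

section Asymptotics

variable {η : Measure (SPlus d)} [IsProbabilityMeasure η] {lam : ℝ} {ψ : SPlus d →ᵇ ℝ}

omit [IsProbabilityMeasure μ] in
theorem integral_sq_walk_zero :
    ∫ q, walk ((0 : ℕ) * lam) ψ q.1 q.2 ^ 2 ∂((convPow μ 0).prod η) = 0 := by
  rw [convPow, Measure.dirac_prod, integral_map (by fun_prop)
    (Measurable.aestronglyMeasurable (by fun_prop))]
  simp [walk_one]

/-- The initial law `η` is arbitrary, so that it can later be a Dirac mass at a vertex. -/
theorem IsCorrector.integral_sq_le (hL : MemLp logCol 2 μ) (h : IsCorrector μ lam ψ) (n : ℕ) :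
    ∫ q, walk (n * lam) ψ q.1 q.2 ^ 2 ∂((convPow μ n).prod η) ≤
      n * ∫ g, walkBound lam ψ g ^ 2 ∂μ := by
  induction n with
  | zero => rw [integral_sq_walk_zero]; simp
  | succ n ih =>
    rw [h.integral_sq_succ hL]
    have h1 := abs_integral_le ((convPow μ n).prod η)
      fun q : G d × SPlus d => abs_condVariance_le hL lam ψ (act q.1 q.2)
    have h2 := (abs_le.1 h1).2
    push_cast
    linarith

/-- Under an invariant initial law every step contributes the same mean variance, so the formula is
exact. -/
theorem IsCorrector.integral_sq_eq (hL : MemLp logCol 2 μ) (h : IsCorrector μ lam ψ)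
    (hη : IsInvariant μ η) (n : ℕ) :
    ∫ q, walk (n * lam) ψ q.1 q.2 ^ 2 ∂((convPow μ n).prod η) =
      n * ∫ x, condVariance μ lam ψ x ∂η := by
  induction n with
  | zero => rw [integral_sq_walk_zero]; simp
  | succ n ih =>
    obtain ⟨K, hK⟩ := h.lipschitz_condVariance hL
    have hm := hK.continuous.measurable
    rw [h.integral_sq_succ hL, ih, integral_prod_symm _ (integrable_of_bounded (by fun_prop)
      fun q => abs_condVariance_le hL lam ψ (act q.1 q.2))]
    change ∫ x, avg μ n (condVariance μ lam ψ) x ∂η + _ = _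
    rw [integral_avg_eq hη hm (abs_condVariance_le hL lam ψ)]
    push_cast
    ring

theorem integrable_abs_walk (hL : MemLp logCol 2 μ) (n : ℕ) :
    Integrable (fun q : G d × SPlus d => |walk (n * lam) ψ q.1 q.2|) ((convPow μ n).prod η) :=
  ((memLp_walk_convPow hL lam ψ n).integrable one_le_two).abs

theorem IsCorrector.integral_abs_le (hL : MemLp logCol 2 μ) (h : IsCorrector μ lam ψ) {n : ℕ}
    (hn : 1 ≤ n) :
    ∫ q, |walk (n * lam) ψ q.1 q.2| ∂((convPow μ n).prod η) ≤
      (∫ g, walkBound lam ψ g ^ 2 ∂μ + 1) * √n := by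
  have hs : 0 < √(n : ℝ) := Real.sqrt_pos.2 (by exact_mod_cast hn)
  have hss : √(n : ℝ) * √(n : ℝ) = n := Real.mul_self_sqrt (by positivity)
  have hw := memLp_walk_convPow (η := η) hL lam ψ n
  -- The pointwise inequality `|w| ≤ w²/√n + √n` replaces Cauchy–Schwarz.
  have h1 : ∫ q, |walk (n * lam) ψ q.1 q.2| ∂((convPow μ n).prod η) ≤
      ∫ q, (walk (n * lam) ψ q.1 q.2 ^ 2 / √n + √n) ∂((convPow μ n).prod η) := by
    refine integral_mono (integrable_abs_walk hL n)
      ((hw.integrable_sq.div_const _).add (integrable_const _)) fun q => ?_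
    set w := walk (n * lam) ψ q.1 q.2
    change |w| ≤ w ^ 2 / √n + √n
    rw [← sq_abs w, div_add' _ _ _ hs.ne', le_div_iff₀ hs]
    nlinarith [sq_nonneg (|w| - √n), sq_nonneg (|w|), abs_nonneg w]
  rw [integral_add (hw.integrable_sq.div_const _) (integrable_const _), integral_div] at h1
  simp only [integral_const, probReal_univ, one_smul] at h1
  refine h1.trans ?_
  rw [add_mul, one_mul]
  gcongr
  rw [div_le_iff₀ hs, mul_assoc, hss]
  exact (h.integral_sq_le (η := η) hL n).trans_eq (mul_comm _ _)

theorem tendsto_sqrt_div_atTop : Tendsto (fun n : ℕ => √(n : ℝ) / n) atTop (𝓝 0) := by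
  have h1 : Tendsto (fun n : ℕ => (√(n : ℝ))⁻¹) atTop (𝓝 0) :=
    tendsto_inv_atTop_zero.comp (Real.tendsto_sqrt_atTop.comp tendsto_natCast_atTop_atTop)
  refine h1.congr fun n => ?_
  rw [Real.sqrt_div_self]

theorem IsCorrector.tendsto_integral_abs (hL : MemLp logCol 2 μ) (h : IsCorrector μ lam ψ) :
    Tendsto (fun n : ℕ => (∫ q, |walk (n * lam) ψ q.1 q.2| ∂((convPow μ n).prod η)) / n) atTop
      (𝓝 0) := by
  have h0 : Tendsto (fun n : ℕ => (∫ g, walkBound lam ψ g ^ 2 ∂μ + 1) * (√(n : ℝ) / n)) atTop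
      (𝓝 0) := by simpa using tendsto_sqrt_div_atTop.const_mul _
  refine squeeze_zero' (Eventually.of_forall fun n => ?_) ?_ h0
  · exact div_nonneg (integral_nonneg fun q => abs_nonneg _) (by positivity)
  · filter_upwards [eventually_ge_atTop 1] with n hn
    rw [← mul_div_assoc]
    exact div_le_div_of_nonneg_right (h.integral_abs_le hL hn) (by positivity)

/-! ### The Lyapunov exponent -/

theorem memLp_sigma_convPow (hL : MemLp logCol 2 μ) (n : ℕ) :
    MemLp (fun q : G d × SPlus d => sigma q.1 q.2) 2 ((convPow μ n).prod η) := by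
  refine (memLp_walk_convPow (η := η) hL 0 0 n).congr_norm
    (Measurable.aestronglyMeasurable (by fun_prop)) (ae_of_all _ fun q => ?_)
  simp [walk]

theorem memLp_sigma_convPow_left (hL : MemLp logCol 2 μ) (n : ℕ) (x : SPlus d) :
    MemLp (fun g => sigma g x) 2 (convPow μ n) := by
  have h := memLp_sigma_convPow (η := Measure.dirac x) hL n
  rw [Measure.prod_dirac, memLp_map_measure_iff
    (Measurable.aestronglyMeasurable (by fun_prop)) (by fun_prop)] at h
  exact h

theorem integrable_log_opNorm [NeZero d] (hL : MemLp logCol 2 μ) (n : ℕ) :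
    Integrable (fun g => Real.log (opNorm g)) (convPow μ n) := by
  refine Integrable.mono' (g := fun g => ∑ j, |sigma g (vertex j)|)
    (integrable_finsetSum _ fun j _ =>
      ((memLp_sigma_convPow_left hL n _).integrable one_le_two).abs)
    (measurable_opNorm.log.aestronglyMeasurable) (ae_of_all _ fun g => ?_)
  simpa using abs_log_opNorm_sub_le g 0

/-- The first moment bound is applied from each vertex; the passage from `walk` back to `σ` costs
`2‖ψ‖`, negligible after division by `n`. -/
theorem IsCorrector.tendsto_integral_opNorm [NeZero d] (hL : MemLp logCol 2 μ)
    (h : IsCorrector μ lam ψ) :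
    Tendsto (fun n : ℕ => ∫ g, |Real.log (opNorm g) / n - lam| ∂(convPow μ n)) atTop (𝓝 0) := by
  set D : ℕ → Fin d → ℝ := fun n j =>
    (∫ q, |walk (n * lam) ψ q.1 q.2| ∂((convPow μ n).prod (Measure.dirac (vertex j)))) / n with hD
  have h0 : Tendsto (fun n : ℕ => ∑ j, (D n j + 2 * ‖ψ‖ / n)) atTop (𝓝 0) := by
    rw [show (0 : ℝ) = ∑ _j : Fin d, ((0 : ℝ) + 0) by simp]
    exact tendsto_finsetSum _ fun j _ => (h.tendsto_integral_abs hL).add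
      (tendsto_const_div_atTop_nhds_zero_nat _)
  refine squeeze_zero' (Eventually.of_forall fun n => integral_nonneg fun q => abs_nonneg _) ?_ h0
  filter_upwards [eventually_ge_atTop 1] with n hn
  have hn0 : (0 : ℝ) < n := by exact_mod_cast hn
  have hw (j : Fin d) : Integrable (fun g => |walk (n * lam) ψ g (vertex j)|) (convPow μ n) ∧
      ∫ q, |walk (n * lam) ψ q.1 q.2| ∂((convPow μ n).prod (Measure.dirac (vertex j))) =
        ∫ g, |walk (n * lam) ψ g (vertex j)| ∂(convPow μ n) := by
    have hi := integrable_abs_walk (lam := lam) (ψ := ψ) (η := Measure.dirac (vertex j)) hL n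
    rw [Measure.prod_dirac] at hi ⊢
    constructor
    · rwa [integrable_map_measure (Measurable.aestronglyMeasurable (by fun_prop))
        (by fun_prop)] at hi
    · rw [integral_map (by fun_prop) (Measurable.aestronglyMeasurable (by fun_prop))]
  calc ∫ g, |Real.log (opNorm g) / n - lam| ∂(convPow μ n)
      ≤ ∫ g, ∑ j, (|walk (n * lam) ψ g (vertex j)| / n + 2 * ‖ψ‖ / n) ∂(convPow μ n) := by
        refine integral_mono_of_nonneg (ae_of_all _ fun g => abs_nonneg _)
          (integrable_finsetSum _ fun j _ => ((hw j).1.div_const _).add (integrable_const _))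
          (ae_of_all _ fun g => ?_)
        have e : |Real.log (opNorm g) / n - lam| = |Real.log (opNorm g) - n * lam| / n := by
          rw [← abs_of_pos hn0, ← abs_div, abs_of_pos hn0, sub_div,
            mul_div_cancel_left₀ _ hn0.ne']
        simp only [e]
        rw [div_le_iff₀ hn0, Finset.sum_mul]
        refine (abs_log_opNorm_sub_le g _).trans (Finset.sum_le_sum fun j _ => ?_)
        rw [← add_div, div_mul_cancel₀ _ hn0.ne']
        have h1 := abs_le.1 (abs_walk_sub_le (n * lam) ψ g (vertex j))
        have h2 := abs_le.1 (le_refl |walk (n * lam) ψ g (vertex j)|)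
        rw [abs_le]
        constructor <;> linarith
    _ = ∑ j, (D n j + 2 * ‖ψ‖ / n) := by
        have hi (j : Fin d) : Integrable (fun g => |walk (n * lam) ψ g (vertex j)| / n +
            2 * ‖ψ‖ / n) (convPow μ n) := ((hw j).1.div_const _).add (integrable_const _)
        rw [integral_finsetSum _ fun j _ => hi j]
        refine Finset.sum_congr rfl fun j _ => ?_
        rw [integral_add ((hw j).1.div_const _) (integrable_const _), integral_div, hD]
        simp only [(hw j).2, integral_const, probReal_univ, one_smul]

theorem IsCorrector.lyapunov_eq [NeZero d] (hL : MemLp logCol 2 μ) (h : IsCorrector μ lam ψ) :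
    lyapunov μ = lam := by
  refine Tendsto.limUnder_eq (tendsto_iff_norm_sub_tendsto_zero.2 ?_)
  refine squeeze_zero (fun n => norm_nonneg _) (fun n => ?_) (h.tendsto_integral_opNorm hL)
  have hi := (integrable_log_opNorm hL n).div_const (n : ℝ)
  have e : (∫ g, Real.log (opNorm g) ∂(convPow μ n)) / n - lam =
      ∫ g, (Real.log (opNorm g) / n - lam) ∂(convPow μ n) := by
    rw [integral_sub hi (integrable_const _), integral_div]
    simp
  rw [e]
  exact norm_integral_le_integral_norm _

/-! ### The asymptotic variance -/

/-- The quantities `σ - nλ` and `walk` differ by at most `B = 2‖ψ‖`, hence their squares by at most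
`2B|walk| + B²`, whose mean is `o(n)`. -/
theorem IsCorrector.tendsto_integral_sq (hL : MemLp logCol 2 μ) (h : IsCorrector μ lam ψ)
    (hη : IsInvariant μ η) :
    Tendsto (fun n : ℕ => (∫ q, (sigma q.1 q.2 - n * lam) ^ 2 ∂((convPow μ n).prod η)) / n) atTop
      (𝓝 (∫ x, condVariance μ lam ψ x ∂η)) := by
  set s := ∫ x, condVariance μ lam ψ x ∂η
  set B := 2 * ‖ψ‖ with hB
  have hB0 : 0 ≤ B := by positivity
  have h0 : Tendsto (fun n : ℕ => 2 * B * ((∫ q, |walk (n * lam) ψ q.1 q.2|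
      ∂((convPow μ n).prod η)) / n) + B ^ 2 / n) atTop (𝓝 0) := by
    simpa using ((h.tendsto_integral_abs hL).const_mul (2 * B)).add
      (tendsto_const_div_atTop_nhds_zero_nat (B ^ 2))
  refine tendsto_iff_norm_sub_tendsto_zero.2
    (squeeze_zero' (Eventually.of_forall fun n => norm_nonneg _) ?_ h0)
  filter_upwards [eventually_ge_atTop 1] with n hn
  have hn0 : (0 : ℝ) < n := by exact_mod_cast hn
  set π := (convPow μ n).prod η
  have hw := memLp_walk_convPow (η := η) hL lam ψ n
  have hS : MemLp (fun q : G d × SPlus d => sigma q.1 q.2 - n * lam) 2 π :=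
    (memLp_sigma_convPow hL n).sub (memLp_const _)
  have hiw := integrable_abs_walk (lam := lam) (ψ := ψ) (η := η) hL n
  have e : (∫ q, (sigma q.1 q.2 - n * lam) ^ 2 ∂π) / n - s =
      (∫ q, ((sigma q.1 q.2 - n * lam) ^ 2 - walk (n * lam) ψ q.1 q.2 ^ 2) ∂π) / n := by
    rw [integral_sub hS.integrable_sq hw.integrable_sq, h.integral_sq_eq hL hη, sub_div,
      mul_div_cancel_left₀ _ hn0.ne']
  rw [e, norm_div, Real.norm_of_nonneg hn0.le, ← mul_div_assoc, ← add_div]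
  refine div_le_div_of_nonneg_right ?_ hn0.le
  calc ‖∫ q, ((sigma q.1 q.2 - n * lam) ^ 2 - walk (n * lam) ψ q.1 q.2 ^ 2) ∂π‖
      ≤ ∫ q, (2 * B * |walk (n * lam) ψ q.1 q.2| + B ^ 2) ∂π := by
        refine norm_integral_le_of_norm_le ((hiw.const_mul _).add (integrable_const _))
          (ae_of_all _ fun q => ?_)
        have h1 := abs_walk_sub_le (n * lam) ψ q.1 q.2
        set w := walk (n * lam) ψ q.1 q.2
        set b := w - (sigma q.1 q.2 - n * lam) with hb
        rw [show (sigma q.1 q.2 - n * lam) ^ 2 - w ^ 2 = -(2 * b * w) + b ^ 2 by rw [hb]; ring]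
        refine (norm_add_le _ _).trans ?_
        rw [norm_neg, norm_mul, norm_mul, norm_pow, Real.norm_eq_abs, Real.norm_eq_abs,
          Real.norm_eq_abs, abs_two]
        gcongr
    _ = _ := by
        rw [integral_add (hiw.const_mul _) (integrable_const _), integral_const_mul]
        simp [π]

end Asymptotics

end

section

variable {d : ℕ} {μ : Measure (G d)} [IsProbabilityMeasure μ]

/-! ### The central limit theorem -/

theorem norm_exp_sub_one_le (y : ℝ) : ‖Complex.exp (y * Complex.I) - 1‖ ≤ 2 * min 1 |y| := by
  rw [mul_comm]
  rcases le_total 1 |y| with h | h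
  · rw [min_eq_left h]
    refine (norm_sub_le _ _).trans ?_
    rw [mul_comm, Complex.norm_exp_ofReal_mul_I]
    norm_num
  · rw [min_eq_right h]
    have := Real.norm_exp_I_mul_ofReal_sub_one_le (x := y)
    rw [Real.norm_eq_abs] at this
    linarith [abs_nonneg y]

/-- The factor `min 1 |y|` interpolates between the cubic remainder and the trivial quadratic bound,
so only second moments are needed. -/
theorem norm_exp_sub_taylor_le (y : ℝ) :
    ‖Complex.exp (y * Complex.I) - (1 + y * Complex.I - y ^ 2 / 2)‖ ≤ 4 * y ^ 2 * min 1 |y| := by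
  have hI : ‖(y : ℂ) * Complex.I‖ = |y| := by simp
  rcases le_total 1 |y| with h | h
  · rw [min_eq_left h, mul_one]
    have h1 : ‖(1 : ℂ) + y * Complex.I - y ^ 2 / 2‖ ≤ 1 + |y| + y ^ 2 / 2 := by
      refine (norm_sub_le _ _).trans (add_le_add ((norm_add_le _ _).trans ?_) ?_)
      · rw [hI, norm_one]
      · simp
    have h2 := norm_sub_le (Complex.exp (y * Complex.I)) (1 + y * Complex.I - y ^ 2 / 2)
    rw [Complex.norm_exp_ofReal_mul_I] at h2
    nlinarith [sq_abs y]
  · rw [min_eq_right h]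
    have h1 := Complex.exp_bound (x := y * Complex.I) (by rwa [hI]) (n := 3) (by norm_num)
    rw [hI] at h1
    have h2 : ∑ m ∈ Finset.range 3, ((y : ℂ) * Complex.I) ^ m / m.factorial =
        1 + y * Complex.I - y ^ 2 / 2 := by
      simp [Finset.sum_range_succ, mul_pow, Nat.factorial]
      ring
    rw [h2] at h1
    refine h1.trans ?_
    rw [show 4 * y ^ 2 * |y| = |y| ^ 3 * 4 by rw [← sq_abs y]; ring]
    refine mul_le_mul_of_nonneg_left ?_ (by positivity)
    norm_num [Nat.factorial]

/-- The error of the second order expansion of the characteristic function. -/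
def taylorError (μ : Measure (G d)) (lam : ℝ) (ψ : SPlus d →ᵇ ℝ) (θ : ℝ) : ℝ :=
  ∫ g, walkBound lam ψ g ^ 2 * min 1 (|θ| * walkBound lam ψ g) ∂μ

theorem integrable_taylorError (hL : MemLp logCol 2 μ) (lam : ℝ) (ψ : SPlus d →ᵇ ℝ) (θ : ℝ) :
    Integrable (fun g => walkBound lam ψ g ^ 2 * min 1 (|θ| * walkBound lam ψ g)) μ := by
  refine (memLp_walkBound hL lam ψ).integrable_sq.mono' (Measurable.aestronglyMeasurable
    (by fun_prop)) (ae_of_all _ fun g => ?_)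
  have h0 := one_le_walkBound lam ψ g
  have h1 : 0 ≤ min 1 (|θ| * walkBound lam ψ g) := by positivity
  rw [Real.norm_of_nonneg (by positivity)]
  exact mul_le_of_le_one_right (sq_nonneg _) (min_le_left _ _)

theorem taylorError_nonneg (μ : Measure (G d)) (lam : ℝ) (ψ : SPlus d →ᵇ ℝ) (θ : ℝ) :
    0 ≤ taylorError μ lam ψ θ := integral_nonneg fun g => by
  have h0 := one_le_walkBound lam ψ g
  change 0 ≤ walkBound lam ψ g ^ 2 * min 1 (|θ| * walkBound lam ψ g)
  positivity

theorem tendsto_taylorError (hL : MemLp logCol 2 μ) (lam : ℝ) (ψ : SPlus d →ᵇ ℝ) :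
    Tendsto (taylorError μ lam ψ) (𝓝 0) (𝓝 0) := by
  rw [show (0 : ℝ) = ∫ _g, (0 : ℝ) ∂μ by simp]
  refine tendsto_integral_filter_of_dominated_convergence (fun g => walkBound lam ψ g ^ 2)
    (Eventually.of_forall fun θ => Measurable.aestronglyMeasurable (by fun_prop))
    (Eventually.of_forall fun θ => ae_of_all _ fun g => ?_)
    (memLp_walkBound hL lam ψ).integrable_sq (ae_of_all _ fun g => ?_)
  · have h0 := one_le_walkBound lam ψ g
    have h1 : 0 ≤ min 1 (|θ| * walkBound lam ψ g) := by positivity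
    rw [Real.norm_of_nonneg (by positivity)]
    exact mul_le_of_le_one_right (sq_nonneg _) (min_le_left _ _)
  · have : Continuous fun θ : ℝ => walkBound lam ψ g ^ 2 * min 1 (|θ| * walkBound lam ψ g) := by
      fun_prop
    simpa using this.tendsto 0

variable {lam s : ℝ} {ψ u : SPlus d →ᵇ ℝ}

/-- The approximate eigenfunction of the perturbed transfer operator. -/
def approxEigen (u : SPlus d →ᵇ ℝ) (θ : ℝ) (x : SPlus d) : ℂ := 1 - (θ ^ 2 / 2 : ℝ) * (u x : ℂ)

@[fun_prop]
theorem measurable_approxEigen (u : SPlus d →ᵇ ℝ) (θ : ℝ) : Measurable (approxEigen u θ) := by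
  have : Measurable u := u.continuous.measurable
  unfold approxEigen
  fun_prop

theorem norm_approxEigen_sub_one_le (u : SPlus d →ᵇ ℝ) (θ : ℝ) (x : SPlus d) :
    ‖approxEigen u θ x - 1‖ ≤ θ ^ 2 / 2 * ‖u‖ := by
  rw [approxEigen, sub_sub_cancel_left, norm_neg, norm_mul, Complex.norm_real, Complex.norm_real,
    Real.norm_of_nonneg (by positivity)]
  exact mul_le_mul_of_nonneg_left (u.norm_coe_le_norm x) (by positivity)

theorem norm_exp_mul_le (θ w : ℝ) (z : ℂ) : ‖Complex.exp ((θ * w : ℝ) * Complex.I) * z‖ = ‖z‖ := by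
  rw [norm_mul, Complex.norm_exp_ofReal_mul_I, one_mul]

theorem integrable_of_norm_le {α : Type*} [MeasurableSpace α] {P : Measure α} [IsFiniteMeasure P]
    {f : α → ℂ} {C : ℝ} (hf : Measurable f) (hC : ∀ a, ‖f a‖ ≤ C) : Integrable f P :=
  Integrable.of_bound hf.aestronglyMeasurable C (ae_of_all _ hC)

/-- To second order the integral is `1 - θ²(V + Pu)/2`, the linear term vanishing by `mean_zero`.
The Poisson equation gives `V + Pu = u + s`, which agrees with `(1 - θ²s/2)(1 - θ²u/2)` up to `θ⁴ s
u/4`. The term `r1` is the Taylor remainder and `r2` the interaction of the phase with `u`. -/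
theorem IsCorrector.norm_transfer_sub_le (hL : MemLp logCol 2 μ) (h : IsCorrector μ lam ψ)
    (hu : ∀ x, u x - ∫ g, u (act g x) ∂μ = condVariance μ lam ψ x - s) (θ : ℝ) (x : SPlus d) :
    ‖∫ g, Complex.exp ((θ * walk lam ψ g x : ℝ) * Complex.I) * approxEigen u θ (act g x) ∂μ -
      (1 - θ ^ 2 * s / 2 : ℝ) * approxEigen u θ x‖ ≤
      θ ^ 2 * ((4 + ‖u‖) * taylorError μ lam ψ θ + θ ^ 2 * |s| * ‖u‖) := by
  set w : G d → ℝ := fun g => walk lam ψ g x with hw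
  set H : G d → ℝ := walkBound lam ψ with hH
  have hum : Measurable u := u.continuous.measurable
  have hwm : Measurable w := by fun_prop
  have hwL : MemLp w 2 μ := memLp_walk hL lam ψ x
  have hwH (g) : |w g| ≤ H g := abs_walk_le lam ψ g x
  have hH1 (g) : 1 ≤ H g := one_le_walkBound lam ψ g
  have hHm : Measurable H := measurable_walkBound lam ψ
  set e : G d → ℂ := fun g => Complex.exp ((θ * w g : ℝ) * Complex.I) with he
  have hem : Measurable e := by fun_prop
  have hmin (g) : min 1 |θ * w g| ≤ min 1 (|θ| * H g) := by
    rw [abs_mul]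
    exact min_le_min le_rfl (mul_le_mul_of_nonneg_left (hwH g) (abs_nonneg θ))
  have hmin0 (g) : 0 ≤ min 1 (|θ| * H g) := by
    have := hH1 g
    positivity
  -- the two error terms
  set r1 : G d → ℂ := fun g => e g - (1 + (θ * w g : ℝ) * Complex.I - ((θ * w g : ℝ) : ℂ) ^ 2 / 2)
    with hr1
  set r2 : G d → ℂ := fun g => (e g - 1) * u (act g x) with hr2
  have hb1 (g) : ‖r1 g‖ ≤ 4 * θ ^ 2 * (H g ^ 2 * min 1 (|θ| * H g)) := by
    refine (norm_exp_sub_taylor_le (θ * w g)).trans ?_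
    have h1 : (θ * w g) ^ 2 ≤ θ ^ 2 * H g ^ 2 := by
      rw [mul_pow]
      exact mul_le_mul_of_nonneg_left (sq_le_sq.2 ((hwH g).trans (le_abs_self _))) (sq_nonneg θ)
    calc 4 * (θ * w g) ^ 2 * min 1 |θ * w g|
        ≤ 4 * (θ ^ 2 * H g ^ 2) * min 1 (|θ| * H g) := by
          have := hmin g
          gcongr
      _ = _ := by ring
  have hb2 (g) : ‖r2 g‖ ≤ 2 * ‖u‖ * (H g ^ 2 * min 1 (|θ| * H g)) := by
    rw [hr2, norm_mul, Complex.norm_real]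
    have h1 : 1 ≤ H g ^ 2 := one_le_pow₀ (hH1 g)
    calc ‖e g - 1‖ * ‖u (act g x)‖ ≤ (2 * min 1 (|θ| * H g)) * ‖u‖ :=
          mul_le_mul ((norm_exp_sub_one_le _).trans (mul_le_mul_of_nonneg_left (hmin g) two_pos.le))
            (u.norm_coe_le_norm _) (norm_nonneg _) (by have := hmin0 g; positivity)
      _ = 2 * ‖u‖ * (1 * min 1 (|θ| * H g)) := by ring
      _ ≤ _ := by
          have := hmin0 g
          gcongr
  have hiT := integrable_taylorError hL lam ψ θ
  have hi1 : Integrable r1 μ := (hiT.const_mul (4 * θ ^ 2)).mono'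
    (Measurable.aestronglyMeasurable (by fun_prop)) (ae_of_all _ hb1)
  have hi2 : Integrable r2 μ := (hiT.const_mul (2 * ‖u‖)).mono'
    (Measurable.aestronglyMeasurable (by fun_prop)) (ae_of_all _ hb2)
  have hR1 : ‖∫ g, r1 g ∂μ‖ ≤ 4 * θ ^ 2 * taylorError μ lam ψ θ := by
    rw [taylorError, ← integral_const_mul]
    exact norm_integral_le_of_norm_le (hiT.const_mul _) (ae_of_all _ hb1)
  have hR2 : ‖∫ g, r2 g ∂μ‖ ≤ 2 * ‖u‖ * taylorError μ lam ψ θ := by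
    rw [taylorError, ← integral_const_mul]
    exact norm_integral_le_of_norm_le (hiT.const_mul _) (ae_of_all _ hb2)
  have hdec (g) : e g * approxEigen u θ (act g x) =
      r1 g - (θ ^ 2 / 2 : ℝ) * r2 g + (1 + (θ * w g : ℝ) * Complex.I -
        (θ ^ 2 / 2 * w g ^ 2 : ℝ) - (θ ^ 2 / 2 * u (act g x) : ℝ)) := by
    simp only [hr1, hr2, approxEigen]
    push_cast
    ring
  have hiw : Integrable w μ := hwL.integrable one_le_two
  have hiu : Integrable (fun g => u (act g x)) μ := integrable_comp_act u μ x
  have j1 : Integrable (fun g => ((θ * w g : ℝ) : ℂ) * Complex.I) μ :=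
    ((hiw.const_mul θ).ofReal).mul_const _
  have j2 : Integrable (fun g => ((θ ^ 2 / 2 * w g ^ 2 : ℝ) : ℂ)) μ :=
    (hwL.integrable_sq.const_mul _).ofReal
  have j3 : Integrable (fun g => ((θ ^ 2 / 2 * u (act g x) : ℝ) : ℂ)) μ :=
    (hiu.const_mul _).ofReal
  have j4 : Integrable (fun g => (1 : ℂ) + ((θ * w g : ℝ) : ℂ) * Complex.I) μ :=
    (integrable_const _).add j1
  have j6 : Integrable (fun g => (1 : ℂ) + ((θ * w g : ℝ) : ℂ) * Complex.I -
      ((θ ^ 2 / 2 * w g ^ 2 : ℝ) : ℂ)) μ := j4.sub j2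
  have j7 : Integrable (fun g => (1 : ℂ) + ((θ * w g : ℝ) : ℂ) * Complex.I -
      ((θ ^ 2 / 2 * w g ^ 2 : ℝ) : ℂ) - ((θ ^ 2 / 2 * u (act g x) : ℝ) : ℂ)) μ := j6.sub j3
  have j5 : Integrable (fun g => r1 g - ((θ ^ 2 / 2 : ℝ) : ℂ) * r2 g) μ :=
    hi1.sub (hi2.const_mul _)
  have hint : ∫ g, e g * approxEigen u θ (act g x) ∂μ =
      (∫ g, r1 g ∂μ) - (θ ^ 2 / 2 : ℝ) * (∫ g, r2 g ∂μ) +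
        (1 - (θ ^ 2 / 2 * condVariance μ lam ψ x : ℝ) -
          (θ ^ 2 / 2 * ∫ g, u (act g x) ∂μ : ℝ)) := by
    simp only [hdec]
    rw [integral_add j5 j7, integral_sub hi1 (hi2.const_mul _),
      integral_const_mul, integral_sub j6 j3, integral_sub j4 j2,
      integral_add (integrable_const _) j1, integral_mul_const, integral_complex_ofReal,
      integral_complex_ofReal, integral_complex_ofReal, integral_const_mul, integral_const_mul, integral_const_mul, h.mean_zero]
    simp [condVariance, hw]
  have hPu : ∫ g, u (act g x) ∂μ = u x - (condVariance μ lam ψ x - s) := by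
    rw [← hu x]; ring
  have hfin : ∫ g, e g * approxEigen u θ (act g x) ∂μ -
      (1 - θ ^ 2 * s / 2 : ℝ) * approxEigen u θ x =
      (∫ g, r1 g ∂μ) - (θ ^ 2 / 2 : ℝ) * (∫ g, r2 g ∂μ) - (θ ^ 4 / 4 * s * u x : ℝ) := by
    rw [hint, hPu, approxEigen]
    push_cast
    ring
  rw [hfin]
  have hT := taylorError_nonneg μ lam ψ θ
  have hlast : ‖((θ ^ 4 / 4 * s * u x : ℝ) : ℂ)‖ ≤ θ ^ 2 * (θ ^ 2 * |s| * ‖u‖) := by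
    rw [Complex.norm_real, norm_mul, norm_mul, Real.norm_of_nonneg (by positivity),
      Real.norm_eq_abs s]
    calc θ ^ 4 / 4 * |s| * ‖u x‖ ≤ θ ^ 4 * |s| * ‖u‖ := by
          have := u.norm_coe_le_norm x
          have h4 : θ ^ 4 / 4 ≤ θ ^ 4 := by
            have : 0 ≤ θ ^ 4 := by positivity
            linarith
          gcongr
      _ = _ := by ring
  have hmid : ‖((θ ^ 2 / 2 : ℝ) : ℂ) * (∫ g, r2 g ∂μ)‖ ≤
      θ ^ 2 * (‖u‖ * taylorError μ lam ψ θ) := by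
    rw [norm_mul, Complex.norm_real, Real.norm_of_nonneg (by positivity)]
    calc θ ^ 2 / 2 * ‖∫ g, r2 g ∂μ‖ ≤ θ ^ 2 / 2 * (2 * ‖u‖ * taylorError μ lam ψ θ) :=
          mul_le_mul_of_nonneg_left hR2 (by positivity)
      _ = _ := by ring
  calc _ ≤ ‖∫ g, r1 g ∂μ‖ + ‖((θ ^ 2 / 2 : ℝ) : ℂ) * (∫ g, r2 g ∂μ)‖ +
        ‖((θ ^ 4 / 4 * s * u x : ℝ) : ℂ)‖ :=
        (norm_sub_le _ _).trans (add_le_add_left (norm_sub_le _ _) _)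
    _ ≤ 4 * θ ^ 2 * taylorError μ lam ψ θ + θ ^ 2 * (‖u‖ * taylorError μ lam ψ θ) +
        θ ^ 2 * (θ ^ 2 * |s| * ‖u‖) := by gcongr
    _ = _ := by ring

end

section

variable {d : ℕ} {μ : Measure (G d)} [IsProbabilityMeasure μ]
variable {lam s : ℝ} {ψ u : SPlus d →ᵇ ℝ} {η : Measure (SPlus d)} [IsProbabilityMeasure η]

/-! ### Iteration of the perturbed transfer operator -/

/-- The characteristic function of the corrected cocycle, weighted by `f`. -/
def weightedChar (μ : Measure (G d)) (η : Measure (SPlus d)) (lam : ℝ) (ψ : SPlus d →ᵇ ℝ) (θ : ℝ)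
    (f : SPlus d → ℂ) (n : ℕ) : ℂ :=
  ∫ q, Complex.exp ((θ * walk (n * lam) ψ q.1 q.2 : ℝ) * Complex.I) * f (act q.1 q.2)
    ∂((convPow μ n).prod η)

theorem weightedChar_succ {θ C : ℝ} {f : SPlus d → ℂ} (hf : Measurable f) (hC : ∀ x, ‖f x‖ ≤ C)
    (n : ℕ) :
    weightedChar μ η lam ψ θ f (n + 1) = weightedChar μ η lam ψ θ
      (fun x => ∫ g, Complex.exp ((θ * walk lam ψ g x : ℝ) * Complex.I) * f (act g x) ∂μ) n := by
  have hm : Measurable fun q : G d × SPlus d =>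
      Complex.exp ((θ * walk ((n + 1 : ℕ) * lam) ψ q.1 q.2 : ℝ) * Complex.I) *
        f (act q.1 q.2) := by fun_prop
  rw [weightedChar, integral_convPow_succ_prod hm.stronglyMeasurable
    (integrable_of_norm_le (C := C) hm fun q => (norm_exp_mul_le _ _ _).trans_le (hC _)),
    weightedChar]
  refine integral_congr_ae (ae_of_all _ fun q => ?_)
  simp only
  rw [← integral_const_mul]
  refine integral_congr_ae (ae_of_all _ fun g => ?_)
  simp only [act_mul]
  rw [← mul_assoc, ← Complex.exp_add, Nat.cast_succ, add_mul, one_mul, add_comm _ lam, walk_mul]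
  congr 2
  push_cast
  ring

omit [IsProbabilityMeasure μ] in
theorem weightedChar_zero {θ : ℝ} {f : SPlus d → ℂ} (hf : Measurable f) :
    weightedChar μ η lam ψ θ f 0 = ∫ x, f x ∂η := by
  rw [weightedChar, convPow, Measure.dirac_prod, integral_map (by fun_prop)
    (Measurable.aestronglyMeasurable (by fun_prop))]
  simp [walk_one, act_one]

theorem norm_weightedChar_sub_le {θ C D ε : ℝ} {f f' : SPlus d → ℂ} (hf : Measurable f)
    (hf' : Measurable f') (hC : ∀ x, ‖f x‖ ≤ C) (hD : ∀ x, ‖f' x‖ ≤ D) (n : ℕ)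
    (h : ∀ x, ‖f x - f' x‖ ≤ ε) :
    ‖weightedChar μ η lam ψ θ f n - weightedChar μ η lam ψ θ f' n‖ ≤ ε := by
  have hi {f : SPlus d → ℂ} {C : ℝ} (hf : Measurable f) (hC : ∀ x, ‖f x‖ ≤ C) :
      Integrable (fun q : G d × SPlus d =>
        Complex.exp ((θ * walk (n * lam) ψ q.1 q.2 : ℝ) * Complex.I) * f (act q.1 q.2))
        ((convPow μ n).prod η) :=
    integrable_of_norm_le (C := C) (by fun_prop) fun q => (norm_exp_mul_le _ _ _).trans_le (hC _)
  rw [weightedChar, weightedChar, ← integral_sub (hi hf hC) (hi hf' hD)]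
  have := norm_integral_le_of_norm_le_const (μ := (convPow μ n).prod η)
    (f := fun q : G d × SPlus d =>
      Complex.exp ((θ * walk (n * lam) ψ q.1 q.2 : ℝ) * Complex.I) * f (act q.1 q.2) -
      Complex.exp ((θ * walk (n * lam) ψ q.1 q.2 : ℝ) * Complex.I) * f' (act q.1 q.2))
    (C := ε) (ae_of_all _ fun q => by
      rw [← mul_sub, norm_exp_mul_le]; exact h _)
  simpa using this

omit [IsProbabilityMeasure μ] [IsProbabilityMeasure η] in
theorem weightedChar_const_mul {θ : ℝ} {f : SPlus d → ℂ} (c : ℂ) (n : ℕ) :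
    weightedChar μ η lam ψ θ (fun x => c * f x) n = c * weightedChar μ η lam ψ θ f n := by
  rw [weightedChar, weightedChar, ← integral_const_mul]
  exact integral_congr_ae (ae_of_all _ fun q => mul_left_comm _ _ _)

theorem measurable_transfer {θ : ℝ} {f : SPlus d → ℂ} (hf : Measurable f) : Measurable fun x =>
    ∫ g, Complex.exp ((θ * walk lam ψ g x : ℝ) * Complex.I) * f (act g x) ∂μ := by
  have : Measurable fun q : SPlus d × G d =>
      Complex.exp ((θ * walk lam ψ q.2 q.1 : ℝ) * Complex.I) * f (act q.2 q.1) := by fun_prop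
  exact (this.stronglyMeasurable.integral_prod_right (ν := μ)).measurable

/-- An approximate eigenfunction loses at most `ε` per step, because the phases have modulus one and
`‖a‖ ≤ 1`; the errors add up to `n ε`. -/
theorem norm_weightedChar_sub_pow_le {θ C ε : ℝ} {f : SPlus d → ℂ} (hf : Measurable f)
    (hC : ∀ x, ‖f x‖ ≤ C) {a : ℂ} (ha : ‖a‖ ≤ 1)
    (h : ∀ x, ‖∫ g, Complex.exp ((θ * walk lam ψ g x : ℝ) * Complex.I) * f (act g x) ∂μ -
      a * f x‖ ≤ ε) (n : ℕ) :
    ‖weightedChar μ η lam ψ θ f n - a ^ n * ∫ x, f x ∂η‖ ≤ n * ε := by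
  induction n with
  | zero => rw [weightedChar_zero hf]; simp
  | succ n ih =>
    have h1 : ‖weightedChar μ η lam ψ θ f (n + 1) - a * weightedChar μ η lam ψ θ f n‖ ≤ ε := by
      rw [weightedChar_succ hf hC, ← weightedChar_const_mul]
      refine norm_weightedChar_sub_le (C := C) (D := C) (measurable_transfer hf) (hf.const_mul a)
        (fun x => ?_) (fun x => ?_) n h
      · have := norm_integral_le_of_norm_le_const (μ := μ)
          (f := fun g => Complex.exp ((θ * walk lam ψ g x : ℝ) * Complex.I) * f (act g x))
          (C := C) (ae_of_all _ fun g => (norm_exp_mul_le _ _ _).trans_le (hC _))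
        simpa using this
      · rw [norm_mul]
        exact (mul_le_of_le_one_left (norm_nonneg _) ha).trans (hC x)
    have h2 : ‖a * (weightedChar μ η lam ψ θ f n - a ^ n * ∫ x, f x ∂η)‖ ≤ n * ε := by
      rw [norm_mul]
      exact (mul_le_of_le_one_left (norm_nonneg _) ha).trans ih
    calc ‖weightedChar μ η lam ψ θ f (n + 1) - a ^ (n + 1) * ∫ x, f x ∂η‖
        = ‖(weightedChar μ η lam ψ θ f (n + 1) - a * weightedChar μ η lam ψ θ f n) +
          a * (weightedChar μ η lam ψ θ f n - a ^ n * ∫ x, f x ∂η)‖ := by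
          congr 1; ring
      _ ≤ ε + n * ε := (norm_add_le _ _).trans (add_le_add h1 h2)
      _ = _ := by push_cast; ring

theorem tendsto_div_sqrt_atTop (t : ℝ) : Tendsto (fun n : ℕ => t / √(n : ℝ)) atTop (𝓝 0) :=
  tendsto_const_nhds.div_atTop (Real.tendsto_sqrt_atTop.comp tendsto_natCast_atTop_atTop)

/-- With `θ = t/√n` one has `n θ² = t²`. The total error is therefore `t²` times a quantity tending
to zero, and `(1 - s t²/(2n))^n` converges to the Gaussian value. -/
theorem IsCorrector.tendsto_weightedChar (hL : MemLp logCol 2 μ) (h : IsCorrector μ lam ψ)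
    (hs : 0 ≤ s)
    (hu : ∀ x, u x - ∫ g, u (act g x) ∂μ = condVariance μ lam ψ x - s) (t : ℝ) :
    Tendsto (fun n : ℕ => weightedChar μ η lam ψ (t / √(n : ℝ)) (fun _ => 1) n) atTop
      (𝓝 (Complex.exp (-(s * t ^ 2 / 2)))) := by
  set θ : ℕ → ℝ := fun n => t / √(n : ℝ) with hθ
  have hθ0 : Tendsto θ atTop (𝓝 0) := tendsto_div_sqrt_atTop t
  have hθ2 : ∀ n : ℕ, 1 ≤ n → n * θ n ^ 2 = t ^ 2 := fun n hn => by
    have : (n : ℝ) ≠ 0 := by positivity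
    rw [hθ, div_pow, Real.sq_sqrt (Nat.cast_nonneg n), mul_div_cancel₀ _ this]
  have hfm (n : ℕ) : Measurable (approxEigen u (θ n)) := measurable_approxEigen u _
  have hfC (n : ℕ) (x) : ‖approxEigen u (θ n) x‖ ≤ θ n ^ 2 / 2 * ‖u‖ + 1 := by
    have h1 := norm_approxEigen_sub_one_le u (θ n) x
    have h2 := norm_sub_norm_le (approxEigen u (θ n) x) 1
    rw [norm_one] at h2
    linarith
  set a : ℕ → ℝ := fun n => 1 - θ n ^ 2 * s / 2 with ha
  set ε : ℕ → ℝ := fun n =>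
    θ n ^ 2 * ((4 + ‖u‖) * taylorError μ lam ψ (θ n) + θ n ^ 2 * |s| * ‖u‖) with hε
  have hθu : Tendsto (fun n => θ n ^ 2 / 2 * ‖u‖) atTop (𝓝 0) := by
    simpa using ((hθ0.pow 2).div_const 2).mul_const ‖u‖
  -- first comparison
  have e1 : Tendsto (fun n => weightedChar μ η lam ψ (θ n) (fun _ => 1) n -
      weightedChar μ η lam ψ (θ n) (approxEigen u (θ n)) n) atTop (𝓝 0) := by
    refine squeeze_zero_norm (fun n => ?_) hθu
    exact norm_weightedChar_sub_le (C := 1) measurable_const (hfm n) (by simp) (hfC n) n fun x => by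
      rw [norm_sub_rev]; exact norm_approxEigen_sub_one_le u (θ n) x
  -- iteration of the transfer operator
  have e2 : Tendsto (fun n => weightedChar μ η lam ψ (θ n) (approxEigen u (θ n)) n -
      (a n : ℂ) ^ n * ∫ x, approxEigen u (θ n) x ∂η) atTop (𝓝 0) := by
    have hlim : Tendsto (fun n => t ^ 2 * ((4 + ‖u‖) * taylorError μ lam ψ (θ n) +
        θ n ^ 2 * |s| * ‖u‖)) atTop (𝓝 0) := by
      simpa using ((((tendsto_taylorError hL lam ψ).comp hθ0).const_mul (4 + ‖u‖)).add
        (((hθ0.pow 2).mul_const |s|).mul_const ‖u‖)).const_mul (t ^ 2)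
    refine squeeze_zero_norm' ?_ hlim
    have ha1 : ∀ᶠ n in atTop, θ n ^ 2 * s / 2 < 1 := by
      have : Tendsto (fun n => θ n ^ 2 * s / 2) atTop (𝓝 0) := by
        simpa using ((hθ0.pow 2).mul_const s).div_const 2
      exact this.eventually (gt_mem_nhds one_pos)
    filter_upwards [ha1, eventually_ge_atTop 1] with n hn hn1
    have hab : ‖(a n : ℂ)‖ ≤ 1 := by
      have h0 : 0 ≤ θ n ^ 2 * s / 2 := by positivity
      rw [Complex.norm_real, Real.norm_eq_abs, abs_le]
      constructor <;> simp only [ha] <;> linarith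
    refine (norm_weightedChar_sub_pow_le (hfm n) (hfC n) hab
      (h.norm_transfer_sub_le hL hu (θ n)) n).trans_eq ?_
    rw [← mul_assoc, hθ2 n hn1]
  have e3 : Tendsto (fun n => (a n : ℂ) ^ n) atTop (𝓝 (Complex.exp (-(s * t ^ 2 / 2)))) := by
    have h1 := (Complex.continuous_ofReal.tendsto _).comp
      (Real.tendsto_one_add_div_pow_exp (-(s * t ^ 2 / 2)))
    have h2 : ((Real.exp (-(s * t ^ 2 / 2)) : ℝ) : ℂ) = Complex.exp (-(s * t ^ 2 / 2)) := by
      push_cast; rfl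
    rw [h2] at h1
    refine h1.congr' ?_
    filter_upwards [eventually_ge_atTop 1] with n hn
    have hn0 : (n : ℝ) ≠ 0 := by positivity
    simp only [Function.comp, ha, Complex.ofReal_pow]
    congr 2
    rw [← hθ2 n hn]
    field_simp
    ring
  have e4 : Tendsto (fun n => ∫ x, approxEigen u (θ n) x ∂η) atTop (𝓝 1) := by
    refine tendsto_iff_norm_sub_tendsto_zero.2
      (squeeze_zero (fun n => norm_nonneg _) (fun n => ?_) hθu)
    have h1 : (∫ x, approxEigen u (θ n) x ∂η) - 1 = ∫ x, (approxEigen u (θ n) x - 1) ∂η := by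
      rw [integral_sub (integrable_of_norm_le (hfm n) (hfC n)) (integrable_const _)]
      simp
    rw [h1]
    have := norm_integral_le_of_norm_le_const (μ := η) (f := fun x => approxEigen u (θ n) x - 1)
      (ae_of_all _ (norm_approxEigen_sub_one_le u (θ n)))
    simpa using this
  have := (e1.add e2).add (e3.mul e4)
  simp only [sub_add_sub_cancel, add_zero, mul_one, zero_add, sub_add_cancel] at this
  exact this

/-- Removing the coboundary changes the phase by at most `2‖ψ‖ |t|/√n`. -/
theorem IsCorrector.tendsto_charFun (hL : MemLp logCol 2 μ) (h : IsCorrector μ lam ψ)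
    (hs : 0 ≤ s)
    (hu : ∀ x, u x - ∫ g, u (act g x) ∂μ = condVariance μ lam ψ x - s) (t : ℝ) :
    Tendsto (fun n : ℕ => charFun (((convPow μ n).prod η).map
      fun q => (sigma q.1 q.2 - n * lam) / √(n : ℝ)) t) atTop
      (𝓝 (Complex.exp (-(s * t ^ 2 / 2)))) := by
  have h1 := h.tendsto_weightedChar (η := η) hL hs hu t
  have h2 : Tendsto (fun n : ℕ => charFun (((convPow μ n).prod η).map
      fun q => (sigma q.1 q.2 - n * lam) / √(n : ℝ)) t -
      weightedChar μ η lam ψ (t / √(n : ℝ)) (fun _ => 1) n) atTop (𝓝 0) := by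
    have h0 : Tendsto (fun n : ℕ => 2 * (|t / √(n : ℝ)| * (2 * ‖ψ‖))) atTop (𝓝 0) := by
      simpa using ((tendsto_div_sqrt_atTop t).abs.mul_const (2 * ‖ψ‖)).const_mul 2
    refine squeeze_zero_norm (fun n => ?_) h0
    set θ := t / √(n : ℝ) with hθ
    rw [charFun_apply_real, integral_map (Measurable.aemeasurable (by fun_prop))
      (Measurable.aestronglyMeasurable (by fun_prop)), weightedChar]
    simp only [mul_one]
    have hi {f : G d × SPlus d → ℝ} (hf : Measurable f) : Integrable
        (fun q => Complex.exp ((f q : ℝ) * Complex.I)) ((convPow μ n).prod η) :=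
      integrable_of_norm_le (C := 1) (by fun_prop) fun q => (Complex.norm_exp_ofReal_mul_I _).le
    have e (q : G d × SPlus d) : Complex.exp ((t : ℂ) *
        (((sigma q.1 q.2 - n * lam) / √(n : ℝ) : ℝ) : ℂ) * Complex.I) =
        Complex.exp ((θ * (sigma q.1 q.2 - n * lam) : ℝ) * Complex.I) := by
      congr 2
      rw [hθ]
      push_cast
      ring
    simp only [e]
    rw [← integral_sub (hi (by fun_prop)) (hi (by fun_prop))]
    have := norm_integral_le_of_norm_le_const (μ := (convPow μ n).prod η)
      (f := fun q : G d × SPlus d => Complex.exp ((θ * (sigma q.1 q.2 - n * lam) : ℝ) * Complex.I) -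
        Complex.exp ((θ * walk (n * lam) ψ q.1 q.2 : ℝ) * Complex.I))
      (C := 2 * (|θ| * (2 * ‖ψ‖))) (ae_of_all _ fun q => ?_)
    · simpa using this
    · set y := θ * (sigma q.1 q.2 - n * lam)
      set z := θ * walk (n * lam) ψ q.1 q.2
      have e2 : Complex.exp ((y : ℝ) * Complex.I) - Complex.exp ((z : ℝ) * Complex.I) =
          -(Complex.exp ((y : ℝ) * Complex.I) *
            (Complex.exp (((z - y : ℝ) : ℂ) * Complex.I) - 1)) := by
        rw [mul_sub, ← Complex.exp_add, mul_one, neg_sub]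
        congr 2
        push_cast
        ring
      rw [e2, norm_neg, norm_mul, Complex.norm_exp_ofReal_mul_I, one_mul]
      refine (norm_exp_sub_one_le _).trans (mul_le_mul_of_nonneg_left
        ((min_le_right _ _).trans ?_) two_pos.le)
      rw [← mul_sub, abs_mul]
      exact mul_le_mul_of_nonneg_left (abs_walk_sub_le _ ψ q.1 q.2) (abs_nonneg _)
  have := h2.add h1
  simpa only [sub_add_cancel, zero_add] using this

end

section

variable {d : ℕ}

/-! ### Random products -/

/-- This regroups the triple product law. It is applied with `X` the starting point, `Y` the past
matrices and `Z` the next matrix. -/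
theorem indepFun_prodMk_left {Ω α β γ : Type*} [MeasurableSpace Ω] [MeasurableSpace α]
    [MeasurableSpace β] [MeasurableSpace γ] {P : Measure Ω} [IsProbabilityMeasure P] {X : Ω → α}
    {Y : Ω → β} {Z : Ω → γ} (hX : Measurable X) (hY : Measurable Y) (hZ : Measurable Z)
    (h : IndepFun X (fun ω => (Y ω, Z ω)) P) (h' : IndepFun Y Z P) :
    IndepFun (fun ω => (X ω, Y ω)) Z P := by
  have hXY : IndepFun X Y P := h.comp measurable_id measurable_fst
  have : IsProbabilityMeasure (P.map X) := Measure.isProbabilityMeasure_map hX.aemeasurable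
  have : IsProbabilityMeasure (P.map Y) := Measure.isProbabilityMeasure_map hY.aemeasurable
  have : IsProbabilityMeasure (P.map Z) := Measure.isProbabilityMeasure_map hZ.aemeasurable
  rw [indepFun_iff_map_prod_eq_prod_map_map (by fun_prop) (by fun_prop)] at h h' hXY ⊢
  rw [h', ← Measure.prodAssoc_prod, ← hXY] at h
  have h2 := congrArg (Measure.map (MeasurableEquiv.prodAssoc (α := α) (β := β) (γ := γ)).symm) h
  rw [Measure.map_map (by fun_prop) (by fun_prop), Measure.map_map (by fun_prop) (by fun_prop)] at h2
  simp only [Function.comp_def, MeasurableEquiv.symm_apply_apply, Measure.map_id'] at h2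
  exact h2

section RandomProducts

variable {Ω : Type*} [MeasurableSpace Ω] {P : Measure Ω} [IsProbabilityMeasure P]
  {Y : ℕ → Ω → G d} {W : Ω → SPlus d} {hY : ∀ n, Measurable (Y n)} {hW : Measurable W}

theorem indep_pastFiltration (hind : iIndepFun Y P) (hWY : IndepFun W (fun ω n => Y n ω) P)
    (n : ℕ) :
    Indep (pastFiltration Y W hY hW n) (MeasurableSpace.comap (Y n) inferInstance) P := by
  let B : Ω → (Finset.range n → G d) := fun ω k => Y k ω
  have hBm : Measurable B := measurable_pi_lambda _ fun k => hY k
  have hB' : Measurable[pastSigma Y n] B :=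
    @measurable_pi_lambda _ _ _ (pastSigma Y n) _ _ fun k =>
      measurable_pastSigma (Finset.mem_range.1 k.2)
  have h1 : IndepFun B (Y n) P :=
    indep_of_indep_of_le_left (indep_pastSigma hY hind n) hB'.comap_le
  have h2 : IndepFun W (fun ω => (B ω, Y n ω)) P :=
    hWY.comp (φ := id) (ψ := fun y : ℕ → G d => ((fun k : Finset.range n => y k), y n))
      measurable_id (by fun_prop)
  have h3 := indepFun_prodMk_left hW hBm (hY n) h2 h1
  refine indep_of_indep_of_le_left h3 (sup_le ?_ (iSup₂_le fun k hk => ?_))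
  · exact ((measurable_fst.comp (comap_measurable fun ω => (W ω, B ω)))).comap_le
  · exact (((measurable_pi_apply (⟨k, Finset.mem_range.2 hk⟩ : Finset.range n)).comp
      measurable_snd).comp (comap_measurable fun ω => (W ω, B ω))).comap_le

theorem measurable_pastFiltration_init (n : ℕ) : Measurable[pastFiltration Y W hY hW n] W :=
  measurable_iff_comap_le.2 le_sup_left

theorem measurable_pastFiltration_leftProd (n : ℕ) :
    Measurable[pastFiltration Y W hY hW n] (leftProd Y n) :=
  (measurable_pastSigma_leftProd n).mono le_sup_right le_rfl

theorem measurable_leftProd (hY : ∀ n, Measurable (Y n)) (n : ℕ) : Measurable (leftProd Y n) :=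
  (measurable_pastSigma_leftProd n).mono (pastSigma_le hY n) le_rfl

theorem map_prodMk_of_measurable_past {α : Type*} [MeasurableSpace α] {μ : Measure (G d)}
    (hlaw : ∀ n, P.map (Y n) = μ) (hind : iIndepFun Y P)
    (hWY : IndepFun W (fun ω n => Y n ω) P) {n : ℕ} {V : Ω → α}
    (hV : Measurable[pastFiltration Y W hY hW n] V) :
    P.map (fun ω => (Y n ω, V ω)) = μ.prod (P.map V) := by
  have hVm : Measurable V := hV.mono ((pastFiltration Y W hY hW).le n) le_rfl
  have : IndepFun V (Y n) P :=
    indep_of_indep_of_le_left (indep_pastFiltration hind hWY n) hV.comap_le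
  rw [(indepFun_iff_map_prod_eq_prod_map_map (hY n).aemeasurable hVm.aemeasurable).1 this.symm,
    hlaw]

theorem map_leftProd {μ : Measure (G d)} [IsProbabilityMeasure μ] {η : Measure (SPlus d)}
    [IsProbabilityMeasure η] (hY : ∀ n, Measurable (Y n)) (hW : Measurable W)
    (hlaw : ∀ n, P.map (Y n) = μ) (hlawW : P.map W = η) (hind : iIndepFun Y P)
    (hWY : IndepFun W (fun ω n => Y n ω) P) (n : ℕ) :
    P.map (fun ω => (leftProd Y n ω, W ω)) = (convPow μ n).prod η := by
  induction n with
  | zero =>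
    rw [convPow, Measure.dirac_prod, ← hlawW, Measure.map_map (by fun_prop) hW]
    rfl
  | succ n ih =>
    have hV : Measurable[pastFiltration Y W hY hW n] fun ω => (leftProd Y n ω, W ω) :=
      (measurable_pastFiltration_leftProd n).prodMk (measurable_pastFiltration_init n)
    have hVm : Measurable fun ω => (leftProd Y n ω, W ω) :=
      hV.mono ((pastFiltration Y W hY hW).le n) le_rfl
    rw [convPow_succ_prod, ← ih, ← map_prodMk_of_measurable_past hlaw hind hWY hV,
      Measure.map_map (by fun_prop) ((hY n).prodMk hVm)]
    rfl

theorem map_leftProd_left {μ : Measure (G d)} [IsProbabilityMeasure μ] {η : Measure (SPlus d)}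
    [IsProbabilityMeasure η] (hY : ∀ n, Measurable (Y n)) (hW : Measurable W)
    (hlaw : ∀ n, P.map (Y n) = μ) (hlawW : P.map W = η) (hind : iIndepFun Y P)
    (hWY : IndepFun W (fun ω n => Y n ω) P) (n : ℕ) :
    P.map (leftProd Y n) = convPow μ n := by
  have h := congrArg (Measure.map Prod.fst) (map_leftProd hY hW hlaw hlawW hind hWY n)
  rw [Measure.map_map measurable_fst ((measurable_leftProd hY n).prodMk hW)] at h
  simp only [Measure.map_fst_prod, measure_univ, one_smul] at h
  exact h

/-- The next matrix is independent of the past, and the increment has mean zero from every position.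
-/
theorem IsCorrector.martingale {μ : Measure (G d)} [IsProbabilityMeasure μ]
    (hL : MemLp logCol 2 μ) {lam : ℝ} {ψ : SPlus d →ᵇ ℝ} (h : IsCorrector μ lam ψ)
    (hlaw : ∀ n, P.map (Y n) = μ) (hind : iIndepFun Y P)
    (hWY : IndepFun W (fun ω n => Y n ω) P) :
    Martingale (fun (n : ℕ) ω => walk (n * lam) ψ (leftProd Y n ω) (W ω))
      (pastFiltration Y W hY hW) P := by
  set η := P.map W with hη
  have : IsProbabilityMeasure η := Measure.isProbabilityMeasure_map hW.aemeasurable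
  have hpast (n : ℕ) : Measurable[pastFiltration Y W hY hW n]
      fun ω => walk (n * lam) ψ (leftProd Y n ω) (W ω) :=
    @measurable_walk_comp d Ω (pastFiltration Y W hY hW n) (n * lam) ψ (leftProd Y n) W
      (measurable_pastFiltration_leftProd n) (measurable_pastFiltration_init n)
  have hAW (n : ℕ) : Measurable fun ω => (leftProd Y n ω, W ω) :=
    (measurable_leftProd hY n).prodMk hW
  have hint (n : ℕ) : Integrable (fun ω => walk (n * lam) ψ (leftProd Y n ω) (W ω)) P := by
    have h1 := (memLp_walk_convPow (η := η) hL lam ψ n).integrable one_le_two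
    rw [← map_leftProd hY hW hlaw hη.symm hind hWY n, integrable_map_measure
      (Measurable.aestronglyMeasurable (by fun_prop)) (hAW n).aemeasurable] at h1
    exact h1
  refine martingale_nat (fun n => (hpast n).stronglyMeasurable) hint fun n => ?_
  set D : Ω → ℝ := fun ω => walk lam ψ (Y n ω) (act (leftProd Y n ω) (W ω)) with hD
  have hsucc : (fun ω => walk ((n + 1 : ℕ) * lam) ψ (leftProd Y (n + 1) ω) (W ω)) =
      fun ω => D ω + walk (n * lam) ψ (leftProd Y n ω) (W ω) := by
    funext ω
    rw [leftProd, Nat.cast_succ, add_mul, one_mul, add_comm _ lam, walk_mul]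
  have hDi : Integrable D P := by
    have := (hint (n + 1)).sub (hint n)
    rw [hsucc] at this
    refine this.congr (ae_of_all _ fun ω => ?_)
    simp
  have hD0 : (0 : Ω → ℝ) =ᵐ[P] P[D | pastFiltration Y W hY hW n] := by
    refine ae_eq_condExp_of_forall_setIntegral_eq ((pastFiltration Y W hY hW).le n) hDi
      (fun s _ _ => (integrable_zero _ _ _).integrableOn) (fun s hs _ => ?_)
      stronglyMeasurable_zero.aestronglyMeasurable
    have hs' : MeasurableSet s := (pastFiltration Y W hY hW).le n s hs
    -- The past event and the current position are packed into one past-measurable variable. Its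
    -- joint law with `Y n` is a product, so integrating over the matrix first gives zero.
    let V : Ω → ℝ × SPlus d := fun ω => (s.indicator (fun _ => 1) ω, act (leftProd Y n ω) (W ω))
    have hV : Measurable[pastFiltration Y W hY hW n] V :=
      (measurable_const.indicator hs).prodMk (measurable_act.comp
        ((measurable_pastFiltration_leftProd n).prodMk (measurable_pastFiltration_init n)))
    have hVm : Measurable V := hV.mono ((pastFiltration Y W hY hW).le n) le_rfl
    have hlawV := map_prodMk_of_measurable_past hlaw hind hWY hV
    have hF : Measurable fun q : G d × (ℝ × SPlus d) => q.2.1 * walk lam ψ q.1 q.2.2 := by fun_prop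
    have hFD : (fun ω => (V ω).1 * walk lam ψ (Y n ω) (V ω).2) = s.indicator D := by
      funext ω
      by_cases hω : ω ∈ s <;> simp [V, hD, hω]
    have hFi : Integrable (fun q : G d × (ℝ × SPlus d) => q.2.1 * walk lam ψ q.1 q.2.2)
        (μ.prod (P.map V)) := by
      rw [← hlawV, integrable_map_measure hF.aestronglyMeasurable
        ((hY n).prodMk hVm).aemeasurable]
      change Integrable (fun ω => (V ω).1 * walk lam ψ (Y n ω) (V ω).2) P
      rw [hFD]
      exact hDi.indicator hs'
    have hVp : IsProbabilityMeasure (P.map V) := Measure.isProbabilityMeasure_map hVm.aemeasurable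
    calc ∫ ω in s, (0 : Ω → ℝ) ω ∂P = 0 := by simp
      _ = ∫ q, q.2.1 * walk lam ψ q.1 q.2.2 ∂(μ.prod (P.map V)) := by
          rw [integral_prod_symm _ hFi]
          simp only [integral_const_mul, h.mean_zero, mul_zero, integral_zero]
      _ = ∫ ω, s.indicator D ω ∂P := by
          rw [← hlawV, integral_map ((hY n).prodMk hVm).aemeasurable hF.aestronglyMeasurable,
            ← hFD]
      _ = ∫ ω in s, D ω ∂P := integral_indicator hs'
  change _ =ᵐ[P] P[fun ω => walk ((n + 1 : ℕ) * lam) ψ (leftProd Y (n + 1) ω) (W ω) |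
    pastFiltration Y W hY hW n]
  rw [hsucc]
  have h1 := condExp_add hDi (hint n) (pastFiltration Y W hY hW n)
  have h2 := condExp_of_stronglyMeasurable ((pastFiltration Y W hY hW).le n)
    (hpast n).stronglyMeasurable (hint n)
  refine EventuallyEq.symm (h1.trans ?_)
  rw [h2]
  filter_upwards [hD0] with ω hω
  simp [← hω]

theorem IsCorrector.tendstoInDistribution {μ : Measure (G d)} [IsProbabilityMeasure μ]
    (hL : MemLp logCol 2 μ) {lam : ℝ} {s : ℝ≥0} {ψ u : SPlus d →ᵇ ℝ} (h : IsCorrector μ lam ψ)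
    (hu : ∀ x, u x - ∫ g, u (act g x) ∂μ = condVariance μ lam ψ x - s)
    (hY : ∀ n, Measurable (Y n)) (hW : Measurable W)
    (hlaw : ∀ n, P.map (Y n) = μ) (hind : iIndepFun Y P)
    (hWY : IndepFun W (fun ω n => Y n ω) P) :
    TendstoInDistribution (fun (n : ℕ) ω => (sigma (leftProd Y n ω) (W ω) - n * lam) / √(n : ℝ))
      atTop id (fun _ => P) (gaussianReal 0 s) := by
  have hη : IsProbabilityMeasure (P.map W) := Measure.isProbabilityMeasure_map hW.aemeasurable
  have hA := measurable_leftProd hY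
  refine ⟨fun n => Measurable.aemeasurable (by fun_prop), aemeasurable_id,
    ProbabilityMeasure.tendsto_iff_tendsto_charFun.2 fun t => ?_⟩
  have h1 := h.tendsto_charFun (η := P.map W) hL s.2 hu t
  have e : charFun (Measure.map id (gaussianReal 0 s)) t = Complex.exp (-(s * t ^ 2 / 2)) := by
    rw [Measure.map_id, charFun_gaussianReal]
    simp
  simp only [ProbabilityMeasure.coe_mk, e]
  refine h1.congr fun n => ?_
  rw [← map_leftProd hY hW hlaw rfl hind hWY n, Measure.map_map (by fun_prop)
    ((hA n).prodMk hW)]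
  rfl

end RandomProducts

end

section

variable {d : ℕ}

/-! ### Positivity of the variance -/

theorem support_mul_mem {μ ν : Measure (G d)} [IsProbabilityMeasure μ] [IsProbabilityMeasure ν]
    {g h : G d} (hg : g ∈ μ.support) (hh : h ∈ ν.support) : g * h ∈ (μ.mconv ν).support := by
  rw [Measure.mem_support_iff_forall] at hg hh ⊢
  intro U hU
  have h1 : (fun q : G d × G d => q.1 * q.2) ⁻¹' U ∈ 𝓝 (g, h) :=
    (continuous_mul.tendsto (g, h)) hU
  obtain ⟨V, hV, V', hV', hsub⟩ := mem_nhds_prod_iff.1 h1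
  have hm : Measurable fun q : G d × G d => q.1 * q.2 := by fun_prop
  calc 0 < μ V * ν V' := ENNReal.mul_pos (hg V hV).ne' (hh V' hV').ne'
    _ = (μ.prod ν) (V ×ˢ V') := (Measure.prod_prod _ _).symm
    _ ≤ (μ.prod ν) ((fun q : G d × G d => q.1 * q.2) ⁻¹' U) := measure_mono hsub
    _ ≤ _ := Measure.le_map_apply hm.aemeasurable U

variable {μ : Measure (G d)} [IsProbabilityMeasure μ]

theorem exists_mem_support_convPow {g : G d}
    (hg : g ∈ Subsemigroup.closure μ.support) : ∃ m : ℕ, g ∈ (convPow μ m).support := by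
  induction hg using Subsemigroup.closure_induction with
  | mem x hx => exact ⟨1, by rwa [convPow_one]⟩
  | mul x y _ _ hx hy =>
    obtain ⟨m, hm⟩ := hx
    obtain ⟨n, hn⟩ := hy
    exact ⟨m + n, by rw [convPow_add]; exact support_mul_mem hm hn⟩

/-- All powers of one matrix become available, which is what Gelfand's formula needs. -/
theorem pow_mem_support_convPow {g : G d} {m : ℕ} (hg : g ∈ (convPow μ m).support) (n : ℕ) :
    g ^ n ∈ (convPow μ (n * m)).support := by
  induction n with
  | zero =>
    rw [zero_mul, pow_zero, convPow, Measure.mem_support_iff_forall]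
    intro U hU
    rw [Measure.dirac_apply_of_mem (mem_of_mem_nhds hU)]
    exact one_pos
  | succ n ih =>
    rw [pow_succ, Nat.succ_mul, convPow_add]
    exact support_mul_mem ih hg

/-- The relative interior of the simplex. -/
def interiorSet (d : ℕ) : Set (SPlus d) := {x | ∀ i, 0 < x.val i}

theorem measurableSet_interiorSet : MeasurableSet (interiorSet d) := by
  have : interiorSet d = ⋂ i, {x : SPlus d | 0 < x.val i} := by ext; simp [interiorSet]
  rw [this]
  exact .iInter fun i => measurableSet_lt measurable_const (SPlus.measurable_val i)

theorem measurableSet_GPos : MeasurableSet (GPos d) := by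
  have : GPos d = ⋂ i, ⋂ j, {g : G d | 0 < g.1 i j} := by ext; simp [GPos]
  rw [this]
  exact .iInter fun i => .iInter fun j => measurableSet_lt measurable_const (measurable_entry i j)

theorem act_mem_interiorSet {g : G d} {x : SPlus d}
    (h : ∀ i, ∃ j, 0 < g.1 i j ∧ 0 < x.val j) : act g x ∈ interiorSet d := fun i => by
  obtain ⟨j, hj, hx⟩ := h i
  exact div_pos (Finset.sum_pos' (fun j _ => mul_nonneg (g.2.1 i j) (x.nonneg j))
    ⟨j, Finset.mem_univ _, mul_pos hj hx⟩) (l1_mulVec_pos g x)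

/-- Interior points stay interior because no row vanishes, and boundary points enter the interior
with probability at least `p > 0` in `r` steps. Invariance gives `ν(N) ≤ (1 - p) ν(N)` for the
boundary `N`. -/
theorem IsInvariant.ae_mem_interiorSet (hc : StrictlyContracting μ) {ν : Measure (SPlus d)}
    [IsProbabilityMeasure ν] (hν : IsInvariant μ ν) : ∀ᵐ x ∂ν, x ∈ interiorSet d := by
  obtain ⟨r, -, hr⟩ := hc
  set p := (convPow μ r).real (GPos d) with hp
  have hp0 : 0 < p := ENNReal.toReal_pos hr.ne' (measure_ne_top _ _)
  set N : Set (SPlus d) := (interiorSet d)ᶜ with hN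
  have hNm : MeasurableSet N := measurableSet_interiorSet.compl
  set f : SPlus d → ℝ := N.indicator fun _ => 1 with hf
  have hfm : Measurable f := measurable_const.indicator hNm
  have hf0 (x) : 0 ≤ f x := Set.indicator_nonneg (fun _ _ => zero_le_one) x
  have hf1 (x) : f x ≤ 1 := Set.indicator_le_self' (fun _ _ => zero_le_one) x
  have hfC (x) : |f x| ≤ 1 := by rw [abs_of_nonneg (hf0 x)]; exact hf1 x
  have hfin {x} (hx : x ∈ interiorSet d) : f x = 0 := by simp [hf, hN, hx]
  have key (x) : avg μ r f x ≤ (1 - p) * f x := by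
    calc avg μ r f x ≤ ∫ g, (f x - (GPos d).indicator (fun _ => f x) g) ∂(convPow μ r) := by
          refine integral_mono (integrable_of_bounded (by fun_prop) fun g => hfC _)
            ((integrable_const _).sub ((integrable_const _).indicator measurableSet_GPos))
            fun g => ?_
          by_cases hg : g ∈ GPos d
          · simp only [Set.indicator_of_mem hg, sub_self]
            obtain ⟨j, hj⟩ := x.exists_pos
            exact (hfin (act_mem_interiorSet fun i => ⟨j, hg i j, hj⟩)).le
          · simp only [Set.indicator_of_notMem hg, sub_zero]
            by_cases hx : x ∈ interiorSet d
            · rw [hfin (act_mem_interiorSet fun i => (g.2.2.1 i).imp fun j hj => ⟨hj, hx j⟩)]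
              exact hf0 x
            · refine (hf1 _).trans_eq ?_
              simp [hf, hN, hx]
      _ = _ := by
          rw [integral_sub (integrable_const _)
            ((integrable_const _).indicator measurableSet_GPos),
            integral_indicator_const _ measurableSet_GPos]
          simp only [integral_const, probReal_univ, smul_eq_mul, one_mul, ← hp]
          ring
  have h1 : ∫ x, f x ∂ν ≤ (1 - p) * ∫ x, f x ∂ν := by
    rw [← integral_const_mul]
    conv_lhs => rw [← integral_avg_eq hν hfm hfC r]
    exact integral_mono (integrable_of_bounded (measurable_avg hfm r) fun x => abs_avg_le hfC r x)
      ((integrable_of_bounded hfm hfC).const_mul _) key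
  have h2 : ∫ x, f x ∂ν = ν.real N := by
    rw [hf, integral_indicator_const _ hNm, smul_eq_mul, mul_one]
  have h3 : ν.real N = 0 := by
    rw [h2] at h1
    nlinarith [measureReal_nonneg (μ := ν) (s := N)]
  rw [measureReal_eq_zero_iff] at h3
  exact h3

theorem IsCorrector.ae_walk_eq_zero (hL : MemLp logCol 2 μ) {lam : ℝ} {ψ : SPlus d →ᵇ ℝ}
    (h : IsCorrector μ lam ψ) {ν : Measure (SPlus d)} [IsProbabilityMeasure ν]
    (hν : IsInvariant μ ν) (h0 : ∫ x, condVariance μ lam ψ x ∂ν = 0) (n : ℕ) :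
    ∀ᵐ q ∂((convPow μ n).prod ν), walk (n * lam) ψ q.1 q.2 = 0 := by
  have h1 := h.integral_sq_eq hL hν n
  rw [h0, mul_zero, integral_eq_zero_iff_of_nonneg (fun q => sq_nonneg _)
    (memLp_walk_convPow hL lam ψ n).integrable_sq] at h1
  filter_upwards [h1] with q hq
  exact pow_eq_zero_iff two_ne_zero |>.1 hq

/-! ### Spectral radii and the degenerate case -/

/-- The sum of the entries of `g`. -/
def entrySum (g : G d) : ℝ := ∑ j, colSum g j

theorem l1_mulVec_le_entrySum (g : G d) (x : SPlus d) : l1 (mulVec g x) ≤ entrySum g := by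
  rw [l1_mulVec]
  refine Finset.sum_le_sum fun j _ => mul_le_of_le_one_right (colSum_pos g j).le ?_
  rw [← x.sum_eq]
  exact Finset.single_le_sum (fun j _ => x.nonneg j) (Finset.mem_univ j)

theorem mul_entrySum_le (g : G d) {x : SPlus d} {c : ℝ} (hc : ∀ i, c ≤ x.val i) :
    c * entrySum g ≤ l1 (mulVec g x) := by
  rw [l1_mulVec, entrySum, Finset.mul_sum]
  refine Finset.sum_le_sum fun j _ => ?_
  rw [mul_comm]
  exact mul_le_mul_of_nonneg_left (hc j) (colSum_pos g j).le

/-- At an interior point `‖g^n x‖` is comparable to `‖g^n‖` with constants independent of `n`, so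
Gelfand's formula reads off the spectral radius from the growth of `σ(g^n, x)`. -/
theorem log_kappa_eq [NeZero d] {g : G d} {x : SPlus d} (hx : x ∈ interiorSet d) {t C : ℝ}
    (h : ∀ n : ℕ, |sigma (g ^ n) x - n * t| ≤ C) : Real.log (kappa g) = t := by
  -- Gelfand's formula holds for any algebra norm; the maximal row sum is easily compared with the
  -- sum of the entries.
  let _ := Matrix.linftyOpNormedRing (n := Fin d) (α := ℂ)
  let _ := Matrix.linftyOpNormedAlgebra (n := Fin d) (R := ℂ) (α := ℂ)
  have hcomp : CompleteSpace (Matrix (Fin d) (Fin d) ℂ) := FiniteDimensional.complete ℂ _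
  set M : Matrix (Fin d) (Fin d) ℂ := g.1.map fun t : ℝ => (t : ℂ) with hM
  have hMn (n : ℕ) : M ^ n = (g ^ n).1.map fun t : ℝ => (t : ℂ) := by
    have := map_pow (Complex.ofRealHom.mapMatrix (m := Fin d)) g.1 n
    exact this.symm
  have hentry (n : ℕ) (i j : Fin d) : ‖(M ^ n) i j‖ = (g ^ n).1 i j := by
    rw [hMn, Matrix.map_apply, Complex.norm_real, Real.norm_of_nonneg ((g ^ n).2.1 i j)]
  have hrow (n : ℕ) (i : Fin d) : ∑ j, (g ^ n).1 i j ≤ ‖M ^ n‖ := by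
    rw [Matrix.linfty_opNorm_def]
    have := Finset.le_sup (f := fun i => ∑ j, ‖(M ^ n) i j‖₊) (Finset.mem_univ i)
    have h2 : ((∑ j, ‖(M ^ n) i j‖₊ : ℝ≥0) : ℝ) ≤
      (Finset.univ.sup fun i => ∑ j, ‖(M ^ n) i j‖₊ : ℝ≥0) := by exact_mod_cast this
    refine le_trans (le_of_eq ?_) h2
    push_cast
    exact Finset.sum_congr rfl fun j _ => (hentry n i j).symm
  have hS (n : ℕ) : entrySum (g ^ n) = ∑ i, ∑ j, (g ^ n).1 i j := Finset.sum_comm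
  have hup (n : ℕ) : entrySum (g ^ n) ≤ d * ‖M ^ n‖ := by
    rw [hS]
    exact (Finset.sum_le_sum fun i _ => hrow n i).trans_eq (by simp)
  have hlow (n : ℕ) : ‖M ^ n‖ ≤ entrySum (g ^ n) := by
    obtain ⟨i, -, hi⟩ := Finset.exists_mem_eq_sup Finset.univ Finset.univ_nonempty
      fun i => ∑ j, ‖(M ^ n) i j‖₊
    rw [Matrix.linfty_opNorm_def, hi, hS]
    push_cast
    simp only [hentry]
    exact Finset.single_le_sum (f := fun i => ∑ j, (g ^ n).1 i j)
      (fun i _ => Finset.sum_nonneg fun j _ => (g ^ n).2.1 i j) (Finset.mem_univ i)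
  obtain ⟨k, hk⟩ := Finite.exists_min x.val
  set c := x.val k with hc
  have hc0 : 0 < c := hx k
  have hd : (0 : ℝ) < d := by exact_mod_cast Nat.pos_of_ne_zero (NeZero.ne d)
  have hpos (n : ℕ) : 0 < ‖M ^ n‖ := by
    have h1 := (l1_mulVec_pos (g ^ n) x).trans_le ((l1_mulVec_le_entrySum _ x).trans (hup n))
    exact pos_of_mul_pos_right h1 hd.le
  have hlog (n : ℕ) : |Real.log ‖M ^ n‖ - n * t| ≤ C + |Real.log d| + |Real.log c| := by
    have h1 := abs_le.1 (h n)
    have h2 := Real.log_le_log (l1_mulVec_pos (g ^ n) x)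
      ((l1_mulVec_le_entrySum _ x).trans (hup n))
    rw [Real.log_mul hd.ne' (hpos n).ne'] at h2
    have h3 := Real.log_le_log (mul_pos hc0 (hpos n))
      ((mul_le_mul_of_nonneg_left (hlow n) hc0.le).trans (mul_entrySum_le (g ^ n) hk))
    rw [Real.log_mul hc0.ne' (hpos n).ne'] at h3
    have h4 := abs_le.1 (le_refl |Real.log d|)
    have h5 := abs_le.1 (le_refl |Real.log c|)
    unfold sigma at h1
    rw [abs_le]
    constructor <;> linarith [abs_nonneg (Real.log d), abs_nonneg (Real.log c)]
  have hlim : Tendsto (fun n : ℕ => Real.log ‖M ^ n‖ / n) atTop (𝓝 t) := by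
    refine tendsto_iff_norm_sub_tendsto_zero.2 (squeeze_zero' (Eventually.of_forall fun n =>
      norm_nonneg _) ?_ (tendsto_const_div_atTop_nhds_zero_nat (C + |Real.log d| + |Real.log c|)))
    filter_upwards [eventually_ge_atTop 1] with n hn
    have hn0 : (0 : ℝ) < n := by exact_mod_cast hn
    rw [div_sub' hn0.ne', norm_div, Real.norm_of_nonneg hn0.le]
    exact div_le_div_of_nonneg_right (hlog n) hn0.le
  have hlim2 : Tendsto (fun n : ℕ => ENNReal.ofReal (‖M ^ n‖ ^ (1 / n : ℝ))) atTop
      (𝓝 (ENNReal.ofReal (Real.exp t))) := by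
    refine (ENNReal.continuous_ofReal.tendsto _).comp
      (((Real.continuous_exp.tendsto _).comp hlim).congr fun n => ?_)
    rw [Function.comp, Real.rpow_def_of_pos (hpos n), mul_one_div]
  have hspec := tendsto_nhds_unique (spectrum.pow_norm_pow_one_div_tendsto_nhds_spectralRadius M)
    hlim2
  rw [kappa, ← hM, hspec, ENNReal.toReal_ofReal (Real.exp_pos t).le, Real.log_exp]

end

section

variable {d : ℕ} {μ : Measure (G d)} [IsProbabilityMeasure μ]

/-- The almost sure bound is a closed condition, hence holds on supports. For `g` in the support of
`μ^{*m}` it applies to all powers of `g`, with growth rate `mλ`. Limits in `Γ_μ` are handled by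
taking limits of the rates in the closed group `λℤ`, so no continuity of `κ` is required. -/
theorem log_kappa_mem_zmultiples [NeZero d] {x : SPlus d} (hx : x ∈ interiorSet d) {lam C : ℝ}
    (h : ∀ m : ℕ, ∀ᵐ g ∂(convPow μ m), |sigma g x - m * lam| ≤ C) {g : G d} (hg : g ∈ Gam μ) :
    Real.log (kappa g) ∈ AddSubgroup.zmultiples lam := by
  have hsupp (m : ℕ) : ∀ g ∈ (convPow μ m).support, |sigma g x - m * lam| ≤ C := by
    have hcl : IsClosed {g : G d | |sigma g x - m * lam| ≤ C} :=
      isClosed_le (((continuous_sigma x).sub continuous_const).abs) continuous_const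
    exact fun g hg => Measure.support_subset_of_isClosed hcl (h m) hg
  have hsemi : ∀ g ∈ (Subsemigroup.closure μ.support : Set (G d)),
      ∃ t ∈ AddSubgroup.zmultiples lam, ∀ n : ℕ, |sigma (g ^ n) x - n * t| ≤ C := by
    intro g hg
    obtain ⟨m, hm⟩ := exists_mem_support_convPow hg
    refine ⟨m * lam, ⟨m, by simp⟩, fun n => ?_⟩
    have := hsupp _ _ (pow_mem_support_convPow hm n)
    rwa [Nat.cast_mul, mul_assoc] at this
  obtain ⟨v, hv, hlim⟩ := mem_closure_iff_seq_limit.1 hg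
  choose t ht hvt using fun k => hsemi (v k) (hv k)
  have hcont (n : ℕ) : Tendsto (fun k => sigma (v k ^ n) x) atTop (𝓝 (sigma (g ^ n) x)) :=
    (((continuous_sigma x).comp (continuous_pow n)).tendsto g).comp hlim
  -- The bound for the first power shows that the rates stay bounded, so a subsequence converges.
  have hbdd : ∃ R, ∀ k, |t k| ≤ R := by
    obtain ⟨R, hR⟩ := (hcont 1).abs.bddAbove_range
    refine ⟨R + C, fun k => ?_⟩
    have h1 := hvt k 1
    have h2 : |sigma (v k ^ 1) x| ≤ R := hR ⟨k, rfl⟩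
    rw [Nat.cast_one, one_mul, abs_sub_comm] at h1
    have := abs_sub_abs_le_abs_sub (t k) (sigma (v k ^ 1) x)
    linarith
  obtain ⟨R, hR⟩ := hbdd
  obtain ⟨a, -, φ, hφ, ha⟩ := tendsto_subseq_of_bounded (Metric.isBounded_closedBall (x := (0 : ℝ))
    (r := R)) (x := t) fun k => by simpa using hR k
  have ha' : a ∈ AddSubgroup.zmultiples lam :=
    (AddSubgroup.isClosed_of_discrete (H := AddSubgroup.zmultiples lam)).mem_of_tendsto ha
      (Eventually.of_forall fun k => ht _)
  rw [log_kappa_eq hx (t := a) (C := C) fun n => ?_]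
  · exact ha'
  · exact le_of_tendsto (((hcont n).comp hφ.tendsto_atTop).sub (ha.const_mul (n : ℝ))).abs
      (Eventually.of_forall fun k => hvt (φ k) n)

theorem not_dense_zmultiples (lam : ℝ) : ¬ Dense (AddSubgroup.zmultiples lam : Set ℝ) := by
  intro h
  have hcl : IsClosed (AddSubgroup.zmultiples lam : Set ℝ) := AddSubgroup.isClosed_of_discrete
  have huniv : (AddSubgroup.zmultiples lam : Set ℝ) = Set.univ := by
    rw [← hcl.closure_eq, h.closure_eq]
  have hcount : (AddSubgroup.zmultiples lam : Set ℝ).Countable := by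
    rw [AddSubgroup.coe_zmultiples]
    exact Set.countable_range _
  rw [huniv] at hcount
  exact Set.not_countable_univ hcount

theorem IsCorrector.not_aperiodic [NeZero d] (hc : StrictlyContracting μ)
    (hL : MemLp logCol 2 μ) {lam : ℝ} {ψ : SPlus d →ᵇ ℝ} (h : IsCorrector μ lam ψ)
    {ν : Measure (SPlus d)} [IsProbabilityMeasure ν] (hν : IsInvariant μ ν)
    (h0 : ∫ x, condVariance μ lam ψ x ∂ν = 0) : ¬ Aperiodic μ := by
  have h1 (m : ℕ) : ∀ᵐ x ∂ν, ∀ᵐ g ∂(convPow μ m), |sigma g x - m * lam| ≤ 2 * ‖ψ‖ := by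
    have hm : MeasurableSet {q : G d × SPlus d | |sigma q.1 q.2 - m * lam| ≤ 2 * ‖ψ‖} :=
      measurableSet_le (by fun_prop) measurable_const
    -- Exchanging the quantifiers allows a single interior point `x` to be chosen that works for all
    -- `m` at once.
    refine (Measure.ae_ae_comm (p := fun g x => |sigma g x - m * lam| ≤ 2 * ‖ψ‖) hm).1 ?_
    refine Measure.ae_ae_of_ae_prod
      (p := fun q : G d × SPlus d => |sigma q.1 q.2 - m * lam| ≤ 2 * ‖ψ‖) ?_
    filter_upwards [h.ae_walk_eq_zero hL hν h0 m] with q hq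
    have := abs_walk_sub_le (m * lam) ψ q.1 q.2
    rwa [hq, zero_sub, abs_neg] at this
  obtain ⟨x, hx, hx1⟩ := ((hν.ae_mem_interiorSet hc).and (ae_all_iff.2 h1)).exists
  intro hap
  refine not_dense_zmultiples lam (hap.mono ?_)
  rw [SetLike.coe_subset_coe, AddSubgroup.closure_le]
  rintro _ ⟨g, hg, rfl⟩
  exact log_kappa_mem_zmultiples hx hx1 hg

theorem IsCorrector.coboundaryRelation [NeZero d] (hL : MemLp logCol 2 μ) {lam : ℝ}
    {ψ : SPlus d →ᵇ ℝ} (h : IsCorrector μ lam ψ) {ν : Measure (SPlus d)} [IsProbabilityMeasure ν]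
    (hν : IsInvariant μ ν) (h0 : ∫ x, condVariance μ lam ψ x ∂ν = 0) (m : ℕ) :
    CoboundaryRelation μ ν m ψ := by
  rw [CoboundaryRelation, h.lyapunov_eq hL]
  filter_upwards [h.ae_walk_eq_zero hL hν h0 m] with q hq
  rw [walk] at hq
  linarith

end

end PosProd

end

/-! ### The main theorem -/

theorem mainTheorem5 (d : ℕ) (hd : 2 ≤ d) (μ : Measure (PosProd.G d))
    [IsProbabilityMeasure μ] (hcontr : PosProd.StrictlyContracting μ)
    (hmom : PosProd.HasMoment μ 2) :
    ∃ ν : Measure (PosProd.SPlus d),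
      IsProbabilityMeasure ν ∧ PosProd.IsInvariant μ ν ∧
      (∀ ν' : Measure (PosProd.SPlus d),
        IsProbabilityMeasure ν' → PosProd.IsInvariant μ ν' → ν' = ν) ∧
      ∃ (s2 : ℝ≥0) (ψ : PosProd.SPlus d →ᵇ ℝ),
        (∀ (Ω : Type*) [MeasurableSpace Ω] (P : Measure Ω) [IsProbabilityMeasure P]
          (Y : ℕ → Ω → PosProd.G d) (W : Ω → PosProd.SPlus d)
          (hY : ∀ n, Measurable (Y n)) (hW : Measurable W),
          (∀ n, P.map (Y n) = μ) → P.map W = ν → iIndepFun Y P →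
          IndepFun W (fun ω n => Y n ω) P →
          ((∀ n, Integrable (fun ω => Real.log (PosProd.opNorm (PosProd.leftProd Y n ω))) P) ∧
            Tendsto (fun n : ℕ => ∫ ω, |Real.log (PosProd.opNorm (PosProd.leftProd Y n ω)) / n
              - PosProd.lyapunov μ| ∂P) atTop (𝓝 0)) ∧
          (∀ n, MemLp (fun ω => PosProd.sigma (PosProd.leftProd Y n ω) (W ω)) 2 P) ∧
          Tendsto (fun n : ℕ => (∫ ω, (PosProd.sigma (PosProd.leftProd Y n ω) (W ω)
            - n * PosProd.lyapunov μ) ^ 2 ∂P) / n) atTop (𝓝 (s2 : ℝ)) ∧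
          TendstoInDistribution (fun (n : ℕ) ω =>
              (PosProd.sigma (PosProd.leftProd Y n ω) (W ω) - n * PosProd.lyapunov μ) / √(n : ℝ))
            atTop id (fun _ => P) (gaussianReal 0 s2) ∧
          Martingale (fun (n : ℕ) ω =>
              PosProd.sigma (PosProd.leftProd Y n ω) (W ω) - n * PosProd.lyapunov μ
                + ψ (PosProd.act (PosProd.leftProd Y n ω) (W ω)) - ψ (W ω))
            (PosProd.pastFiltration Y W hY hW) P) ∧
        ((¬ ∃ m : ℕ, 1 ≤ m ∧ ∃ ψ' : PosProd.SPlus d → ℝ,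
            Continuous ψ' ∧ PosProd.CoboundaryRelation μ ν m ψ') → 0 < s2) ∧
        (PosProd.Aperiodic μ → 0 < s2) := by
  have : NeZero d := ⟨by omega⟩
  have hL := PosProd.memLp_logCol hmom
  obtain ⟨ν, hνp, hν⟩ := PosProd.exists_isInvariant hcontr
  obtain ⟨lam, ψ, h⟩ := PosProd.exists_isCorrector hcontr hL hν
  obtain ⟨K, hK⟩ := h.lipschitz_condVariance hL
  obtain ⟨u, -, hu⟩ := PosProd.exists_poisson hcontr hν hK
  have hlyap := h.lyapunov_eq hL
  have hs0 : 0 ≤ ∫ x, PosProd.condVariance μ lam ψ x ∂ν :=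
    integral_nonneg fun x => PosProd.condVariance_nonneg μ lam ψ x
  -- Both positivity claims have the same form: the property is refuted when the variance vanishes.
  have hpos : ∀ p : Prop, (∫ x, PosProd.condVariance μ lam ψ x ∂ν = 0 → ¬ p) → p →
      (0 : ℝ≥0) < ⟨∫ x, PosProd.condVariance μ lam ψ x ∂ν, hs0⟩ := fun p hp hp' =>
    NNReal.coe_pos.1 (lt_of_le_of_ne hs0 fun h0 => hp h0.symm hp')
  refine ⟨ν, hνp, hν, fun ν' _ hν' => hν.unique hcontr hν', ⟨_, hs0⟩, ψ, ?_,
    hpos _ fun h0 hn => hn ⟨1, le_rfl, ψ, ψ.continuous, h.coboundaryRelation hL hν h0 1⟩,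
    hpos _ (h.not_aperiodic hcontr hL hν)⟩
  intro Ω _ P _ Y W hY hW hlaw hlawW hind hWY
  have hA := PosProd.measurable_leftProd hY
  have hAW (n : ℕ) : Measurable fun ω => (PosProd.leftProd Y n ω, W ω) := (hA n).prodMk hW
  have hmapA := PosProd.map_leftProd_left hY hW hlaw hlawW hind hWY
  have hmap := PosProd.map_leftProd hY hW hlaw hlawW hind hWY
  have hopm : Measurable (PosProd.opNorm (d := d)) := PosProd.measurable_opNorm
  rw [hlyap]
  refine ⟨⟨fun n => ?_, ?_⟩, fun n => ?_, ?_, ?_, ?_⟩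
  · have := PosProd.integrable_log_opNorm hL n
    rw [← hmapA n, integrable_map_measure hopm.log.aestronglyMeasurable (hA n).aemeasurable] at this
    exact this
  · refine (h.tendsto_integral_opNorm hL).congr fun n => ?_
    rw [← hmapA n, integral_map (hA n).aemeasurable
      (Measurable.aestronglyMeasurable (by fun_prop))]
  · have := PosProd.memLp_sigma_convPow (η := ν) hL n
    rw [← hmap n, memLp_map_measure_iff (Measurable.aestronglyMeasurable (by fun_prop))
      (hAW n).aemeasurable] at this
    exact this
  · refine (h.tendsto_integral_sq hL hν).congr fun n => ?_
    rw [← hmap n, integral_map (hAW n).aemeasurable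
      (Measurable.aestronglyMeasurable (by fun_prop))]
  · exact h.tendstoInDistribution hL hu hY hW hlaw hind hWY
  · exact h.martingale hL hlaw hind hWY
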